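/- Let $N\ge 2$ be an integer, $M\in\frac12\mathbb N_0$, and $a,b,\omega\in\mathbb R$; all indices in $\{1,\dots,N\}$ are cyclic ($N+1\equiv1$, $0\equiv N$). Let $\Sigma$ be the complex spin space with basis $|s_1,\dots,s_N\rangle$, $s_i\in\{-M,-M+1,\dots,M\}$, let $S_{ij}$ be the operator on $\Sigma$ exchanging $s_i$ and $s_j$, let $K_{ij}$ be the operator on functions exchanging the $i$-th and the $j$-th coordinate, and let $\Lambda$ be the projection onto the states that are symmetric under simultaneous permutations of coordinates and spins. Write $\Lambda(z_1z_2|s\rangle)=\sum_{i<j}z_iz_j|s_{ij}\rangle$ with $|s_{ij}\rangle=|s_{ji}\rangle\in\Sigma$, and let $\Sigma'\subset\Sigma$ be the space of those $|s\rangle$ for which $\sum_i|s_{i,i+1}\rangle$ is invariant under all permutations of the spins. Put $\sigma_k=\sum_iz_i^k$ and $\tau_k=\sum_{i_1<\dots<i_k}z_{i_1}\cdots z_{i_k}$. For $\epsilon=0,1,2$ let $$T_\epsilon=\sum_iz_i^\epsilon\partial_{z_i}^2+2a\sum_i\frac{z_i^\epsilon\partial_{z_i}-z_{i+1}^\epsilon\partial_{z_{i+1}}}{z_i-z_{i+1}}-2a\sum_i\frac{\vartheta_\epsilon(z_i,z_{i+1})}{(z_i-z_{i+1})^2}(1-K_{i,i+1}),$$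 with $\vartheta_0=1$, $\vartheta_1(x,y)=\frac12(x+y)$, $\vartheta_2(x,y)=xy$, and let $\overline H_\epsilon=cT_\epsilon+c_-\sum_i\partial_{z_i}+c_0\sum_iz_i\partial_{z_i}+E_0$ with $(c,c_-,c_0,E_0)$ equal to $(-1,\,0,\,2\omega,\,N\omega(2a+1))$ for $\epsilon=0$, to $(-4,\,-2(2b+1),\,4\omega,\,N\omega(4a+2b+1))$ for $\epsilon=1$, and to $(4,\,0,\,4(1-2a),\,2Na^2)$ for $\epsilon=2$. The operator $\overline H_\epsilon$ acts on $\mathbb C[z_1,\dots,z_N]\otimes\Sigma$ through the first factor (a priori with values in rational functions). For $n\ge0$ define linear spaces $\overline{\mathcal H}{}^n_\epsilon\subset\mathbb C[z_1,\dots,z_N]\otimes\Sigma$ as follows. Here $f,g,h,\tilde h,q$ are polynomials in the indicated arguments, regarded as independent variables, subscripts denote partial derivatives with respect to $\sigma_k$ ($k=1,2,3$) or $\tau_k$ ($k=N-1,N$), $|s\rangle\in\Sigma$ and $|s'\rangle\in\Sigma'$ are arbitrary, $\deg$ is the total degree in $z$, and $\deg f\le n$, $\deg g\le n-1$, $\deg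 h\le n-2$, $\deg\tilde h\le n-2$, $\deg q\le n-N+1$: - $\overline{\mathcal H}{}^n_0$ is spanned by the states $f(\sigma_1,\sigma_2,\sigma_3)\Lambda|s\rangle$, $g(\sigma_1,\sigma_2,\sigma_3)\Lambda(z_1|s\rangle)$, $h(\sigma_1,\sigma_2)\Lambda(z_1^2|s\rangle)$, $\tilde h(\sigma_1,\sigma_2)\Lambda(z_1z_2|s'\rangle)$ with $f_{33}=g_{33}=0$; - $\overline{\mathcal H}{}^n_1$ is spanned by the states $f(\sigma_1,\sigma_2,\tau_N)\Lambda|s\rangle$, $g(\sigma_1,\tau_N)\Lambda(z_1|s\rangle)$ with $f_{22}=0$ and $f_N=g_N=0$; - $\overline{\mathcal H}{}^n_2$ is spanned by the states $f(\sigma_1,\tau_{N-1},\tau_N)\Lambda|s\rangle$, $g(\tau_{N-1},\tau_N)\Lambda(z_1|s\rangle)$, $\tau_Nq(\sigma_1,\tau_N)\Lambda(z_1^{-1}|s\rangle)$ with $f_{11}=f_{N-1,N-1}=g_{N-1,N-1}=q_{11}=0$. Then for every $\epsilon\in\{0,1,2\}$ and every $n\ge 0$: 1. $\overline H_\epsilon$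 maps $\overline{\mathcal H}{}^n_\epsilon$ into itself. 2. Let $H_\epsilon=-\sum_i\partial_{x_i}^2+V_\epsilon$, where, with $r^2=\sum_ix_i^2$, $$V_0=\omega^2r^2+\sum_i\frac{2a^2}{(x_i-x_{i-1})(x_i-x_{i+1})}+\sum_i\frac{2a}{(x_i-x_{i+1})^2}(a-S_{i,i+1}),$$ $$V_1=\omega^2r^2+\sum_i\frac{b(b-1)}{x_i^2}+\sum_i\frac{8a^2x_i^2}{(x_i^2-x_{i-1}^2)(x_i^2-x_{i+1}^2)}+4a\sum_i\frac{x_i^2+x_{i+1}^2}{(x_i^2-x_{i+1}^2)^2}(a-S_{i,i+1}),$$ $$V_2=2a^2\sum_i\cot(x_i-x_{i-1})\cot(x_i-x_{i+1})+2a\sum_i\csc^2(x_i-x_{i+1})(a-S_{i,i+1}),$$ on the set $C_\epsilon$ of all real $x_1<\dots<x_N$, with in addition $x_1>0$ for $\epsilon=1$ and $\sin|x_i-x_{i+1}|>0$ for all $i$ for $\epsilon=2$. Let $\mu$ be $e^{-\omega r^2/2}\prod_i|x_i-x_{i+1}|^a$, $e^{-\omega r^2/2}\prod_i|x_i^2-x_{i+1}^2|^ax_i^b$,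 $\prod_i\sin^a|x_i-x_{i+1}|$, and let $\zeta(x)$ be $x$, $x^2$, $e^{\pm2\mathrm ix}$ (either sign), for $\epsilon=0,1,2$ respectively. Then for all $\Phi\in\overline{\mathcal H}{}^n_\epsilon$, $$H_\epsilon\big(\mu\,\Phi|_{z_i=\zeta(x_i)}\big)=\mu\,(\overline H_\epsilon\Phi)|_{z_i=\zeta(x_i)}\quad\text{on }C_\epsilon .$$ 3. Consequently, if $0\ne\Phi\in\overline{\mathcal H}{}^n_\epsilon$ and $\overline H_\epsilon\Phi=E\Phi$ with $E\in\mathbb C$, then $\Psi=\mu\,\Phi|_{z_i=\zeta(x_i)}$ is smooth and not identically zero on $C_\epsilon$ and satisfies $H_\epsilon\Psi=E\Psi$ there. -/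

import Mathlib

open scoped BigOperators

namespace QES

noncomputable section

/-! ### Spin space, spin-valued polynomials, symmetrizer -/

/-- Labels `(s_1, …, s_N)` of the basis vectors `|s_1, …, s_N⟩` for `N` particles of spin `M`, where
`k = 2M`; the `k + 1 = 2M + 1` values `-M, -M+1, …, M` are numbered `0, …, k`. -/
abbrev Config (N k : ℕ) : Type := Fin N → Fin (k + 1)

/-- The spin space `Σ`, in coordinates with respect to the basis `|s_1, …, s_N⟩`. -/
abbrev Spin (N k : ℕ) : Type := Config N k → ℂ

/-- The action of permutations on the spin space: `|s⟩ ↦ |s ∘ π⁻¹⟩` (the spin of particle `i` is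
moved to particle `π i`). -/
def spinPerm {N k : ℕ} (π : Equiv.Perm (Fin N)) (v : Spin N k) : Spin N k :=
  fun s => v (fun i => s (π i))

/-- The spin exchange operator `S_{ij}`. -/
def spinExchange {N k : ℕ} (i j : Fin N) (v : Spin N k) : Spin N k :=
  spinPerm (Equiv.swap i j) v

/-- Complex polynomials in `z_1, …, z_N`. -/
abbrev Poly (N : ℕ) : Type := MvPolynomial (Fin N) ℂ

/-- Rational functions in `z_1, …, z_N`. -/
abbrev RatFun (N : ℕ) : Type := FractionRing (Poly N)

/-- `ℂ[z_1, …, z_N] ⊗ Σ`: polynomial spin states, in coordinates. -/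
abbrev State (N k : ℕ) : Type := Config N k → Poly N

/-- The decomposable state `p(z) |v⟩`. -/
def prodState {N k : ℕ} (p : Poly N) (v : Spin N k) : State N k :=
  fun s => v s • p

/-- The simultaneous permutation of the coordinates (`z_i ↦ z_{π i}`) and of the spins. -/
def totalPerm {N k : ℕ} (π : Equiv.Perm (Fin N)) (Φ : State N k) : State N k :=
  fun s => MvPolynomial.rename π (Φ (fun i => s (π i)))

/-- The projection `Λ` on the totally symmetric states. -/
def symmetrize {N k : ℕ} (Φ : State N k) : State N k :=
  ((N.factorial : ℂ)⁻¹) • ∑ π : Equiv.Perm (Fin N), totalPerm π Φ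

/-- For `i ≠ j`, the spin vector `|s_{ij}⟩`, that is, the coefficient of `z_i z_j` in
`Λ(z_1 z_2 |s⟩)`. -/
def pairSpin {N k : ℕ} [NeZero N] (v : Spin N k) (i j : Fin N) : Spin N k :=
  fun s => MvPolynomial.coeff (Finsupp.single i 1 + Finsupp.single j 1)
    (symmetrize (prodState (MvPolynomial.X 0 * MvPolynomial.X 1) v) s)

/-- Membership in `Σ'`: the spin vector `∑_i |s_{i,i+1}⟩` (cyclic sum) is symmetric. -/
def IsSpecialSpin {N k : ℕ} [NeZero N] (v : Spin N k) : Prop :=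
  ∀ π : Equiv.Perm (Fin N),
    spinPerm π (∑ i : Fin N, pairSpin v i (i + 1)) = ∑ i : Fin N, pairSpin v i (i + 1)

/-! ### The gauge Hamiltonians -/

/-- The inclusion of polynomials in rational functions. -/
def toRat {N : ℕ} (p : Poly N) : RatFun N := algebraMap (Poly N) (RatFun N) p

/-- The functions `ϑ_0(x,y) = 1`, `ϑ_1(x,y) = (x + y)/2`, `ϑ_2(x,y) = x y`. -/
def theta {N : ℕ} (ε : Fin 3) (x y : RatFun N) : RatFun N :=
  match ε with
  | 0 => 1
  | 1 => (x + y) / 2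
  | 2 => x * y

open MvPolynomial in
/-- The differential-difference operator `T_ε` (indices are cyclic: `z_{N+1} = z_1`). -/
def opT {N : ℕ} [NeZero N] (ε : Fin 3) (a : ℝ) (f : Poly N) : RatFun N :=
  toRat (∑ i, X i ^ (ε : ℕ) * pderiv i (pderiv i f))
  + toRat (C (2 * a : ℂ)) *
      ∑ i : Fin N, toRat (X i ^ (ε : ℕ) * pderiv i f - X (i + 1) ^ (ε : ℕ) * pderiv (i + 1) f)
        / (toRat (X i) - toRat (X (i + 1)))
  - toRat (C (2 * a : ℂ)) *
      ∑ i : Fin N, theta ε (toRat (X i)) (toRat (X (i + 1)))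
        / (toRat (X i) - toRat (X (i + 1))) ^ 2
        * toRat (f - rename (Equiv.swap i (i + 1)) f)

/-- `J^- = ∑_i ∂_i`. -/
def opJminus {N : ℕ} (f : Poly N) : Poly N := ∑ i, MvPolynomial.pderiv i f

/-- `J^0 = ∑_i z_i ∂_i`. -/
def opJzero {N : ℕ} (f : Poly N) : Poly N :=
  ∑ i, MvPolynomial.X i * MvPolynomial.pderiv i f

/-- The constant `c`. -/
def constC (ε : Fin 3) : ℝ :=
  match ε with
  | 0 => -1
  | 1 => -4
  | 2 => 4

/-- The constant `c_-`. -/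
def constMinus (ε : Fin 3) (b : ℝ) : ℝ :=
  match ε with
  | 0 => 0
  | 1 => -2 * (2 * b + 1)
  | 2 => 0

/-- The constant `c_0`. -/
def constZero (ε : Fin 3) (a ω : ℝ) : ℝ :=
  match ε with
  | 0 => 2 * ω
  | 1 => 4 * ω
  | 2 => 4 * (1 - 2 * a)

/-- The constant `E_0`. -/
def constE (ε : Fin 3) (N : ℕ) (a b ω : ℝ) : ℝ :=
  match ε with
  | 0 => N * ω * (2 * a + 1)
  | 1 => N * ω * (4 * a + 2 * b + 1)
  | 2 => 2 * N * a ^ 2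

open MvPolynomial in
/-- The gauge Hamiltonian `c T_ε + c_- J^- + c_0 J^0 + E_0` on polynomials. -/
def gaugeHam {N : ℕ} [NeZero N] (ε : Fin 3) (a b ω : ℝ) (f : Poly N) : RatFun N :=
  toRat (C (constC ε : ℂ)) * opT ε a f
  + toRat (C (constMinus ε b : ℂ) * opJminus f)
  + toRat (C (constZero ε a ω : ℂ) * opJzero f)
  + toRat (C (constE ε N a b ω : ℂ) * f)

/-- `GaugeMaps ε a b ω Φ Ψ`: the gauge Hamiltonian maps the state `Φ` to the state `Ψ`
(it acts trivially on spin, i.e. componentwise). -/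
def GaugeMaps {N k : ℕ} [NeZero N] (ε : Fin 3) (a b ω : ℝ) (Φ Ψ : State N k) : Prop :=
  ∀ s, gaugeHam ε a b ω (Φ s) = toRat (Ψ s)

/-! ### The invariant spaces -/

/-- `σ_j = ∑_i z_i ^ j`. -/
def sigma (N j : ℕ) : Poly N := MvPolynomial.psum (Fin N) ℂ j

/-- `τ_j`, the `j`-th elementary symmetric polynomial. -/
def tau (N j : ℕ) : Poly N := MvPolynomial.esymm (Fin N) ℂ j

/-- The polynomial `τ_N / z_1`. -/
def tauOverFirst (N : ℕ) [NeZero N] : Poly N :=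
  ∏ i ∈ Finset.univ.erase (0 : Fin N), MvPolynomial.X i

/-- Substitution `f(p_0, p_1, …)` of polynomials in `z` into a formal polynomial `f`. -/
def substPoly {N m : ℕ} (p : Fin m → Poly N) (f : MvPolynomial (Fin m) ℂ) : Poly N :=
  MvPolynomial.aeval p f

open MvPolynomial in
/-- The space for `ε = 0`. The variables of `f`, `g` are `σ_1, σ_2, σ_3`, those of `h` are
`σ_1, σ_2`. -/
def space0 (N k n : ℕ) [NeZero N] : Submodule ℂ (State N k) :=
  Submodule.span ℂ (
    {Φ | ∃ (f : MvPolynomial (Fin 3) ℂ) (v : Spin N k),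
      pderiv 2 (pderiv 2 f) = 0 ∧
      (substPoly ![sigma N 1, sigma N 2, sigma N 3] f).totalDegree ≤ n ∧
      Φ = fun s => substPoly ![sigma N 1, sigma N 2, sigma N 3] f * symmetrize (prodState 1 v) s} ∪
    {Φ | ∃ (g : MvPolynomial (Fin 3) ℂ) (v : Spin N k),
      pderiv 2 (pderiv 2 g) = 0 ∧
      (substPoly ![sigma N 1, sigma N 2, sigma N 3] g).totalDegree + 1 ≤ n ∧
      Φ = fun s => substPoly ![sigma N 1, sigma N 2, sigma N 3] g * symmetrize (prodState (X 0) v) s} ∪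
    {Φ | ∃ (h : MvPolynomial (Fin 2) ℂ) (v : Spin N k),
      (substPoly ![sigma N 1, sigma N 2] h).totalDegree + 2 ≤ n ∧
      Φ = fun s => substPoly ![sigma N 1, sigma N 2] h * symmetrize (prodState (X 0 ^ 2) v) s} ∪
    {Φ | ∃ (h : MvPolynomial (Fin 2) ℂ) (v : Spin N k),
      IsSpecialSpin v ∧
      (substPoly ![sigma N 1, sigma N 2] h).totalDegree + 2 ≤ n ∧
      Φ = fun s => substPoly ![sigma N 1, sigma N 2] h * symmetrize (prodState (X 0 * X 1) v) s})

open MvPolynomial in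
/-- The space for `ε = 1`. The variables of `f` are `σ_1, σ_2, τ_N`, those of `g` are
`σ_1, τ_N`; `f` and `g` are restricted by `∂f/∂τ_N = ∂g/∂τ_N = 0`, which makes the conditions
`∂²f/∂τ_N² = ∂²g/∂τ_N² = 0` automatic. -/
def space1 (N k n : ℕ) [NeZero N] : Submodule ℂ (State N k) :=
  Submodule.span ℂ (
    {Φ | ∃ (f : MvPolynomial (Fin 3) ℂ) (v : Spin N k),
      pderiv 1 (pderiv 1 f) = 0 ∧ pderiv 2 f = 0 ∧
      (substPoly ![sigma N 1, sigma N 2, tau N N] f).totalDegree ≤ n ∧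
      Φ = fun s => substPoly ![sigma N 1, sigma N 2, tau N N] f * symmetrize (prodState 1 v) s} ∪
    {Φ | ∃ (g : MvPolynomial (Fin 2) ℂ) (v : Spin N k),
      pderiv 1 g = 0 ∧
      (substPoly ![sigma N 1, tau N N] g).totalDegree + 1 ≤ n ∧
      Φ = fun s => substPoly ![sigma N 1, tau N N] g * symmetrize (prodState (X 0) v) s})

open MvPolynomial in
/-- The space for `ε = 2`. The variables of `f` are `σ_1, τ_{N-1}, τ_N`, those of `g` are
`τ_{N-1}, τ_N`, those of `q` are `σ_1, τ_N`. The last family is `τ_N q Λ(z_1⁻¹ |s⟩)`, where the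
symmetric factor `τ_N` has been moved inside `Λ`. -/
def space2 (N k n : ℕ) [NeZero N] : Submodule ℂ (State N k) :=
  Submodule.span ℂ (
    {Φ | ∃ (f : MvPolynomial (Fin 3) ℂ) (v : Spin N k),
      pderiv 0 (pderiv 0 f) = 0 ∧ pderiv 1 (pderiv 1 f) = 0 ∧
      (substPoly ![sigma N 1, tau N (N - 1), tau N N] f).totalDegree ≤ n ∧
      Φ = fun s => substPoly ![sigma N 1, tau N (N - 1), tau N N] f * symmetrize (prodState 1 v) s} ∪
    {Φ | ∃ (g : MvPolynomial (Fin 2) ℂ) (v : Spin N k),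
      pderiv 0 (pderiv 0 g) = 0 ∧
      (substPoly ![tau N (N - 1), tau N N] g).totalDegree + 1 ≤ n ∧
      Φ = fun s => substPoly ![tau N (N - 1), tau N N] g * symmetrize (prodState (X 0) v) s} ∪
    {Φ | ∃ (q : MvPolynomial (Fin 2) ℂ) (v : Spin N k),
      pderiv 0 (pderiv 0 q) = 0 ∧
      (substPoly ![sigma N 1, tau N N] q).totalDegree + N ≤ n + 1 ∧
      Φ = fun s => substPoly ![sigma N 1, tau N N] q * symmetrize (prodState (tauOverFirst N) v) s})

/-- The space `H̄_ε^n`. -/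
def invSpace (N k n : ℕ) [NeZero N] (ε : Fin 3) : Submodule ℂ (State N k) :=
  match ε with
  | 0 => space0 N k n
  | 1 => space1 N k n
  | 2 => space2 N k n

/-! ### The physical Hamiltonians -/

/-- The configuration spaces. For `ε = 2` the poles of the potential, i.e. the points at which
some `sin (x_i - x_{i+1})` vanishes, are excluded, as well as the points at which some
`sin |x_i - x_{i+1}|` is negative, where the gauge factor would not be defined. -/
def configSpace (N : ℕ) [NeZero N] (ε : Fin 3) : Set (Fin N → ℝ) :=
  match ε with
  | 0 => {x | StrictMono x}
  | 1 => {x | StrictMono x ∧ 0 < x 0}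
  | 2 => {x | StrictMono x ∧ ∀ i, 0 < Real.sin |x i - x (i + 1)|}

/-- The potential `V_ε(x)`, an operator on the spin space (indices are cyclic). -/
def potential {N k : ℕ} [NeZero N] (ε : Fin 3) (a b ω : ℝ) (x : Fin N → ℝ) (v : Spin N k) :
    Spin N k :=
  match ε with
  | 0 => ((ω ^ 2 * ∑ i, x i ^ 2
        + ∑ i, 2 * a ^ 2 / ((x i - x (i - 1)) * (x i - x (i + 1))) : ℝ) : ℂ) • v
      + ∑ i, ((2 * a / (x i - x (i + 1)) ^ 2 : ℝ) : ℂ)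
          • ((a : ℂ) • v - spinExchange i (i + 1) v)
  | 1 => ((ω ^ 2 * ∑ i, x i ^ 2 + ∑ i, b * (b - 1) / x i ^ 2
        + ∑ i, 8 * a ^ 2 * x i ^ 2
            / ((x i ^ 2 - x (i - 1) ^ 2) * (x i ^ 2 - x (i + 1) ^ 2)) : ℝ) : ℂ) • v
      + ∑ i, ((4 * a * ((x i ^ 2 + x (i + 1) ^ 2) / (x i ^ 2 - x (i + 1) ^ 2) ^ 2) : ℝ) : ℂ)
          • ((a : ℂ) • v - spinExchange i (i + 1) v)
  | 2 => ((2 * a ^ 2 * ∑ i, Real.cot (x i - x (i - 1)) * Real.cot (x i - x (i + 1)) : ℝ) : ℂ) • v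
      + ∑ i, ((2 * a / Real.sin (x i - x (i + 1)) ^ 2 : ℝ) : ℂ)
          • ((a : ℂ) • v - spinExchange i (i + 1) v)

/-- The second partial derivative `∂²Ψ/∂x_i²` of a spin-valued function. -/
def secondPartial {N k : ℕ} (i : Fin N) (Ψ : (Fin N → ℝ) → Spin N k) (x : Fin N → ℝ) :
    Spin N k :=
  fun s => iteratedDeriv 2 (fun t : ℝ => Ψ (Function.update x i t) s) (x i)

/-- The Hamiltonian `H_ε = -∑_i ∂²/∂x_i² + V_ε`. -/
def ham {N k : ℕ} [NeZero N] (ε : Fin 3) (a b ω : ℝ) (Ψ : (Fin N → ℝ) → Spin N k)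
    (x : Fin N → ℝ) : Spin N k :=
  -(∑ i, secondPartial i Ψ x) + potential ε a b ω x (Ψ x)

/-- The gauge factor `μ`. -/
def gaugeFactor {N : ℕ} [NeZero N] (ε : Fin 3) (a b ω : ℝ) (x : Fin N → ℝ) : ℝ :=
  match ε with
  | 0 => Real.exp (-(ω / 2) * ∑ i, x i ^ 2) * ∏ i, |x i - x (i + 1)| ^ a
  | 1 => Real.exp (-(ω / 2) * ∑ i, x i ^ 2) * ∏ i, (|x i ^ 2 - x (i + 1) ^ 2| ^ a * x i ^ b)
  | 2 => ∏ i, Real.sin |x i - x (i + 1)| ^ a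

/-- The change of variable `ζ`: `x`, `x²`, `exp(± 2 i x)`; the sign `η` is used for `ε = 2`
only. -/
def changeVar (ε : Fin 3) (η : ℤˣ) (x : ℝ) : ℂ :=
  match ε with
  | 0 => (x : ℂ)
  | 1 => (x : ℂ) ^ 2
  | 2 => Complex.exp (((η : ℤ) : ℂ) * 2 * Complex.I * (x : ℂ))

/-- The spin function `μ(x) Φ(ζ(x_1), …, ζ(x_N))` obtained from a polynomial state `Φ`. -/
def physical {N k : ℕ} [NeZero N] (ε : Fin 3) (η : ℤˣ) (a b ω : ℝ) (Φ : State N k)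
    (x : Fin N → ℝ) : Spin N k :=
  fun s => (gaugeFactor ε a b ω x : ℂ) * MvPolynomial.eval (fun i => changeVar ε η (x i)) (Φ s)

/-- `Ψ` is a smooth, not identically zero solution of `H_ε Ψ = E Ψ` on the configuration space. -/
def IsEigenfunction {N k : ℕ} [NeZero N] (ε : Fin 3) (a b ω : ℝ) (E : ℂ)
    (Ψ : (Fin N → ℝ) → Spin N k) : Prop :=
  ContDiffOn ℝ ((⊤ : ℕ∞) : WithTop ℕ∞) Ψ (configSpace N ε) ∧
  (∃ x ∈ configSpace N ε, Ψ x ≠ 0) ∧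
  ∀ x ∈ configSpace N ε, ham ε a b ω Ψ x = E • Ψ x

end

end QES

/-! Invariance. Multiplication by a symmetric polynomial `F` commutes with every exchange
`K_{i,i+1}`. Hence in `T_ε (F φ)` the difference terms see only `φ`, and the operator acts on `F` as
a second-order differential operator whose only coupling with `φ` is `2 ∑ z_i^ε ∂_i F ∂_i φ`. For `F
= f(p_0, p_1, p_2)` the chain rule (`gaugeHam_aeval_mul`) leaves finitely many computations: on the
generators `p_k` and on `φ = 1, z_j, z_j², z_j z_l, τ_N / z_j`. On each of these every Dunkl-type
term is a polynomial, and its cyclic sum, although it runs over neighbours only, is again of the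
available form. The exception is `z_j z_l`, whose cyclic sum counts whether `j` and `l` are
neighbours; after symmetrization this is the spin vector `∑ |s_{i,i+1}⟩`, which `Σ'` requires to be
symmetric. The differential conditions on `f, g, h, q` remove terms that would leave the space, such
as `∑ (∂_i σ_3)² = 9 σ_4`. The operator never raises the degree, so the bounds by `n` survive.

Conjugation. The gauge factor is `∏ α(x_i) β(x_i, x_{i+1})`, with logarithmic derivative `A(x_i) + a
(λ(x_i, x_{i+1}) + λ(x_i, x_{i-1}))` in `x_i`. Its square has a cross term, which is the three-body
potential; all the rest splits into identities in one or two real variables. These are collected in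
`LocalModel`, proved for three models, and assembled in `LocalModel.ham_physical`. The spin exchange
enters because `K_{ij}` and `S_{ij}` agree on totally symmetric states
(`rename_swap_of_mem_symmetricStates`).

Eigenfunctions. The gauge factor is smooth and nonzero on the configuration space, and this space
contains a box on which `ζ` is injective in each coordinate. A polynomial vanishing on a product of
infinite sets is zero, so a nonzero `Φ` gives a nonzero `Ψ`. -/

namespace QES

open MvPolynomial

/-! ### Formal polynomials: exponents, weights, substitution. -/

section

/-- A monomial of exponent `d` becomes homogeneous of degree `∑ w k * d k`, so the monomials of
weight above `n` contribute only to the components of degree above `n`, which vanish; they can be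
discarded. They may be present in `f`, since the `p k` may be algebraically dependent (for `N = 2`,
`σ_3` is a polynomial in `σ_1, σ_2`). The support of the new polynomial stays inside that of `f`, so
conditions on exponents survive. -/
theorem aeval_eq_of_totalDegree_le {N m n : ℕ} {p : Fin m → Poly N} {w : Fin m → ℕ}
    (hp : ∀ k, (p k).IsHomogeneous (w k)) (f : MvPolynomial (Fin m) ℂ)
    (hf : (aeval p f).totalDegree ≤ n) :
    ∃ g : MvPolynomial (Fin m) ℂ, aeval p g = aeval p f ∧
      ∀ d ∈ g.support, d ∈ f.support ∧ ∑ k, w k * d k ≤ n := by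
  classical
  have hmon : ∀ (d : Fin m →₀ ℕ) (c : ℂ), (aeval p (monomial d c)).IsHomogeneous (∑ k, w k * d k) := by
    intro d c
    rw [aeval_monomial, Finsupp.prod_fintype _ _ (by simp)]
    rw [MvPolynomial.algebraMap_eq]
    exact (IsHomogeneous.prod _ _ _ fun k _ => (hp k).pow (d k)).C_mul c
  refine ⟨∑ d ∈ f.support with ∑ k, w k * d k ≤ n, monomial d (coeff d f), ?_, ?_⟩
  · conv_rhs => rw [← sum_homogeneousComponent (aeval p f)]
    -- The component of degree `j` collects exactly the monomials of weight `j`.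
    have key : ∀ j, homogeneousComponent j (aeval p f) =
        ∑ d ∈ f.support with ∑ k, w k * d k = j, aeval p (monomial d (coeff d f)) := by
      intro j
      conv_lhs => rw [f.as_sum, map_sum, map_sum]
      rw [Finset.sum_filter]
      refine Finset.sum_congr rfl fun d _ => ?_
      simp only [homogeneousComponent_of_mem (hmon d _), eq_comm]
    have h2 : ∑ j ∈ Finset.range ((aeval p f).totalDegree + 1), homogeneousComponent j (aeval p f)
        = ∑ j ∈ Finset.range (n + 1), homogeneousComponent j (aeval p f) := by
      refine Finset.sum_subset (Finset.range_mono (by omega)) fun j _ hj => ?_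
      exact homogeneousComponent_eq_zero _ _ (by simpa using hj)
    rw [h2, Finset.sum_congr rfl fun j _ => key j, map_sum, Finset.sum_filter]
    simp_rw [Finset.sum_filter]
    rw [Finset.sum_comm]
    refine Finset.sum_congr rfl fun d _ => ?_
    rw [Finset.sum_ite_eq]
    simp
  · intro d hd
    rw [mem_support_iff, coeff_sum] at hd
    obtain ⟨e, he, hne⟩ := Finset.exists_ne_zero_of_sum_ne_zero hd
    rw [coeff_monomial] at hne
    split_ifs at hne with h
    · subst h
      simpa using he
    · exact absurd rfl hne

/-- All exponents of `f` satisfy `P`. -/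
def SuppIn {m : ℕ} (P : (Fin m → ℕ) → Prop) (f : MvPolynomial (Fin m) ℂ) : Prop :=
  ∀ d ∈ f.support, P d

theorem SuppIn.pderiv {m : ℕ} {P : (Fin m → ℕ) → Prop} {f : MvPolynomial (Fin m) ℂ}
    (hf : SuppIn P f) (i : Fin m) :
    SuppIn (fun d => P (d + Pi.single i 1)) (MvPolynomial.pderiv i f) := by
  intro d hd
  rw [mem_support_iff, coeff_pderiv] at hd
  have := hf (d + Finsupp.single i 1) (by
    rw [mem_support_iff]; intro h; simp [h] at hd)
  rwa [Finsupp.coe_add, Finsupp.single_eq_pi_single] at this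

theorem SuppIn.X_mul {m : ℕ} {P : (Fin m → ℕ) → Prop} {f : MvPolynomial (Fin m) ℂ}
    (hf : SuppIn P f) (i : Fin m) :
    SuppIn (fun d => ∃ e, d = e + Pi.single i 1 ∧ P e) (X i * f) := by
  classical
  intro d hd
  rw [mem_support_iff, coeff_X_mul'] at hd
  split_ifs at hd with h
  · refine ⟨_, ?_, hf _ (mem_support_iff.2 hd)⟩
    rw [← Finsupp.single_eq_pi_single, ← Finsupp.coe_add]
    congr 1
    rw [tsub_add_cancel_of_le]
    simpa [Finsupp.single_le_iff, Nat.one_le_iff_ne_zero] using h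
  · exact absurd rfl hd

theorem SuppIn.mono {m : ℕ} {P Q : (Fin m → ℕ) → Prop} {f : MvPolynomial (Fin m) ℂ}
    (hf : SuppIn P f) (h : ∀ d, P d → Q d) : SuppIn Q f :=
  fun d hd => h _ (hf d hd)

theorem SuppIn.C_mul {m : ℕ} {P : (Fin m → ℕ) → Prop} {f : MvPolynomial (Fin m) ℂ}
    (hf : SuppIn P f) (c : ℂ) : SuppIn P (C c * f) := by
  intro d hd
  rw [mem_support_iff, coeff_C_mul] at hd
  exact hf d (mem_support_iff.2 (right_ne_zero_of_mul hd))

/-- Characteristic zero: a coefficient of `∂_i f` is a nonzero integer times a coefficient of `f`.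
This lemma and the next three translate conditions like `f_33 = 0` into bounds on exponents and
back. -/
theorem suppIn_of_pderiv_eq_zero {m : ℕ} {f : MvPolynomial (Fin m) ℂ} {i : Fin m}
    (h : MvPolynomial.pderiv i f = 0) : SuppIn (fun d => d i = 0) f := by
  intro d hd
  by_contra h0
  have h1 := coeff_pderiv (i := i) f (d - Finsupp.single i 1)
  rw [h, coeff_zero, tsub_add_cancel_of_le (by
    simpa [Finsupp.single_le_iff, Nat.one_le_iff_ne_zero] using h0)] at h1
  have h2 := mem_support_iff.1 hd
  rcases mul_eq_zero.1 h1.symm with h3 | h3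
  · exact h2 h3
  · exact absurd h3 (by exact Nat.cast_add_one_ne_zero _)

theorem suppIn_of_pderiv_pderiv_eq_zero {m : ℕ} {f : MvPolynomial (Fin m) ℂ} {i : Fin m}
    (h : MvPolynomial.pderiv i (MvPolynomial.pderiv i f) = 0) : SuppIn (fun d => d i ≤ 1) f := by
  intro d hd
  by_contra h0
  have h1 := suppIn_of_pderiv_eq_zero h (d - Finsupp.single i 1) (by
    rw [mem_support_iff, coeff_pderiv, tsub_add_cancel_of_le (by
      simp [Finsupp.single_le_iff]; omega)]
    exact mul_ne_zero (mem_support_iff.1 hd) (by exact Nat.cast_add_one_ne_zero _))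
  simp at h1
  omega

theorem pderiv_eq_zero_of_suppIn {m : ℕ} {f : MvPolynomial (Fin m) ℂ} {i : Fin m}
    (h : SuppIn (fun d => d i = 0) f) : MvPolynomial.pderiv i f = 0 := by
  ext d
  rw [coeff_pderiv, coeff_zero]
  by_contra h0
  have := h _ (mem_support_iff.2 (left_ne_zero_of_mul h0))
  simp at this

theorem pderiv_pderiv_eq_zero_of_suppIn {m : ℕ} {f : MvPolynomial (Fin m) ℂ} {i : Fin m}
    (h : SuppIn (fun d => d i ≤ 1) f) : MvPolynomial.pderiv i (MvPolynomial.pderiv i f) = 0 :=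
  pderiv_eq_zero_of_suppIn ((h.pderiv i).mono fun d hd => by simp at hd; omega)

/-- For `f = 0` the condition on the support is vacuous and the claim is just `c ≤ n`; hence `hc`.
-/
theorem totalDegree_aeval_le {N m n c : ℕ} {p : Fin m → Poly N} {w : Fin m → ℕ}
    (hp : ∀ k, (p k).IsHomogeneous (w k)) {f : MvPolynomial (Fin m) ℂ}
    (hf : SuppIn (fun d => ∑ k, w k * d k + c ≤ n) f) (hc : c ≤ n) :
    (aeval p f).totalDegree + c ≤ n := by
  classical
  have : (aeval p f).totalDegree ≤ n - c := by
    rw [f.as_sum, map_sum]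
    refine totalDegree_finsetSum_le fun d hd => ?_
    rw [aeval_monomial, Finsupp.prod_fintype _ _ (by simp), MvPolynomial.algebraMap_eq]
    refine (((IsHomogeneous.prod _ _ _ fun k _ => (hp k).pow (d k)).C_mul _).totalDegree_le).trans ?_
    have := hf d hd
    simp only at this
    omega
  omega

theorem pderiv_aeval {N m : ℕ} (p : Fin m → Poly N) (f : MvPolynomial (Fin m) ℂ) (i : Fin N) :
    MvPolynomial.pderiv i (aeval p f) =
      ∑ k, aeval p (MvPolynomial.pderiv k f) * MvPolynomial.pderiv i (p k) := by
  induction f using MvPolynomial.induction_on with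
  | C c => simp
  | add f g hf hg => simp only [map_add, hf, hg, add_mul, Finset.sum_add_distrib]
  | mul_X f j hf =>
    have h : ∀ k, aeval p (MvPolynomial.pderiv k (f * X j)) * MvPolynomial.pderiv i (p k) =
        (if k = j then aeval p f * MvPolynomial.pderiv i (p k) else 0)
        + p j * (aeval p (MvPolynomial.pderiv k f) * MvPolynomial.pderiv i (p k)) := by
      intro k
      simp only [Derivation.leibniz, smul_eq_mul, pderiv_X, map_add, map_mul, aeval_X]
      by_cases hk : k = j
      · subst hk; simp only [Pi.single_eq_same, map_one, if_true]; ring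
      · rw [Pi.single_eq_of_ne (Ne.symm hk)]; simp only [map_zero, hk, if_false]; ring
    rw [Finset.sum_congr rfl fun k _ => h k, Finset.sum_add_distrib, ← Finset.mul_sum, ← hf]
    simp [Derivation.leibniz]

end

/-! ### The gauge Hamiltonian on products with symmetric functions. -/

noncomputable section

theorem toRat_add {N : ℕ} (p q : Poly N) : toRat (p + q) = toRat p + toRat q := map_add _ _ _
theorem toRat_sub {N : ℕ} (p q : Poly N) : toRat (p - q) = toRat p - toRat q := map_sub _ _ _
theorem toRat_mul {N : ℕ} (p q : Poly N) : toRat (p * q) = toRat p * toRat q := map_mul _ _ _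
theorem toRat_pow {N : ℕ} (p : Poly N) (n : ℕ) : toRat (p ^ n) = toRat p ^ n := map_pow _ _ _
theorem toRat_sum {N : ℕ} {ι : Type*} (s : Finset ι) (p : ι → Poly N) :
    toRat (∑ i ∈ s, p i) = ∑ i ∈ s, toRat (p i) := map_sum (algebraMap (Poly N) (RatFun N)) _ _
theorem toRat_zero {N : ℕ} : toRat (0 : Poly N) = 0 := map_zero _
theorem toRat_one {N : ℕ} : toRat (1 : Poly N) = 1 := map_one _
theorem toRat_injective {N : ℕ} : Function.Injective (toRat (N := N)) :=
  IsFractionRing.injective (Poly N) (RatFun N)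

/-- `ϑ_ε` as a polynomial. -/
def thetaPoly {N : ℕ} (ε : Fin 3) (x y : Poly N) : Poly N :=
  match ε with
  | 0 => 1
  | 1 => C (1 / 2) * (x + y)
  | 2 => x * y

theorem toRat_thetaPoly {N : ℕ} (ε : Fin 3) (x y : Poly N) :
    toRat (thetaPoly ε x y) = theta ε (toRat x) (toRat y) := by
  have h2 : toRat (C (1 / 2 : ℂ) : Poly N) = 1 / 2 := by
    have : (C (1 / 2 : ℂ) : Poly N) * 2 = 1 := by
      rw [show (2 : Poly N) = C 2 from (map_ofNat C 2).symm, ← C_mul]; norm_num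
    have h := congrArg toRat this
    rw [toRat_mul, toRat_one, show toRat (2 : Poly N) = 2 from map_ofNat _ 2] at h
    rw [eq_div_iff two_ne_zero, h]
  fin_cases ε
  · exact toRat_one
  · change toRat (C (1 / 2) * (x + y)) = (toRat x + toRat y) / 2
    rw [toRat_mul, toRat_add, h2]; ring
  · exact toRat_mul x y

variable {N : ℕ} [NeZero N]

theorem fin_ne_add_one (hN : 2 ≤ N) (i : Fin N) : i ≠ i + 1 := by
  intro h
  have h1 : (1 : Fin N) = 0 := by simpa using h.symm
  have := congrArg Fin.val h1
  rw [Fin.val_one', Nat.mod_eq_of_lt (by omega)] at this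
  simp at this

theorem X_sub_X_ne_zero (hN : 2 ≤ N) (i : Fin N) : (X i - X (i + 1) : Poly N) ≠ 0 := by
  rw [sub_ne_zero]
  exact fun h => fin_ne_add_one hN i (X_injective h)

/-- `∑_i z_i^ε ∂_i²`. -/
def opDelta (ε : Fin 3) (f : Poly N) : Poly N :=
  ∑ i, X i ^ (ε : ℕ) * pderiv i (pderiv i f)

/-- `∑_i z_i^ε ∂_i f ∂_i g`. -/
def opGamma (ε : Fin 3) (f g : Poly N) : Poly N :=
  ∑ i, X i ^ (ε : ℕ) * pderiv i f * pderiv i g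

/-- `z_i^ε ∂_i - z_{i+1}^ε ∂_{i+1}`. -/
def pairDiff (ε : Fin 3) (i : Fin N) (f : Poly N) : Poly N :=
  X i ^ (ε : ℕ) * pderiv i f - X (i + 1) ^ (ε : ℕ) * pderiv (i + 1) f

/-- `R i` is the value at `φ` of the `i`-th Dunkl-type term of `T_ε`. -/
def HasDunkl (ε : Fin 3) (φ : Poly N) (R : Fin N → Poly N) : Prop :=
  ∀ i, pairDiff ε i φ * (X i - X (i + 1))
    - thetaPoly ε (X i) (X (i + 1)) * (φ - rename (Equiv.swap i (i + 1)) φ)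
    = (X i - X (i + 1)) ^ 2 * R i

/-- The value of the gauge Hamiltonian at `φ` given the values of the Dunkl-type terms. -/
def gaugePoly (ε : Fin 3) (a b ω : ℝ) (φ : Poly N) (R : Fin N → Poly N) : Poly N :=
  C (constC ε : ℂ) * (opDelta ε φ + C (2 * a : ℂ) * ∑ i, R i)
  + C (constMinus ε b : ℂ) * opJminus φ + C (constZero ε a ω : ℂ) * opJzero φ
  + C (constE ε N a b ω : ℂ) * φ

/-- `HasDunkl` is the definition of the Dunkl-type terms with the denominator `(z_i - z_{i+1})²`
cleared. For `N ≥ 2` this is nonzero and may be divided out. -/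
theorem gaugeHam_eq_of_hasDunkl (hN : 2 ≤ N) {ε : Fin 3} {φ : Poly N} {R : Fin N → Poly N}
    (h : HasDunkl ε φ R) (a b ω : ℝ) :
    gaugeHam ε a b ω φ = toRat (gaugePoly ε a b ω φ R) := by
  have hi : ∀ i : Fin N, toRat (R i) =
      toRat (pairDiff ε i φ) / (toRat (X i) - toRat (X (i + 1)))
      - theta ε (toRat (X i)) (toRat (X (i + 1))) / (toRat (X i) - toRat (X (i + 1))) ^ 2
        * toRat (φ - rename (Equiv.swap i (i + 1)) φ) := by
    intro i
    have hd : toRat (X i) - toRat (X (i + 1) : Poly N) ≠ 0 := by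
      rw [← toRat_sub, ← toRat_zero]
      exact fun h => X_sub_X_ne_zero hN i (toRat_injective h)
    have := congrArg toRat (h i)
    simp only [toRat_mul, toRat_pow, toRat_sub _ (_ * _), toRat_thetaPoly] at this
    rw [toRat_sub (X i)] at this
    field_simp
    linear_combination -this
  unfold gaugeHam gaugePoly opT
  simp only [toRat_add, toRat_mul (C (constC ε : ℂ)), toRat_mul (C (2 * a : ℂ)), toRat_sum _ R, hi,
    Finset.sum_sub_distrib, opDelta, pairDiff]
  ring

/-- `K_{i,i+1}` fixes `F`, so the exchange part is linear over `F` while the first-order part obeys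
the Leibniz rule. -/
theorem HasDunkl.mul {ε : Fin 3} {F φ : Poly N} {D R : Fin N → Poly N}
    (hs : F.IsSymmetric) (hF : HasDunkl ε F D) (hφ : HasDunkl ε φ R) :
    HasDunkl ε (F * φ) (fun i => F * R i + φ * D i) := by
  intro i
  have h1 := hF i
  have h2 := hφ i
  rw [hs] at h1
  rw [map_mul, hs]
  simp only [pairDiff, Derivation.leibniz, smul_eq_mul] at *
  linear_combination F * h2 + φ * h1

omit [NeZero N] in
theorem isSymmetric_aeval {m : ℕ} {p : Fin m → Poly N} (hs : ∀ k, (p k).IsSymmetric)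
    (f : MvPolynomial (Fin m) ℂ) : (aeval p f).IsSymmetric := by
  intro e
  rw [← AlgHom.comp_apply]
  congr 1
  ext k
  simp [hs k e]

/-- On symmetric functions the exchange part vanishes and the Dunkl-type term is a derivation, hence
the chain rule. -/
theorem hasDunkl_aeval {m : ℕ} {ε : Fin 3} {p : Fin m → Poly N} {D : Fin m → Fin N → Poly N}
    (hs : ∀ k, (p k).IsSymmetric) (hp : ∀ k, HasDunkl ε (p k) (D k))
    (f : MvPolynomial (Fin m) ℂ) :
    HasDunkl ε (aeval p f) (fun i => ∑ k, aeval p (pderiv k f) * D k i) := by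
  intro i
  rw [isSymmetric_aeval hs f]
  simp only [pairDiff, pderiv_aeval p f, sub_self, mul_zero, sub_zero, Finset.mul_sum,
    ← Finset.sum_sub_distrib, Finset.sum_mul]
  refine Finset.sum_congr rfl fun k _ => ?_
  have h1 := hp k i
  rw [hs k] at h1
  simp only [pairDiff] at h1
  linear_combination (aeval p (pderiv k f)) * h1

omit [NeZero N] in
theorem opJminus_mul (f g : Poly N) : opJminus (f * g) = f * opJminus g + g * opJminus f := by
  simp only [opJminus, Derivation.leibniz, smul_eq_mul, Finset.sum_add_distrib, Finset.mul_sum]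

omit [NeZero N] in
theorem opJzero_mul (f g : Poly N) : opJzero (f * g) = f * opJzero g + g * opJzero f := by
  simp only [opJzero, Finset.mul_sum, ← Finset.sum_add_distrib]
  refine Finset.sum_congr rfl fun i _ => ?_
  rw [Derivation.leibniz]
  simp only [smul_eq_mul]
  ring

omit [NeZero N] in
theorem opDelta_mul (ε : Fin 3) (f g : Poly N) :
    opDelta ε (f * g) = f * opDelta ε g + g * opDelta ε f + 2 * opGamma ε f g := by
  simp only [opDelta, opGamma, Finset.mul_sum, ← Finset.sum_add_distrib]
  refine Finset.sum_congr rfl fun i _ => ?_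
  simp only [Derivation.leibniz, smul_eq_mul, map_add]
  ring

omit [NeZero N] in
theorem opJminus_aeval {m : ℕ} (p : Fin m → Poly N) (f : MvPolynomial (Fin m) ℂ) :
    opJminus (aeval p f) = ∑ k, aeval p (pderiv k f) * opJminus (p k) := by
  simp only [opJminus, Finset.mul_sum]
  rw [Finset.sum_comm]
  exact Finset.sum_congr rfl fun i _ => pderiv_aeval p f i

omit [NeZero N] in
theorem opJzero_aeval {m : ℕ} (p : Fin m → Poly N) (f : MvPolynomial (Fin m) ℂ) :
    opJzero (aeval p f) = ∑ k, aeval p (pderiv k f) * opJzero (p k) := by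
  simp only [opJzero, Finset.mul_sum]
  rw [Finset.sum_comm]
  refine Finset.sum_congr rfl fun i _ => ?_
  rw [pderiv_aeval p f i, Finset.mul_sum]
  exact Finset.sum_congr rfl fun k _ => by ring

omit [NeZero N] in
theorem opGamma_aeval {m : ℕ} (ε : Fin 3) (p : Fin m → Poly N) (f : MvPolynomial (Fin m) ℂ)
    (g : Poly N) :
    opGamma ε (aeval p f) g = ∑ k, aeval p (pderiv k f) * opGamma ε (p k) g := by
  simp only [opGamma, Finset.mul_sum]
  rw [Finset.sum_comm]
  refine Finset.sum_congr rfl fun i _ => ?_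
  rw [pderiv_aeval p f i, Finset.mul_sum, Finset.sum_mul]
  exact Finset.sum_congr rfl fun k _ => by ring

omit [NeZero N] in
theorem opDelta_aeval {m : ℕ} (ε : Fin 3) (p : Fin m → Poly N) (f : MvPolynomial (Fin m) ℂ) :
    opDelta ε (aeval p f) = ∑ k, aeval p (pderiv k f) * opDelta ε (p k)
      + ∑ k, ∑ l, aeval p (pderiv l (pderiv k f)) * opGamma ε (p k) (p l) := by
  have h : ∀ i : Fin N, X i ^ (ε : ℕ) * pderiv i (pderiv i (aeval p f)) =
      ∑ k, aeval p (pderiv k f) * (X i ^ (ε : ℕ) * pderiv i (pderiv i (p k)))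
      + ∑ k, ∑ l, aeval p (pderiv l (pderiv k f)) *
          (X i ^ (ε : ℕ) * pderiv i (p k) * pderiv i (p l)) := by
    intro i
    rw [pderiv_aeval p f i, map_sum, Finset.mul_sum, ← Finset.sum_add_distrib]
    refine Finset.sum_congr rfl fun k _ => ?_
    rw [Derivation.leibniz, pderiv_aeval p (pderiv k f) i]
    rw [smul_eq_mul, smul_eq_mul, mul_add, Finset.mul_sum, Finset.mul_sum]
    refine congrArg₂ (· + ·) (mul_left_comm _ _ _) (Finset.sum_congr rfl fun l _ => ?_)
    generalize aeval p (pderiv l (pderiv k f)) = A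
    ring
  unfold opDelta opGamma
  rw [Finset.sum_congr rfl fun i _ => h i, Finset.sum_add_distrib]
  refine congrArg₂ (· + ·) ?_ ?_
  · rw [Finset.sum_comm]
    exact Finset.sum_congr rfl fun k _ => (Finset.mul_sum _ _ _).symm
  · rw [Finset.sum_comm]
    refine Finset.sum_congr rfl fun k _ => ?_
    rw [Finset.sum_comm]
    exact Finset.sum_congr rfl fun l _ => (Finset.mul_sum _ _ _).symm

/-- The gauge Hamiltonian on a product of a function of symmetric polynomials `p k` with `φ`. -/
theorem gaugeHam_aeval_mul (hN : 2 ≤ N) {m : ℕ} {ε : Fin 3} {p : Fin m → Poly N}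
    {D : Fin m → Fin N → Poly N} (hs : ∀ k, (p k).IsSymmetric) (hp : ∀ k, HasDunkl ε (p k) (D k))
    {φ : Poly N} {R : Fin N → Poly N} (hφ : HasDunkl ε φ R)
    (f : MvPolynomial (Fin m) ℂ) (a b ω : ℝ) :
    gaugeHam ε a b ω (aeval p f * φ) = toRat (
      aeval p f * gaugePoly ε a b ω φ R
      + ∑ k, aeval p (pderiv k f) *
          (φ * (gaugePoly ε a b ω (p k) (D k) - C (constE ε N a b ω : ℂ) * p k)
            + C (2 * constC ε : ℂ) * opGamma ε (p k) φ)
      + φ * (C (constC ε : ℂ) *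
          ∑ k, ∑ l, aeval p (pderiv l (pderiv k f)) * opGamma ε (p k) (p l))) := by
  rw [gaugeHam_eq_of_hasDunkl hN ((hasDunkl_aeval hs hp f).mul (isSymmetric_aeval hs f) hφ)]
  refine congrArg toRat ?_
  -- `E_0` enters once, through `φ`; it is therefore subtracted in every chain-rule coefficient.
  have hsum : ∑ k, aeval p (pderiv k f) *
          (φ * (gaugePoly ε a b ω (p k) (D k) - C (constE ε N a b ω : ℂ) * p k)
            + C (2 * constC ε : ℂ) * opGamma ε (p k) φ) =
      φ * (C (constC ε : ℂ) * (∑ k, aeval p (pderiv k f) * opDelta ε (p k)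
        + C (2 * a : ℂ) * ∑ i, ∑ k, aeval p (pderiv k f) * D k i))
      + C (constMinus ε b : ℂ) * (φ * ∑ k, aeval p (pderiv k f) * opJminus (p k))
      + C (constZero ε a ω : ℂ) * (φ * ∑ k, aeval p (pderiv k f) * opJzero (p k))
      + C (2 * constC ε : ℂ) * ∑ k, aeval p (pderiv k f) * opGamma ε (p k) φ := by
    rw [Finset.sum_comm (f := fun i k => aeval p (pderiv k f) * D k i)]
    simp only [← Finset.mul_sum]
    simp only [Finset.mul_sum, ← Finset.sum_add_distrib]
    refine Finset.sum_congr rfl fun k _ => ?_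
    simp only [gaugePoly, ← Finset.mul_sum]
    ring
  rw [hsum]
  unfold gaugePoly
  rw [opJminus_mul, opJzero_mul, opDelta_mul, opDelta_aeval, opGamma_aeval, opJminus_aeval,
    opJzero_aeval, Finset.sum_add_distrib, ← Finset.mul_sum, ← Finset.mul_sum]
  rw [show (C (2 * (constC ε : ℂ)) : Poly N) = 2 * C (constC ε : ℂ) by
    rw [C_mul]; congr 1]
  ring

end

noncomputable section

variable {N : ℕ}

/-! ### Elementary polynomials -/

/-- At `k = 0` the truncated exponent `k - 1` is harmless, its coefficient being zero. -/
theorem pderiv_sigma (i : Fin N) (k : ℕ) :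
    pderiv i (sigma N k) = C (k : ℂ) * X i ^ (k - 1) := by
  simp only [sigma, psum, map_sum, pderiv_pow, pderiv_X]
  rw [Finset.sum_eq_single i]
  · simp
  · intro j _ hj; simp [hj]
  · simp

theorem sigma_one : sigma N 1 = ∑ i, X i := by simp [sigma, psum]

theorem isSymmetric_sigma (k : ℕ) : (sigma N k).IsSymmetric := psum_isSymmetric _ _ _

theorem isSymmetric_tau (k : ℕ) : (tau N k).IsSymmetric := esymm_isSymmetric _ _ _

theorem isHomogeneous_sigma (k : ℕ) : (sigma N k).IsHomogeneous k :=
  IsHomogeneous.sum _ _ _ fun i _ => isHomogeneous_X_pow i k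

theorem isHomogeneous_tau (k : ℕ) : (tau N k).IsHomogeneous k := by
  refine IsHomogeneous.sum _ _ _ fun s hs => ?_
  have := IsHomogeneous.prod s (fun i => (X i : Poly N)) (fun _ => 1) fun i _ => isHomogeneous_X ℂ i
  simpa [(Finset.mem_powersetCard.1 hs).2] using this

theorem tau_self : tau N N = ∏ i, X i := by
  have h : (Finset.powersetCard N (Finset.univ : Finset (Fin N))) = {Finset.univ} := by
    have := Finset.powersetCard_self (Finset.univ : Finset (Fin N))
    rwa [Finset.card_univ, Fintype.card_fin] at this
  simp [tau, esymm, h]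

/-- The product of all variables but `z_j`. -/
def cofactor (j : Fin N) : Poly N := ∏ i ∈ Finset.univ.erase j, X i

theorem X_mul_cofactor (j : Fin N) : X j * cofactor j = tau N N := by
  rw [tau_self, cofactor, Finset.mul_prod_erase _ _ (Finset.mem_univ j)]

/-- After multiplication by `z_{e j}` both sides are `τ_N`, which is symmetric. -/
theorem rename_cofactor (e : Equiv.Perm (Fin N)) (j : Fin N) :
    rename e (cofactor j) = cofactor (e j) := by
  have h : (X (e j) : Poly N) * rename e (cofactor j) = X (e j) * cofactor (e j) := by
    rw [X_mul_cofactor, ← isSymmetric_tau N e, ← X_mul_cofactor j, map_mul, rename_X]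
  exact mul_left_cancel₀ (X_ne_zero _) h

theorem tau_pred [NeZero N] : tau N (N - 1) = ∑ j, cofactor j := by
  have hN := NeZero.pos N
  have himg : Finset.powersetCard (N - 1) (Finset.univ : Finset (Fin N))
      = Finset.univ.image fun j => Finset.univ.erase j := by
    ext s
    simp only [Finset.mem_powersetCard, Finset.subset_univ, true_and, Finset.mem_image,
      Finset.mem_univ]
    constructor
    · intro hs
      have : sᶜ.card = 1 := by rw [Finset.card_compl, hs]; simp; omega
      obtain ⟨j, hj⟩ := Finset.card_eq_one.1 this
      refine ⟨j, ?_⟩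
      rw [← compl_compl s, hj]
      ext x; simp
    · rintro ⟨j, rfl⟩
      rw [Finset.card_erase_of_mem (Finset.mem_univ j)]; simp
  rw [tau, esymm, himg, Finset.sum_image]
  · rfl
  · intro i _ j _ h
    by_contra hne
    have : j ∈ Finset.univ.erase i := by simp [Ne.symm hne]
    rw [show Finset.univ.erase i = Finset.univ.erase j from h] at this
    simp at this

/-- A squarefree monomial is an eigenvector of the Euler operator `z_i ∂_i`, with eigenvalue 1 or 0.
The elementary symmetric polynomials below are all handled through `z_i ∂_i`, which avoids writing
products with two factors removed. -/
theorem X_mul_pderiv_prod (S : Finset (Fin N)) (i : Fin N) :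
    X i * pderiv i (∏ m ∈ S, X m : Poly N) = if i ∈ S then ∏ m ∈ S, X m else 0 := by
  induction S using Finset.induction_on with
  | empty => simp
  | insert m S hm ih =>
    rw [Finset.prod_insert hm, Derivation.leibniz, pderiv_X]
    simp only [smul_eq_mul, mul_add]
    rw [mul_left_comm, ih]
    by_cases h : m = i
    · subst h; simp [hm, mul_comm]
    · rw [Pi.single_eq_of_ne h]
      simp [Ne.symm h]

theorem X_mul_pderiv_cofactor (i j : Fin N) :
    X i * pderiv i (cofactor j) = if i = j then 0 else cofactor j := by
  rw [cofactor, X_mul_pderiv_prod]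
  by_cases h : i = j <;> simp [h]

theorem X_mul_pderiv_tau_self (i : Fin N) : X i * pderiv i (tau N N) = tau N N := by
  rw [tau_self, X_mul_pderiv_prod]; simp

theorem X_mul_pderiv_tau_pred [NeZero N] (i : Fin N) :
    X i * pderiv i (tau N (N - 1)) = tau N (N - 1) - cofactor i := by
  have : (cofactor i : Poly N) = ∑ j, if i = j then cofactor j else 0 := by simp
  rw [this, tau_pred, map_sum, Finset.mul_sum, ← Finset.sum_sub_distrib]
  refine Finset.sum_congr rfl fun j _ => ?_
  rw [X_mul_pderiv_cofactor]
  split_ifs <;> simp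

/-- `z_i² ∂_i² = (z_i ∂_i)² - z_i ∂_i`, and the Euler eigenvalues 0 and 1 are the roots of `t² - t`.
-/
theorem X_sq_mul_pderiv_pderiv_prod (S : Finset (Fin N)) (i : Fin N) :
    X i ^ 2 * pderiv i (pderiv i (∏ m ∈ S, X m : Poly N)) = 0 := by
  have h := congrArg (fun p => X i * pderiv i p) (X_mul_pderiv_prod S i)
  have h1 := X_mul_pderiv_prod S i
  simp only [Derivation.leibniz, smul_eq_mul, pderiv_X_self] at h
  split_ifs at h h1 with hi
  · linear_combination h
  · simp only [map_zero] at h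
    linear_combination h - h1

theorem opDelta_two_cofactor (j : Fin N) : opDelta 2 (cofactor j) = 0 :=
  Finset.sum_eq_zero fun i _ => X_sq_mul_pderiv_pderiv_prod _ i

theorem opDelta_two_tau_self : opDelta 2 (tau N N) = 0 := by
  rw [tau_self]
  exact Finset.sum_eq_zero fun i _ => X_sq_mul_pderiv_pderiv_prod _ i

theorem opDelta_two_tau_pred [NeZero N] : opDelta 2 (tau N (N - 1)) = 0 := by
  rw [tau_pred]
  refine Finset.sum_eq_zero fun i _ => ?_
  rw [map_sum, map_sum, Finset.mul_sum]
  exact Finset.sum_eq_zero fun j _ => X_sq_mul_pderiv_pderiv_prod _ i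

theorem opJzero_tau_self : opJzero (tau N N) = C (N : ℂ) * tau N N := by
  simp [opJzero, X_mul_pderiv_tau_self]

theorem opJzero_cofactor (j : Fin N) : opJzero (cofactor j) = C ((N : ℂ) - 1) * cofactor j := by
  have : ∀ i : Fin N, X i * pderiv i (cofactor j) =
      cofactor j - if i = j then cofactor j else 0 := by
    intro i; rw [X_mul_pderiv_cofactor]; split_ifs <;> simp
  simp only [opJzero, this, Finset.sum_sub_distrib, Finset.sum_ite_eq', Finset.mem_univ, if_true]
  simp [sub_mul]

theorem opJzero_tau_pred [NeZero N] :
    opJzero (tau N (N - 1)) = C ((N : ℂ) - 1) * tau N (N - 1) := by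
  simp only [opJzero, X_mul_pderiv_tau_pred, Finset.sum_sub_distrib]
  rw [← tau_pred]
  simp [sub_mul]

theorem opGamma_two_tau_self (φ : Poly N) : opGamma 2 (tau N N) φ = tau N N * opJzero φ := by
  simp only [opGamma, opJzero, Finset.mul_sum]
  refine Finset.sum_congr rfl fun i _ => ?_
  have := X_mul_pderiv_tau_self i
  change X i ^ 2 * _ * _ = _
  linear_combination (X i * pderiv i φ) * this

/-- The operator `J^-` arises from `(τ_N / z_i) z_i ∂_i φ = τ_N ∂_i φ`, the correction in `z_i ∂_i
τ_{N-1} = τ_{N-1} - τ_N / z_i`. -/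
theorem opGamma_two_tau_pred [NeZero N] (φ : Poly N) :
    opGamma 2 (tau N (N - 1)) φ =
      tau N (N - 1) * opJzero φ - tau N N * opJminus φ := by
  simp only [opGamma, opJzero, opJminus, Finset.mul_sum, ← Finset.sum_sub_distrib]
  refine Finset.sum_congr rfl fun i _ => ?_
  have h1 := X_mul_pderiv_tau_pred i
  have h2 := X_mul_cofactor i
  change X i ^ 2 * _ * _ = _
  linear_combination (X i * pderiv i φ) * h1 - pderiv i φ * h2

theorem opGamma_sigma (ε : Fin 3) (k : ℕ) (φ : Poly N) :
    opGamma ε (sigma N k) φ = C (k : ℂ) * ∑ i, X i ^ ((ε : ℕ) + (k - 1)) * pderiv i φ := by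
  simp only [opGamma, pderiv_sigma, Finset.mul_sum]
  exact Finset.sum_congr rfl fun i _ => by ring

theorem opGamma_sigma_sigma (ε : Fin 3) (k l : ℕ) :
    opGamma ε (sigma N k) (sigma N l) =
      C ((k : ℂ) * l) * sigma N ((ε : ℕ) + (k - 1) + (l - 1)) := by
  simp only [opGamma_sigma, pderiv_sigma]
  simp only [sigma, psum, Finset.mul_sum, C_mul]
  exact Finset.sum_congr rfl fun i _ => by ring

theorem opGamma_comm (ε : Fin 3) (f g : Poly N) : opGamma ε f g = opGamma ε g f :=
  Finset.sum_congr rfl fun i _ => by ring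

theorem opDelta_sigma (ε : Fin 3) (k : ℕ) :
    opDelta ε (sigma N k) = C ((k : ℂ) * (k - 1 : ℕ)) * sigma N ((ε : ℕ) + (k - 1 - 1)) := by
  simp only [opDelta, pderiv_sigma, pderiv_C_mul, pderiv_pow, pderiv_X_self]
  simp only [sigma, psum, Finset.mul_sum, C_mul]
  refine Finset.sum_congr rfl fun i _ => ?_
  rw [show ((k - 1 : ℕ) : Poly N) = C ((k - 1 : ℕ) : ℂ) by simp]
  ring

theorem opJzero_sigma (k : ℕ) : opJzero (sigma N k) = C (k : ℂ) * sigma N k := by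
  simp only [opJzero, pderiv_sigma]
  simp only [sigma, psum, Finset.mul_sum]
  refine Finset.sum_congr rfl fun i _ => ?_
  rcases k with _ | k
  · simp
  · rw [Nat.add_sub_cancel]; ring

theorem opJminus_sigma (k : ℕ) : opJminus (sigma N k) = C (k : ℂ) * sigma N (k - 1) := by
  simp only [opJminus, pderiv_sigma]
  simp only [sigma, psum, Finset.mul_sum]

theorem sigma_zero : sigma N 0 = C (N : ℂ) := by simp [sigma, psum]

theorem sum_pderiv_X_mul (q : Fin N → Poly N) (j : Fin N) :
    ∑ i, q i * pderiv i (X j : Poly N) = q j := by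
  rw [Finset.sum_eq_single j]
  · simp
  · intro i _ hi; rw [pderiv_X_of_ne hi.symm, mul_zero]
  · simp

theorem pderiv_pderiv_X (i j : Fin N) : pderiv i (pderiv i (X j : Poly N)) = 0 := by
  by_cases h : j = i
  · subst h; simp
  · rw [pderiv_X_of_ne h, map_zero]

theorem opDelta_X (ε : Fin 3) (j : Fin N) : opDelta ε (X j : Poly N) = 0 := by
  simp only [opDelta, pderiv_pderiv_X, mul_zero, Finset.sum_const_zero]

theorem opJminus_X (j : Fin N) : opJminus (X j : Poly N) = 1 := by
  have := sum_pderiv_X_mul (fun _ => (1 : Poly N)) j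
  simp only [one_mul] at this
  exact this

theorem opJzero_X (j : Fin N) : opJzero (X j : Poly N) = X j := sum_pderiv_X_mul _ j

theorem opGamma_sigma_X (ε : Fin 3) (k : ℕ) (j : Fin N) :
    opGamma ε (sigma N k) (X j) = C (k : ℂ) * X j ^ ((ε : ℕ) + (k - 1)) := by
  rw [opGamma_sigma, sum_pderiv_X_mul]

theorem opGamma_mul_right (ε : Fin 3) (p f g : Poly N) :
    opGamma ε p (f * g) = f * opGamma ε p g + g * opGamma ε p f := by
  simp only [opGamma, Finset.mul_sum, ← Finset.sum_add_distrib]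
  refine Finset.sum_congr rfl fun i _ => ?_
  rw [Derivation.leibniz, smul_eq_mul, smul_eq_mul]
  ring

/-! ### Dunkl-type terms of elementary polynomials -/

variable [NeZero N]

theorem sum_add_one {M : Type*} [AddCommMonoid M] (g : Fin N → M) : ∑ i, g (i + 1) = ∑ i, g i :=
  Equiv.sum_comp (Equiv.addRight (1 : Fin N)) g

theorem sum_X_add_X : ∑ i : Fin N, (X i + X (i + 1) : Poly N) = C 2 * sigma N 1 := by
  rw [Finset.sum_add_distrib, sum_add_one (fun i => (X i : Poly N)), ← sigma_one,
    show (C 2 : Poly N) = 2 from map_ofNat C 2]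
  ring

/-- The number of times `j` occurs among `i`, `i + 1`. -/
def incidence (i j : Fin N) : Poly N := (if j = i then 1 else 0) + (if j = i + 1 then 1 else 0)

theorem sum_incidence (j : Fin N) : ∑ i : Fin N, incidence i j = C 2 := by
  have h := sum_add_one (fun i : Fin N => if j = i then (1 : Poly N) else 0)
  simp only [incidence, Finset.sum_add_distrib, h]
  simp only [Finset.sum_ite_eq, Finset.mem_univ, if_true]
  rw [show (C 2 : Poly N) = 2 from map_ofNat C 2]
  norm_num

theorem hasDunkl_one (ε : Fin 3) : HasDunkl ε (1 : Poly N) (fun _ => 0) := by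
  intro i; simp [pairDiff]

theorem HasDunkl.sum {ι : Type*} {ε : Fin 3} (s : Finset ι) {φ : ι → Poly N}
    {R : ι → Fin N → Poly N} (h : ∀ j ∈ s, HasDunkl ε (φ j) (R j)) :
    HasDunkl ε (∑ j ∈ s, φ j) (fun i => ∑ j ∈ s, R j i) := by
  intro i
  simp only [pairDiff, map_sum, Finset.mul_sum, ← Finset.sum_sub_distrib, Finset.sum_mul]
  refine Finset.sum_congr rfl fun j hj => ?_
  have := h j hj i
  simp only [pairDiff] at this
  exact this

/-- The exchange part vanishes on `σ_k`, so only the divided difference of `k z^{ε+k-1}` remains. -/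
theorem hasDunkl_sigma_of {ε : Fin 3} {k : ℕ} {D : Fin N → Poly N}
    (h : ∀ i, C (k : ℂ) * (X i ^ ((ε : ℕ) + (k - 1)) - X (i + 1) ^ ((ε : ℕ) + (k - 1)))
      = (X i - X (i + 1)) * D i) : HasDunkl ε (sigma N k) D := by
  intro i
  rw [isSymmetric_sigma, pairDiff, pderiv_sigma, pderiv_sigma]
  linear_combination (X i - X (i + 1)) * h i

theorem hasDunkl_tau_self_one : HasDunkl 1 (tau N N) (fun _ => 0) := by
  intro i
  rw [isSymmetric_tau, pairDiff]
  have h1 := X_mul_pderiv_tau_self i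
  have h2 := X_mul_pderiv_tau_self (i + 1)
  simp only [Fin.val_one, pow_one]
  linear_combination (X i - X (i + 1)) * (h1 - h2)

theorem hasDunkl_tau_self_two : HasDunkl 2 (tau N N) (fun _ => tau N N) := by
  intro i
  rw [isSymmetric_tau, pairDiff]
  have h1 := X_mul_pderiv_tau_self i
  have h2 := X_mul_pderiv_tau_self (i + 1)
  simp only [Fin.val_two]
  linear_combination (X i - X (i + 1)) * (X i * h1 - X (i + 1) * h2)

theorem fin_cases_pair {i : Fin N} (j : Fin N) : j = i ∨ j = i + 1 ∨ (j ≠ i ∧ j ≠ i + 1) := by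
  tauto

/-- When `j` is `i` or `i + 1`, the pole `± 1/(z_i - z_{i+1})` of the derivative part is cancelled
by the exchange part. The same cancellation makes the terms of the other nonsymmetric polynomials
below regular. -/
theorem hasDunkl_X_zero (hN : 2 ≤ N) (j : Fin N) : HasDunkl 0 (X j : Poly N) (fun _ => 0) := by
  intro i
  have hne := fin_ne_add_one hN i
  simp only [pairDiff, rename_X, thetaPoly]
  rcases fin_cases_pair (i := i) j with rfl | rfl | ⟨h1, h2⟩
  · rw [pderiv_X_of_ne hne, Equiv.swap_apply_left]; simp
  · rw [pderiv_X_of_ne hne.symm, Equiv.swap_apply_right]; simp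
  · rw [pderiv_X_of_ne h1, pderiv_X_of_ne h2, Equiv.swap_apply_of_ne_of_ne h1 h2]; simp

theorem hasDunkl_X_one (hN : 2 ≤ N) (j : Fin N) :
    HasDunkl 1 (X j : Poly N) (fun i => C (1 / 2) * incidence i j) := by
  intro i
  have hne := fin_ne_add_one hN i
  have hC : (2 : Poly N) * C (1 / 2 : ℂ) = 1 := by
    rw [show (2 : Poly N) = C 2 from (map_ofNat C 2).symm, ← C_mul]; norm_num
  simp only [pairDiff, rename_X, thetaPoly, incidence]
  rcases fin_cases_pair (i := i) j with rfl | rfl | ⟨h1, h2⟩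
  · rw [pderiv_X_of_ne hne, Equiv.swap_apply_left]
    simp only [Fin.val_one, pow_one, pderiv_X_self, if_true, if_neg hne]
    linear_combination (-(X j) * (X j - X (j + 1)) : Poly N) * hC
  · rw [pderiv_X_of_ne hne.symm, Equiv.swap_apply_right]
    simp only [Fin.val_one, pow_one, pderiv_X_self, if_true, if_neg hne.symm]
    linear_combination (X (i + 1) * (X i - X (i + 1)) : Poly N) * hC
  · rw [pderiv_X_of_ne h1, pderiv_X_of_ne h2, Equiv.swap_apply_of_ne_of_ne h1 h2]
    simp [h1, h2]

theorem hasDunkl_X_two (hN : 2 ≤ N) (j : Fin N) :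
    HasDunkl 2 (X j : Poly N) (fun i => X j * incidence i j) := by
  intro i
  have hne := fin_ne_add_one hN i
  simp only [pairDiff, rename_X, thetaPoly, incidence]
  rcases fin_cases_pair (i := i) j with rfl | rfl | ⟨h1, h2⟩
  · rw [pderiv_X_of_ne hne, Equiv.swap_apply_left]
    simp only [Fin.val_two, pderiv_X_self, if_true, if_neg hne]
    ring
  · rw [pderiv_X_of_ne hne.symm, Equiv.swap_apply_right]
    simp only [Fin.val_two, pderiv_X_self, if_true, if_neg hne.symm]
    ring
  · rw [pderiv_X_of_ne h1, pderiv_X_of_ne h2, Equiv.swap_apply_of_ne_of_ne h1 h2]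
    simp [h1, h2]

theorem hasDunkl_X_sq_zero (hN : 2 ≤ N) (j : Fin N) :
    HasDunkl 0 (X j ^ 2 : Poly N) (fun i => incidence i j) := by
  intro i
  have hne := fin_ne_add_one hN i
  simp only [pairDiff, map_pow, pderiv_pow, rename_X, thetaPoly, incidence]
  rcases fin_cases_pair (i := i) j with rfl | rfl | ⟨h1, h2⟩
  · rw [pderiv_X_of_ne hne, Equiv.swap_apply_left]
    simp only [Fin.val_zero, pderiv_X_self, if_true, if_neg hne]
    push_cast; ring
  · rw [pderiv_X_of_ne hne.symm, Equiv.swap_apply_right]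
    simp only [Fin.val_zero, pderiv_X_self, if_true, if_neg hne.symm]
    push_cast; ring
  · rw [pderiv_X_of_ne h1, pderiv_X_of_ne h2, Equiv.swap_apply_of_ne_of_ne h1 h2]
    simp [h1, h2]

omit [NeZero N] in
theorem single_add_single_eq_iff {i j k l : Fin N} (hkl : k ≠ l) :
    Finsupp.single i 1 + Finsupp.single j 1 = (Finsupp.single k 1 + Finsupp.single l 1 : Fin N →₀ ℕ)
      ↔ (i = k ∧ j = l) ∨ (i = l ∧ j = k) := by
  constructor
  · intro h
    have h1 := DFunLike.congr_fun h k
    have h2 := DFunLike.congr_fun h l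
    simp only [Finsupp.add_apply, Finsupp.single_apply, if_true, if_neg hkl, if_neg hkl.symm]
      at h1 h2
    by_cases a1 : i = k <;> by_cases a2 : j = k <;> by_cases a3 : i = l <;> by_cases a4 : j = l <;>
      simp_all
  · rintro (⟨rfl, rfl⟩ | ⟨rfl, rfl⟩)
    · rfl
    · exact add_comm _ _

omit [NeZero N] in
theorem coeff_X_mul_X {i j k l : Fin N} (hkl : k ≠ l) :
    coeff (Finsupp.single i 1 + Finsupp.single j 1) (X k * X l : Poly N) =
      if (i = k ∧ j = l) ∨ (i = l ∧ j = k) then 1 else 0 := by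
  rw [X, X, monomial_mul, coeff_monomial, mul_one]
  simp only [eq_comm (a := Finsupp.single k 1 + Finsupp.single l 1),
    single_add_single_eq_iff hkl]

/-- If exactly one of `j, l` lies in `{i, i+1}`, the two parts cancel as for a single variable; if
both do, the exchange part is zero and the derivative part is `(z_{i+1} - z_i)/(z_i - z_{i+1}) =
-1`. This indicator is written as a coefficient of `z_j z_l` because `pairSpin` is defined by the
same coefficient. -/
theorem hasDunkl_X_mul_X_zero (hN : 2 ≤ N) {j l : Fin N} (hjl : j ≠ l) :
    HasDunkl 0 (X j * X l : Poly N)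
      (fun i => -C (coeff (Finsupp.single i 1 + Finsupp.single (i + 1) 1) (X j * X l : Poly N))) := by
  intro i
  have hne := fin_ne_add_one hN i
  beta_reduce
  rw [coeff_X_mul_X hjl]
  simp only [pairDiff, map_mul, rename_X, thetaPoly, Derivation.leibniz, smul_eq_mul, Fin.val_zero,
    pow_zero, one_mul]
  have hl := fin_cases_pair (i := i) l
  rcases fin_cases_pair (i := i) j with rfl | rfl | ⟨h1, h2⟩ <;>
  rcases hl with h | h | ⟨h3, h4⟩
  · exact absurd h.symm hjl
  · subst h
    rw [Equiv.swap_apply_left, Equiv.swap_apply_right, pderiv_X_of_ne hne, pderiv_X_of_ne hne.symm]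
    simp; ring
  · rw [Equiv.swap_apply_left, Equiv.swap_apply_of_ne_of_ne h3 h4, pderiv_X_of_ne hne,
      pderiv_X_of_ne h3, pderiv_X_of_ne h4]
    simp [hne.symm, h3.symm, h4.symm]; ring
  · subst h
    rw [Equiv.swap_apply_left, Equiv.swap_apply_right, pderiv_X_of_ne hne, pderiv_X_of_ne hne.symm]
    simp; ring
  · exact absurd h.symm hjl
  · rw [Equiv.swap_apply_right, Equiv.swap_apply_of_ne_of_ne h3 h4, pderiv_X_of_ne hne.symm,
      pderiv_X_of_ne h3, pderiv_X_of_ne h4]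
    simp [hne, h3.symm, h4.symm]; ring
  · subst h
    rw [Equiv.swap_apply_left, Equiv.swap_apply_of_ne_of_ne h1 h2, pderiv_X_of_ne hne,
      pderiv_X_of_ne h1, pderiv_X_of_ne h2]
    simp [hne.symm, h1.symm, h2.symm]; ring
  · subst h
    rw [Equiv.swap_apply_right, Equiv.swap_apply_of_ne_of_ne h1 h2, pderiv_X_of_ne hne.symm,
      pderiv_X_of_ne h1, pderiv_X_of_ne h2]
    simp [hne, h1.symm, h2.symm]; ring
  · rw [Equiv.swap_apply_of_ne_of_ne h1 h2, Equiv.swap_apply_of_ne_of_ne h3 h4,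
      pderiv_X_of_ne h1, pderiv_X_of_ne h2, pderiv_X_of_ne h3, pderiv_X_of_ne h4]
    simp [h1.symm, h3.symm]

/-- For `j = i` the parts are `-z_{i+1} (τ_N / z_i)/(z_i - z_{i+1})` and `τ_N/(z_i - z_{i+1})`, with
sum `τ_N / z_i`; the other cases give the same value, so nothing here depends on `i`. -/
theorem hasDunkl_cofactor_two (hN : 2 ≤ N) (j : Fin N) :
    HasDunkl 2 (cofactor j) (fun _ => cofactor j) := by
  intro i
  have hne := fin_ne_add_one hN i
  have e1 := X_mul_pderiv_cofactor i j
  have e2 := X_mul_pderiv_cofactor (i + 1) j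
  have c1 := X_mul_cofactor i
  have c2 := X_mul_cofactor (i + 1)
  simp only [pairDiff, rename_cofactor, thetaPoly, Fin.val_two]
  rcases fin_cases_pair (i := i) j with rfl | rfl | ⟨h1, h2⟩
  · rw [Equiv.swap_apply_left]
    rw [if_pos rfl] at e1
    rw [if_neg hne.symm] at e2
    linear_combination (X j - X (j + 1)) * (X j * e1 - X (j + 1) * e2) - X j * c1
      + X j * c2
  · rw [Equiv.swap_apply_right]
    rw [if_pos rfl] at e2
    rw [if_neg hne] at e1
    linear_combination (X i - X (i + 1)) * (X i * e1 - X (i + 1) * e2) + X (i + 1) * c1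
      - X (i + 1) * c2
  · rw [Equiv.swap_apply_of_ne_of_ne h1 h2]
    rw [if_neg h1.symm] at e1
    rw [if_neg h2.symm] at e2
    linear_combination (X i - X (i + 1)) * (X i * e1 - X (i + 1) * e2)

theorem hasDunkl_tau_pred_two (hN : 2 ≤ N) :
    HasDunkl 2 (tau N (N - 1)) (fun _ => tau N (N - 1)) := by
  rw [tau_pred]
  exact HasDunkl.sum _ fun j _ => hasDunkl_cofactor_two hN j

end

noncomputable section

/-! ### Symmetrized states -/

/-- The state `(N!)⁻¹ ∑_π Q_π |v ∘ π⟩`. -/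
def symState {N k : ℕ} (v : Spin N k) : (Equiv.Perm (Fin N) → Poly N) →ₗ[ℂ] State N k where
  toFun Q := fun s => ((N.factorial : ℂ)⁻¹) • ∑ π : Equiv.Perm (Fin N), v (fun i => s (π i)) • Q π
  map_add' P Q := by
    funext s
    simp only [Pi.add_apply, smul_add, Finset.sum_add_distrib]
  map_smul' c Q := by
    funext s
    simp only [Pi.smul_apply, RingHom.id_apply, Finset.smul_sum]
    refine Finset.sum_congr rfl fun π _ => ?_
    rw [smul_comm _ c (Q π), smul_comm _ c]

variable {N k : ℕ}

theorem symState_apply (v : Spin N k) (Q : Equiv.Perm (Fin N) → Poly N) (s : Config N k) :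
    symState v Q s =
      ((N.factorial : ℂ)⁻¹) • ∑ π : Equiv.Perm (Fin N), v (fun i => s (π i)) • Q π := rfl

/-- From here on a symmetrized state is represented by the family of its permuted polynomials, so
that the gauge Hamiltonian need only be computed on one permuted polynomial at a time. -/
theorem symmetrize_prodState (p : Poly N) (v : Spin N k) :
    symmetrize (prodState p v) = symState v (fun π => rename π p) := by
  funext s
  simp [symmetrize, symState_apply, totalPerm, prodState, Finset.sum_apply]

theorem symState_mul (v : Spin N k) (F : Poly N) (Q : Equiv.Perm (Fin N) → Poly N) :
    symState v (fun π => F * Q π) = fun s => F * symState v Q s := by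
  funext s
  simp only [symState_apply, mul_smul_comm, Finset.mul_sum]

theorem symState_map (v : Spin N k) (T : Poly N →ₗ[ℂ] Poly N) (Q : Equiv.Perm (Fin N) → Poly N)
    (s : Config N k) : symState v (fun π => T (Q π)) s = T (symState v Q s) := by
  simp only [symState_apply, map_smul, map_sum]

theorem totalPerm_symmetrize (e : Equiv.Perm (Fin N)) (Φ : State N k) :
    totalPerm e (symmetrize Φ) = symmetrize Φ := by
  funext s
  simp only [totalPerm, symmetrize, Pi.smul_apply, Finset.sum_apply, map_smul, map_sum,
    rename_rename]
  congr 1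
  refine Fintype.sum_equiv (Equiv.mulLeft e) _ _ fun π => ?_
  rfl

/-! ### Linearity of the gauge Hamiltonian -/

variable [NeZero N]

theorem gaugeHam_add (ε : Fin 3) (a b ω : ℝ) (f g : Poly N) :
    gaugeHam ε a b ω (f + g) = gaugeHam ε a b ω f + gaugeHam ε a b ω g := by
  have hT : opT ε a (f + g) = opT ε a f + opT ε a g := by
    simp only [opT, map_add, mul_add, toRat_sub, toRat_add, Finset.sum_add_distrib, add_div,
      sub_div, Finset.sum_sub_distrib, mul_sub]
    ring
  have hm : opJminus (f + g) = opJminus f + opJminus g := by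
    simp [opJminus, Finset.sum_add_distrib]
  have hz : opJzero (f + g) = opJzero f + opJzero g := by
    simp [opJzero, Finset.sum_add_distrib, mul_add]
  simp only [gaugeHam, hT, hm, hz, mul_add, toRat_add]
  ring

theorem gaugeHam_C_mul (ε : Fin 3) (a b ω : ℝ) (c : ℂ) (f : Poly N) :
    gaugeHam ε a b ω (C c * f) = toRat (C c) * gaugeHam ε a b ω f := by
  have hT : opT ε a (C c * f) = toRat (C c) * opT ε a f := by
    have h1 : ∀ i : Fin N, C c * (X i ^ (ε : ℕ) * pderiv i f)
        - C c * (X (i + 1) ^ (ε : ℕ) * pderiv (i + 1) f)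
        = C c * (X i ^ (ε : ℕ) * pderiv i f - X (i + 1) ^ (ε : ℕ) * pderiv (i + 1) f) :=
      fun i => by ring
    have h2 : ∀ i : Fin N, C c * f - C c * rename (Equiv.swap i (i + 1)) f
        = C c * (f - rename (Equiv.swap i (i + 1)) f) := fun i => by ring
    simp only [opT, pderiv_C_mul, map_mul, rename_C, h1, h2, mul_left_comm _ (C c) _,
      ← Finset.mul_sum, toRat_mul (C c), mul_div_assoc, mul_left_comm _ (toRat (C c)) _]
    ring
  have hm : opJminus (C c * f) = C c * opJminus f := by
    simp [opJminus, Finset.mul_sum]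
  have hz : opJzero (C c * f) = C c * opJzero f := by
    simp only [opJzero, Finset.mul_sum, pderiv_C_mul, mul_left_comm]
  simp only [gaugeHam, hT, hm, hz, toRat_mul]
  ring

theorem gaugeHam_smul (ε : Fin 3) (a b ω : ℝ) (c : ℂ) (f : Poly N) :
    gaugeHam ε a b ω (c • f) = toRat (C c) * gaugeHam ε a b ω f := by
  rw [smul_eq_C_mul, gaugeHam_C_mul]

theorem gaugeHam_zero (ε : Fin 3) (a b ω : ℝ) : gaugeHam ε a b ω (0 : Poly N) = 0 := by
  simpa [toRat_zero] using gaugeHam_C_mul (N := N) ε a b ω 0 0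

theorem gaugeHam_sum {ι : Type*} (ε : Fin 3) (a b ω : ℝ) (s : Finset ι) (f : ι → Poly N) :
    gaugeHam ε a b ω (∑ i ∈ s, f i) = ∑ i ∈ s, gaugeHam ε a b ω (f i) :=
  map_sum (AddMonoidHom.mk' (gaugeHam ε a b ω) (gaugeHam_add ε a b ω)) f s

theorem gaugeMaps_symState {ε : Fin 3} {a b ω : ℝ} (v : Spin N k)
    {P Q : Equiv.Perm (Fin N) → Poly N} (h : ∀ π, gaugeHam ε a b ω (P π) = toRat (Q π)) :
    GaugeMaps ε a b ω (symState v P) (symState v Q) := by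
  intro s
  simp only [symState_apply, gaugeHam_smul, gaugeHam_sum, h]
  simp only [smul_eq_C_mul, toRat_mul, toRat_sum]

/-- The states that the gauge Hamiltonian maps into a given space. -/
def preimage (ε : Fin 3) (a b ω : ℝ) (S : Submodule ℂ (State N k)) : Submodule ℂ (State N k) where
  carrier := {Φ | ∃ Ψ ∈ S, GaugeMaps ε a b ω Φ Ψ}
  zero_mem' := ⟨0, S.zero_mem, fun s => by simp [gaugeHam_zero, toRat_zero]⟩
  add_mem' := by
    rintro Φ Φ' ⟨Ψ, h, hm⟩ ⟨Ψ', h', hm'⟩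
    refine ⟨Ψ + Ψ', S.add_mem h h', fun s => ?_⟩
    rw [Pi.add_apply, gaugeHam_add, hm s, hm' s, Pi.add_apply, toRat_add]
  smul_mem' := by
    rintro c Φ ⟨Ψ, h, hm⟩
    refine ⟨c • Ψ, S.smul_mem c h, fun s => ?_⟩
    rw [Pi.smul_apply, gaugeHam_smul, hm s, Pi.smul_apply, smul_eq_C_mul, toRat_mul]

theorem symState_mem_preimage {ε : Fin 3} {a b ω : ℝ} {S : Submodule ℂ (State N k)} {v : Spin N k}
    {P Q : Equiv.Perm (Fin N) → Poly N} (hQ : symState v Q ∈ S)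
    (h : ∀ π, gaugeHam ε a b ω (P π) = toRat (Q π)) : symState v P ∈ preimage ε a b ω S :=
  ⟨_, hQ, gaugeMaps_symState v h⟩

/-! ### Spins of the special type -/

omit [NeZero N] in
theorem symState_one_of_invariant {w : Spin N k} (hw : ∀ π, spinPerm π w = w) (s : Config N k) :
    symState w (fun _ => 1) s = C (w s) := by
  have h : ∀ π : Equiv.Perm (Fin N), w (fun i => s (π i)) = w s := fun π => congrFun (hw π) s
  simp only [symState_apply, h, Finset.sum_const, Finset.card_univ, Fintype.card_perm,
    Fintype.card_fin, smul_eq_C_mul, mul_one]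
  rw [nsmul_eq_mul, ← mul_assoc, show ((N.factorial : ℕ) : Poly N) = C (N.factorial : ℂ) by simp,
    ← C_mul, inv_mul_cancel₀ (by exact_mod_cast N.factorial_ne_zero), C_1, one_mul]

/-- Taking a coefficient commutes with symmetrization (`symState_map`), so the left side is `∑
|s_{i,i+1}⟩` by the definition of `pairSpin`. By the condition defining `Σ'` this vector is its own
symmetrization, which makes it a state of the form `Λ|s⟩`. -/
theorem symState_sum_coeff {v : Spin N k} (hv : IsSpecialSpin v) :
    symState v (fun π => ∑ i : Fin N,
        C (coeff (Finsupp.single i 1 + Finsupp.single (i + 1) 1) (X (π 0) * X (π 1) : Poly N)))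
      = symState (∑ i : Fin N, pairSpin v i (i + 1)) (fun _ => 1) := by
  funext s
  rw [symState_one_of_invariant hv]
  have := symState_map v (∑ i : Fin N, (Algebra.linearMap ℂ (Poly N)).comp
    (lcoeff ℂ (Finsupp.single i 1 + Finsupp.single (i + 1) 1)))
    (fun π => (X (π 0) * X (π 1) : Poly N)) s
  simp only [LinearMap.sum_apply, LinearMap.comp_apply, Algebra.linearMap_apply,
    MvPolynomial.algebraMap_eq, lcoeff_apply] at this
  rw [this, Finset.sum_apply, map_sum]
  refine Finset.sum_congr rfl fun i _ => ?_
  rw [pairSpin, symmetrize_prodState]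
  simp

/-! ### Renaming formal variables -/

/-- The computations use three formal variables throughout; this returns to two variables where the
spaces ask for them. -/
theorem exists_rename_of_suppIn {P : (Fin 3 → ℕ) → Prop} {f : MvPolynomial (Fin 3) ℂ}
    {ι : Fin 2 → Fin 3} (hι : Function.Injective ι) {c : Fin 3} (hc : ∀ x, x ≠ c → ∃ j, ι j = x)
    (h0 : SuppIn (fun d => d c = 0) f) (hf : SuppIn P f) :
    ∃ g : MvPolynomial (Fin 2) ℂ, rename ι g = f ∧
      SuppIn (fun e => ∃ d, P d ∧ ∀ j, d (ι j) = e j) g := by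
  classical
  have hv : (f.vars : Set (Fin 3)) ⊆ Set.range ι := by
    intro x hx
    obtain ⟨d, hd, hxd⟩ := (mem_vars_iff_mem_support x).1 hx
    refine hc x ?_
    rintro rfl
    exact (Finsupp.mem_support_iff.1 hxd) (h0 d hd)
  obtain ⟨g, rfl⟩ := exists_rename_eq_of_vars_subset_range f ι hι hv
  refine ⟨g, rfl, fun e he => ⟨Finsupp.mapDomain ι e, hf _ ?_, fun j => ?_⟩⟩
  · rw [mem_support_iff, coeff_rename_mapDomain _ hι]
    exact mem_support_iff.1 he
  · exact Finsupp.mapDomain_apply hι _ _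

theorem SuppIn.rename {P : (Fin 2 → ℕ) → Prop} {g : MvPolynomial (Fin 2) ℂ} (hg : SuppIn P g)
    {ι : Fin 2 → Fin 3} (hι : Function.Injective ι) {c : Fin 3} (hc : c ∉ Set.range ι) :
    SuppIn (fun d => d c = 0 ∧ P (fun j => d (ι j))) (MvPolynomial.rename ι g) := by
  classical
  intro d hd
  rw [mem_support_iff] at hd
  obtain ⟨e, rfl, he⟩ := coeff_rename_ne_zero _ _ _ hd
  refine ⟨Finsupp.mapDomain_of_notMem_range _ _ hc, ?_⟩
  simp only [Finsupp.mapDomain_apply hι]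
  exact hg e (mem_support_iff.2 he)

theorem SuppIn.add {m : ℕ} {P : (Fin m → ℕ) → Prop} {f g : MvPolynomial (Fin m) ℂ}
    (hf : SuppIn P f) (hg : SuppIn P g) : SuppIn P (f + g) := by
  classical
  intro d hd
  rcases Finset.mem_union.1 (support_add hd) with h | h
  exacts [hf d h, hg d h]

omit [NeZero N] in
/-- A bound on the weighted degree of a formal polynomial bounds the degree after substitution. -/
theorem eq_zero_or_totalDegree_aeval_le {m n c : ℕ} {p : Fin m → Poly N} {w : Fin m → ℕ}
    (hp : ∀ k, (p k).IsHomogeneous (w k)) {f : MvPolynomial (Fin m) ℂ}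
    (hf : SuppIn (fun d => ∑ k, w k * d k + c ≤ n) f) :
    f = 0 ∨ (aeval p f).totalDegree + c ≤ n := by
  by_cases hc : c ≤ n
  · exact Or.inr (totalDegree_aeval_le hp hf hc)
  · left
    by_contra h
    obtain ⟨d, hd⟩ := support_nonempty.2 h
    have := hf d hd
    simp only at this
    omega

end

/-! ### Invariance of the spaces under the gauge Hamiltonian. -/

noncomputable section

variable {N k : ℕ}

theorem mul_symmetrize_eq (F q : Poly N) (v : Spin N k) :
    (fun s => F * symmetrize (prodState q v) s) = symState v (fun π => F * rename π q) := by
  rw [symState_mul, symmetrize_prodState]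

theorem symState_mul_eq_zero (v : Spin N k) {F : Poly N} (hF : F = 0)
    (Q : Equiv.Perm (Fin N) → Poly N) : symState v (fun π => F * Q π) = 0 := by
  subst hF
  rw [symState_mul]
  funext s
  simp

variable [NeZero N]

/-! ### The rational case -/

/-- The symmetric polynomials generating the coefficients for `ε = 0`. -/
abbrev gens0 (N : ℕ) : Fin 3 → Poly N := ![sigma N 1, sigma N 2, sigma N 3]

omit [NeZero N] in
theorem isHomogeneous_gens0 : ∀ i, (gens0 N i).IsHomogeneous ((![1, 2, 3] : Fin 3 → ℕ) i) := by
  intro i; fin_cases i <;> exact isHomogeneous_sigma _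

omit [NeZero N] in
theorem isSymmetric_gens0 : ∀ i, (gens0 N i).IsSymmetric := by
  intro i; fin_cases i <;> exact isSymmetric_sigma _

/-- Exponents of weight at most `n - c` in which the last variable has exponent at most `r`. -/
def Adm0 (n r c : ℕ) (d : Fin 3 → ℕ) : Prop := d 2 ≤ r ∧ d 0 + 2 * d 1 + 3 * d 2 + c ≤ n

omit [NeZero N] in
theorem degree_bound0 {n r c : ℕ} {f : MvPolynomial (Fin 3) ℂ} (hf : SuppIn (Adm0 n r c) f) :
    f = 0 ∨ (aeval (gens0 N) f).totalDegree + c ≤ n := by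
  refine eq_zero_or_totalDegree_aeval_le isHomogeneous_gens0 (hf.mono fun d hd => ?_)
  simp only [Fin.sum_univ_three]
  have := hd.2
  simp; omega

omit [NeZero N] in
theorem exists_adm0 {n r c : ℕ} {f : MvPolynomial (Fin 3) ℂ} (hf : SuppIn (fun d => d 2 ≤ r) f)
    (hd : (aeval (gens0 N) f).totalDegree + c ≤ n) :
    ∃ g, aeval (gens0 N) g = aeval (gens0 N) f ∧ SuppIn (Adm0 n r c) g := by
  obtain ⟨g, h1, h2⟩ := aeval_eq_of_totalDegree_le (isHomogeneous_gens0 (N := N)) f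
    (n := n - c) (Nat.le_sub_of_add_le hd)
  refine ⟨g, h1, fun d hg => ⟨hf d (h2 d hg).1, ?_⟩⟩
  have := (h2 d hg).2
  rw [Fin.sum_univ_three] at this
  simp at this
  omega

/-- The inclusion of the first two variables. -/
abbrev incl01 : Fin 2 → Fin 3 := ![0, 1]

theorem incl01_injective : Function.Injective incl01 := by decide

omit [NeZero N] in
theorem exists_two_var0 {n c : ℕ} {f : MvPolynomial (Fin 3) ℂ} (hf : SuppIn (Adm0 n 0 c) f) :
    ∃ h : MvPolynomial (Fin 2) ℂ, aeval ![sigma N 1, sigma N 2] h = aeval (gens0 N) f := by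
  obtain ⟨g, rfl, -⟩ := exists_rename_of_suppIn incl01_injective (c := 2) (by decide)
    (hf.mono fun d hd => Nat.le_zero.1 hd.1) hf
  refine ⟨g, ?_⟩
  rw [aeval_rename]
  congr 1
  ext j
  fin_cases j <;> simp

omit [NeZero N] in
theorem exists_three_var0 {n c : ℕ} {h : MvPolynomial (Fin 2) ℂ}
    (hd : (aeval ![sigma N 1, sigma N 2] h).totalDegree + c ≤ n) :
    ∃ f, aeval (gens0 N) f = aeval ![sigma N 1, sigma N 2] h ∧ SuppIn (Adm0 n 0 c) f := by
  have e : aeval (gens0 N) (rename incl01 h) = aeval ![sigma N 1, sigma N 2] h := by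
    rw [aeval_rename]
    congr 1
    ext j
    fin_cases j <;> simp
  obtain ⟨g, h1, h2⟩ := exists_adm0 (N := N) (n := n) (r := 0) (c := c) (f := rename incl01 h)
    (by
      have : SuppIn (fun _ => True) h := fun _ _ => trivial
      exact (this.rename incl01_injective (c := 2) (by decide)).mono fun d hd => hd.1.le)
    (by rw [e]; exact hd)
  exact ⟨g, h1.trans e, h2⟩

variable {n : ℕ}

theorem mem_space0_one (v : Spin N k) {f : MvPolynomial (Fin 3) ℂ} (hf : SuppIn (Adm0 n 1 0) f) :
    symState v (fun _ => aeval (gens0 N) f) ∈ space0 N k n := by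
  rcases degree_bound0 (N := N) hf with rfl | hd
  · simp only [map_zero]
    exact (symState v).map_zero ▸ Submodule.zero_mem _
  · refine Submodule.subset_span (Or.inl (Or.inl (Or.inl ⟨f, v, ?_, hd, ?_⟩)))
    · exact pderiv_pderiv_eq_zero_of_suppIn (hf.mono fun d h => h.1)
    · rw [mul_symmetrize_eq]; simp [substPoly]

theorem mem_space0_X (v : Spin N k) {f : MvPolynomial (Fin 3) ℂ} (hf : SuppIn (Adm0 n 1 1) f) :
    symState v (fun π => aeval (gens0 N) f * X (π 0)) ∈ space0 N k n := by
  -- For `n = 0` no exponent is admissible, so `f = 0` and the degree condition of the generator is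
  -- not available.
  rcases degree_bound0 (N := N) hf with rfl | hd
  · rw [symState_mul_eq_zero _ (map_zero _)]
    exact Submodule.zero_mem _
  · refine Submodule.subset_span (Or.inl (Or.inl (Or.inr ⟨f, v, ?_, hd, ?_⟩)))
    · exact pderiv_pderiv_eq_zero_of_suppIn (hf.mono fun d h => h.1)
    · rw [mul_symmetrize_eq]; simp [substPoly]

theorem mem_space0_sq (v : Spin N k) {f : MvPolynomial (Fin 3) ℂ} (hf : SuppIn (Adm0 n 0 2) f) :
    symState v (fun π => aeval (gens0 N) f * X (π 0) ^ 2) ∈ space0 N k n := by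
  rcases degree_bound0 (N := N) hf with rfl | hd
  · rw [symState_mul_eq_zero _ (map_zero _)]
    exact Submodule.zero_mem _
  · obtain ⟨h, e⟩ := exists_two_var0 (N := N) hf
    rw [← e] at hd ⊢
    refine Submodule.subset_span (Or.inl (Or.inr ⟨h, v, hd, ?_⟩))
    rw [mul_symmetrize_eq]; simp [substPoly]

theorem mem_space0_mul {v : Spin N k} (hv : IsSpecialSpin v) {f : MvPolynomial (Fin 3) ℂ}
    (hf : SuppIn (Adm0 n 0 2) f) :
    symState v (fun π => aeval (gens0 N) f * (X (π 0) * X (π 1))) ∈ space0 N k n := by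
  rcases degree_bound0 (N := N) hf with rfl | hd
  · rw [symState_mul_eq_zero _ (map_zero _)]
    exact Submodule.zero_mem _
  · obtain ⟨h, e⟩ := exists_two_var0 (N := N) hf
    rw [← e] at hd ⊢
    refine Submodule.subset_span (Or.inr ⟨h, v, hv, hd, ?_⟩)
    rw [mul_symmetrize_eq]; simp [substPoly]

/-- Differential and degree conditions are exchanged for admissible exponents of three-variable
polynomials, so that all four families take the form `f · φ` of `gaugeHam_aeval_mul`. -/
theorem space0_le {S : Submodule ℂ (State N k)}
    (h1 : ∀ (v : Spin N k) (f : MvPolynomial (Fin 3) ℂ), SuppIn (Adm0 n 1 0) f →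
      symState v (fun _ => aeval (gens0 N) f * 1) ∈ S)
    (h2 : ∀ (v : Spin N k) (f : MvPolynomial (Fin 3) ℂ), SuppIn (Adm0 n 1 1) f →
      symState v (fun π => aeval (gens0 N) f * X (π 0)) ∈ S)
    (h3 : ∀ (v : Spin N k) (f : MvPolynomial (Fin 3) ℂ), SuppIn (Adm0 n 0 2) f →
      symState v (fun π => aeval (gens0 N) f * X (π 0) ^ 2) ∈ S)
    (h4 : ∀ v : Spin N k, IsSpecialSpin v → ∀ f : MvPolynomial (Fin 3) ℂ, SuppIn (Adm0 n 0 2) f →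
      symState v (fun π => aeval (gens0 N) f * (X (π 0) * X (π 1))) ∈ S) :
    space0 N k n ≤ S := by
  refine Submodule.span_le.2 ?_
  rintro Φ (((⟨f, v, hf, hd, rfl⟩ | ⟨f, v, hf, hd, rfl⟩) | ⟨f, v, hd, rfl⟩) | ⟨f, v, hv, hd, rfl⟩)
  · obtain ⟨g, e, hg⟩ := exists_adm0 (N := N) (c := 0) (suppIn_of_pderiv_pderiv_eq_zero hf) hd
    have := h1 v g hg
    rw [e] at this
    rw [mul_symmetrize_eq]
    simp only [map_one]
    exact this
  · obtain ⟨g, e, hg⟩ := exists_adm0 (N := N) (suppIn_of_pderiv_pderiv_eq_zero hf) hd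
    have := h2 v g hg
    rw [e] at this
    rw [mul_symmetrize_eq]
    simp only [rename_X]
    exact this
  · obtain ⟨g, e, hg⟩ := exists_three_var0 (N := N) hd
    have := h3 v g hg
    rw [e] at this
    rw [mul_symmetrize_eq]
    simp only [map_pow, rename_X]
    exact this
  · obtain ⟨g, e, hg⟩ := exists_three_var0 (N := N) hd
    have := h4 v hv g hg
    rw [e] at this
    rw [mul_symmetrize_eq]
    simp only [map_mul, rename_X]
    exact this

/-- The action of the gauge Hamiltonian for `ε = 0` on functions of `σ_1, σ_2, σ_3`, without the
constant term. -/
def act0 (N : ℕ) (a ω : ℝ) (f : MvPolynomial (Fin 3) ℂ) : MvPolynomial (Fin 3) ℂ :=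
  C (constZero 0 a ω : ℂ) * (X 0 * pderiv 0 f)
  + C (constC 0 * (2 * N + 4 * a * N) : ℂ) * pderiv 1 f
  + C (2 * constZero 0 a ω : ℂ) * (X 1 * pderiv 1 f)
  + C (constC 0 * (6 + 12 * a) : ℂ) * (X 0 * pderiv 2 f)
  + C (3 * constZero 0 a ω : ℂ) * (X 2 * pderiv 2 f)
  + C (constC 0 * N : ℂ) * pderiv 0 (pderiv 0 f)
  + C (2 * constC 0 : ℂ) * (X 0 * pderiv 0 (pderiv 1 f))
  + C (2 * constC 0 : ℂ) * (X 0 * pderiv 1 (pderiv 0 f))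
  + C (3 * constC 0 : ℂ) * (X 1 * pderiv 0 (pderiv 2 f))
  + C (3 * constC 0 : ℂ) * (X 1 * pderiv 2 (pderiv 0 f))
  + C (4 * constC 0 : ℂ) * (X 1 * pderiv 1 (pderiv 1 f))
  + C (6 * constC 0 : ℂ) * (X 2 * pderiv 1 (pderiv 2 f))
  + C (6 * constC 0 : ℂ) * (X 2 * pderiv 2 (pderiv 1 f))

omit [NeZero N] in
-- Terms coming from `J^0` preserve the weight and all others lower it by two. The variable `σ_3` is
-- only multiplied in where a derivative in `σ_3` has been taken.
theorem suppIn_act0 {r c : ℕ} {f : MvPolynomial (Fin 3) ℂ} (hf : SuppIn (Adm0 n r c) f)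
    (a ω : ℝ) : SuppIn (Adm0 n r c) (act0 N a ω f) := by
  have hX : ∀ {P} {g : MvPolynomial (Fin 3) ℂ}, SuppIn P g → ∀ i,
      (∀ e, P e → Adm0 n r c (e + Pi.single i 1)) → SuppIn (Adm0 n r c) (X i * g) :=
    fun h i h' => (h.X_mul i).mono (by rintro _ ⟨e, rfl, he⟩; exact h' e he)
  refine .add (.add (.add (.add (.add (.add (.add (.add (.add (.add (.add (.add (.C_mul (hX (hf.pderiv _) _ ?_) _)
    (.C_mul ((hf.pderiv _).mono ?_) _))
    (.C_mul (hX (hf.pderiv _) _ ?_) _))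
    (.C_mul (hX (hf.pderiv _) _ ?_) _))
    (.C_mul (hX (hf.pderiv _) _ ?_) _))
    (.C_mul (((hf.pderiv _).pderiv _).mono ?_) _))
    (.C_mul (hX ((hf.pderiv _).pderiv _) _ ?_) _))
    (.C_mul (hX ((hf.pderiv _).pderiv _) _ ?_) _))
    (.C_mul (hX ((hf.pderiv _).pderiv _) _ ?_) _))
    (.C_mul (hX ((hf.pderiv _).pderiv _) _ ?_) _))
    (.C_mul (hX ((hf.pderiv _).pderiv _) _ ?_) _))
    (.C_mul (hX ((hf.pderiv _).pderiv _) _ ?_) _))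
    (.C_mul (hX ((hf.pderiv _).pderiv _) _ ?_) _)
  all_goals
    intro e he
    simp only [Adm0, Pi.add_apply, Pi.single_apply] at he ⊢
    simp at he ⊢
    omega

/-- The hypothesis `hf` removes the one second-order term outside `ℂ[σ_1, σ_2, σ_3]`, namely `∑ (∂_i
σ_3)² = 9 σ_4`. -/
theorem gaugeHam_zero_mul (hN : 2 ≤ N) {φ : Poly N} {R : Fin N → Poly N} (hφ : HasDunkl 0 φ R)
    {f : MvPolynomial (Fin 3) ℂ} (hf : pderiv 2 (pderiv 2 f) = 0) (a b ω : ℝ) :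
    gaugeHam 0 a b ω (aeval (gens0 N) f * φ) = toRat (
      aeval (gens0 N) f * gaugePoly 0 a b ω φ R + aeval (gens0 N) (act0 N a ω f) * φ
      + C (2 * constC 0 : ℂ) * (aeval (gens0 N) (pderiv 0 f) * opGamma 0 (sigma N 1) φ
        + aeval (gens0 N) (pderiv 1 f) * opGamma 0 (sigma N 2) φ
        + aeval (gens0 N) (pderiv 2 f) * opGamma 0 (sigma N 3) φ)) := by
  -- Divided differences of `k z^{k-1}`. Their cyclic sums are symmetric because they contain no
  -- products `z_i z_{i+1}`; the divided difference for `σ_4` would contain one.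
  have hD : ∀ j, HasDunkl 0 (gens0 N j)
      ((![fun _ => 0, fun _ => C 2, fun i => C 3 * (X i + X (i + 1))] :
        Fin 3 → Fin N → Poly N) j) := by
    intro j
    fin_cases j
    · exact hasDunkl_sigma_of fun i => by simp
    · exact hasDunkl_sigma_of fun i => by simp; ring
    · exact hasDunkl_sigma_of fun i => by simp; ring
  rw [gaugeHam_aeval_mul hN isSymmetric_gens0 hD hφ]
  refine congrArg toRat ?_
  have hm : constMinus 0 b = 0 := rfl
  simp only [Fin.sum_univ_three, hf, map_zero, zero_mul, add_zero]
  simp [gaugePoly, hm, opDelta_sigma, opJzero_sigma, opGamma_sigma_sigma, ← Finset.mul_sum,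
    act0, sigma_zero, sum_X_add_X]
  simp only [map_ofNat]
  ring

omit [NeZero N] in
theorem opGamma_X_left (ε : Fin 3) (j : Fin N) (φ : Poly N) :
    opGamma ε (X j) φ = X j ^ (ε : ℕ) * pderiv j φ := by
  have := sum_pderiv_X_mul (fun i => X i ^ (ε : ℕ) * pderiv i φ) j
  rw [← this]
  exact Finset.sum_congr rfl fun i _ => by ring

omit [NeZero N] in
theorem opGamma_one (ε : Fin 3) (p : Poly N) : opGamma ε p 1 = 0 := by
  simp [opGamma]

omit [NeZero N] in
theorem opDelta_one (ε : Fin 3) : opDelta ε (1 : Poly N) = 0 := by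
  simp [opDelta]

omit [NeZero N] in
theorem opJminus_one : opJminus (1 : Poly N) = 0 := by
  simp [opJminus]

omit [NeZero N] in
theorem opJzero_one : opJzero (1 : Poly N) = 0 := by
  simp [opJzero]

omit [NeZero N] in
-- Right translation of the summation index. For a transposition it reads `Λ(z_2 |s⟩) = Λ(z_1 S_{12}
-- |s⟩)`.
theorem symState_comp (v : Spin N k) (σ : Equiv.Perm (Fin N)) (Q : Equiv.Perm (Fin N) → Poly N) :
    symState v Q = symState (spinPerm σ v) (fun π => Q (π * σ)) := by
  funext s
  rw [symState_apply, symState_apply]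
  congr 1
  exact (Equiv.sum_comp (Equiv.mulRight σ) fun π => v (fun i => s (π i)) • Q π).symm

theorem SuppIn.pderiv_mono {m : ℕ} {P Q : (Fin m → ℕ) → Prop} {f : MvPolynomial (Fin m) ℂ}
    (hf : SuppIn P f) (i : Fin m) (h : ∀ e, P (e + Pi.single i 1) → Q e) :
    SuppIn Q (MvPolynomial.pderiv i f) := (hf.pderiv i).mono h

theorem symState_mem_preimage0_one (hN : 2 ≤ N) (a b ω : ℝ) (v : Spin N k)
    {f : MvPolynomial (Fin 3) ℂ} (hf : SuppIn (Adm0 n 1 0) f) :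
    symState v (fun _ => aeval (gens0 N) f * 1) ∈ preimage 0 a b ω (space0 N k n) := by
  refine ⟨_, mem_space0_one v ((hf.C_mul (constE 0 N a b ω)).add (suppIn_act0 (N := N) hf a ω)),
    gaugeMaps_symState v fun π => ?_⟩
  rw [gaugeHam_zero_mul hN (hasDunkl_one 0)
    (pderiv_pderiv_eq_zero_of_suppIn (hf.mono fun d h => h.1))]
  refine congrArg toRat ?_
  simp [gaugePoly, opGamma_one, opDelta_one, opJminus_one, opJzero_one]
  ring

/-- The coupling of `σ_k` with `z_j` is `k z_j^{k-1}`, so the three first derivatives of `f` feed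
the families of `1`, `z_j` and `z_j²`. The last gets `∂f/∂σ_3`, which is free of `σ_3` as that
family requires. -/
theorem symState_mem_preimage0_X (hN : 2 ≤ N) (a b ω : ℝ) (v : Spin N k)
    {f : MvPolynomial (Fin 3) ℂ} (hf : SuppIn (Adm0 n 1 1) f) :
    symState v (fun π => aeval (gens0 N) f * X (π 0)) ∈ preimage 0 a b ω (space0 N k n) := by
  have hm : constMinus 0 b = 0 := rfl
  have m1 := mem_space0_X v (((hf.C_mul (constZero 0 a ω + constE 0 N a b ω)).add (suppIn_act0 (N := N) hf a ω)).add
    ((hf.pderiv_mono (Q := Adm0 n 1 1) 1 (fun e he => by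
      simp [Adm0] at he ⊢; omega)).C_mul (4 * constC 0)))
  have m2 := mem_space0_one v ((hf.pderiv_mono (Q := Adm0 n 1 0) 0 (fun e he => by
      simp [Adm0] at he ⊢; omega)).C_mul (2 * constC 0))
  have m3 := mem_space0_sq v ((hf.pderiv_mono (Q := Adm0 n 0 2) 2 (fun e he => by
      simp [Adm0] at he ⊢; omega)).C_mul (6 * constC 0))
  have hmem := add_mem (add_mem m1 m2) m3
  rw [← map_add, ← map_add] at hmem
  refine symState_mem_preimage hmem fun π => ?_
  rw [gaugeHam_zero_mul hN (hasDunkl_X_zero hN (π 0))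
    (pderiv_pderiv_eq_zero_of_suppIn (hf.mono fun d h => h.1))]
  refine congrArg toRat ?_
  simp [gaugePoly, opGamma_sigma_X, opDelta_X, opJminus_X, opJzero_X, hm]
  simp only [map_ofNat]
  ring

/-- A dependence on `σ_3` would couple to `z_j²` through `6 z_j³`, outside the space; hence two
variables only. The constant `2 + 4a` is `∂_j² z_j² = 2` plus `2a` times the two pairs that contain
`j`. -/
theorem symState_mem_preimage0_sq (hN : 2 ≤ N) (a b ω : ℝ) (v : Spin N k)
    {f : MvPolynomial (Fin 3) ℂ} (hf : SuppIn (Adm0 n 0 2) f) :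
    symState v (fun π => aeval (gens0 N) f * X (π 0) ^ 2) ∈ preimage 0 a b ω (space0 N k n) := by
  have hm : constMinus 0 b = 0 := rfl
  have m1 := mem_space0_sq v
    (((hf.C_mul (2 * constZero 0 a ω + constE 0 N a b ω)).add (suppIn_act0 (N := N) hf a ω)).add
    ((hf.pderiv_mono (Q := Adm0 n 0 2) 1 (fun e he => by
      simp [Adm0] at he ⊢; omega)).C_mul (8 * constC 0)))
  have m2 := mem_space0_X v ((hf.pderiv_mono (Q := Adm0 n 1 1) 0 (fun e he => by
      simp [Adm0] at he ⊢; omega)).C_mul (4 * constC 0))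
  have m3 := mem_space0_one v ((hf.mono (Q := Adm0 n 1 0) (fun e he => by
      simp [Adm0] at he ⊢; omega)).C_mul (constC 0 * (2 + 4 * a)))
  have hmem := add_mem (add_mem m1 m2) m3
  rw [← map_add, ← map_add] at hmem
  refine symState_mem_preimage hmem fun π => ?_
  have hz : pderiv 2 f = 0 := pderiv_eq_zero_of_suppIn (hf.mono fun d h => Nat.le_zero.1 h.1)
  rw [gaugeHam_zero_mul hN (hasDunkl_X_sq_zero hN (π 0)) (by rw [hz, map_zero])]
  refine congrArg toRat ?_
  simp [gaugePoly, sq, opGamma_mul_right, opDelta_mul, opJzero_mul, opGamma_X_left,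
    opGamma_sigma_X, opDelta_X, opJzero_X, hm, hz, sum_incidence]
  simp only [map_ofNat]
  ring

theorem symState_mem_preimage0_mul (hN : 2 ≤ N) (a b ω : ℝ) {v : Spin N k} (hv : IsSpecialSpin v)
    {f : MvPolynomial (Fin 3) ℂ} (hf : SuppIn (Adm0 n 0 2) f) :
    symState v (fun π => aeval (gens0 N) f * (X (π 0) * X (π 1))) ∈ preimage 0 a b ω (space0 N k n) := by
  have hm : constMinus 0 b = 0 := rfl
  have m1 := mem_space0_mul hv
    (((hf.C_mul (2 * constZero 0 a ω + constE 0 N a b ω)).add (suppIn_act0 (N := N) hf a ω)).add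
    ((hf.pderiv_mono (Q := Adm0 n 0 2) 1 (fun e he => by
      simp [Adm0] at he ⊢; omega)).C_mul (8 * constC 0)))
  have h2 := (hf.pderiv_mono (Q := Adm0 n 1 1) 0 (fun e he => by
      simp [Adm0] at he ⊢; omega)).C_mul (2 * constC 0)
  have m2 := mem_space0_X v h2
  -- The coupling of `σ_1` with `z_j z_l` is `z_j + z_l`; its second summand is moved to the first
  -- coordinate by exchanging the spins.
  have m2' := mem_space0_X (spinPerm (Equiv.swap 0 1) v) h2
  have h3 := (hf.mono (Q := Adm0 n 1 0) (fun e he => by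
      simp [Adm0] at he ⊢; omega)).C_mul (-(2 * a * constC 0))
  -- The neighbour indicator, summed over the ring, becomes a state of the first family.
  have m3 := mem_space0_one (∑ i : Fin N, pairSpin v i (i + 1)) h3
  have e2 : symState (spinPerm (Equiv.swap 0 1) v)
      (fun π => aeval (gens0 N) (C (2 * (constC 0 : ℂ)) * pderiv 0 f) * X (π 0))
      = symState v (fun π => aeval (gens0 N) (C (2 * (constC 0 : ℂ)) * pderiv 0 f) * X (π 1)) := by
    rw [symState_comp v (Equiv.swap 0 1)]
    simp
  have e3 : symState (∑ i : Fin N, pairSpin v i (i + 1))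
      (fun _ => aeval (gens0 N) (C (-(2 * a * constC 0 : ℂ)) * f))
      = symState v (fun π => aeval (gens0 N) (C (-(2 * a * constC 0 : ℂ)) * f) *
        ∑ i : Fin N, C (coeff (Finsupp.single i 1 + Finsupp.single (i + 1) 1)
          (X (π 0) * X (π 1) : Poly N))) := by
    rw [symState_mul, symState_sum_coeff hv, ← symState_mul]
    simp
  rw [e2] at m2'
  rw [e3] at m3
  have hmem := add_mem (add_mem (add_mem m1 m2) m2') m3
  rw [← map_add, ← map_add, ← map_add] at hmem
  refine symState_mem_preimage hmem fun π => ?_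
  have hz : pderiv 2 f = 0 := pderiv_eq_zero_of_suppIn (hf.mono fun d h => Nat.le_zero.1 h.1)
  have h01 : (0 : Fin N) ≠ 1 := by simpa using fin_ne_add_one hN 0
  have hπ : π 0 ≠ π 1 := π.injective.ne h01
  rw [gaugeHam_zero_mul hN (hasDunkl_X_mul_X_zero hN hπ) (by rw [hz, map_zero])]
  refine congrArg toRat ?_
  simp [gaugePoly, opGamma_mul_right, opDelta_mul, opJzero_mul, opGamma_X_left,
    opGamma_sigma_X, opDelta_X, opJzero_X, hm, hz, pderiv_X_of_ne hπ.symm]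
  simp only [map_ofNat]
  ring

theorem space0_le_preimage (hN : 2 ≤ N) (a b ω : ℝ) :
    space0 N k n ≤ preimage 0 a b ω (space0 N k n) :=
  space0_le (fun v _ hf => symState_mem_preimage0_one hN a b ω v hf)
    (fun v _ hf => symState_mem_preimage0_X hN a b ω v hf)
    (fun v _ hf => symState_mem_preimage0_sq hN a b ω v hf)
    (fun _ hv _ hf => symState_mem_preimage0_mul hN a b ω hv hf)

end

noncomputable section

variable {N k n : ℕ}

/-! ### The case `ε = 1` -/

/-- The symmetric polynomials generating the coefficients for `ε = 1`. -/
abbrev gens1 (N : ℕ) : Fin 3 → Poly N := ![sigma N 1, sigma N 2, tau N N]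

theorem isHomogeneous_gens1 : ∀ i, (gens1 N i).IsHomogeneous ((![1, 2, N] : Fin 3 → ℕ) i) := by
  intro i; fin_cases i
  exacts [isHomogeneous_sigma 1, isHomogeneous_sigma 2, isHomogeneous_tau N]

theorem isSymmetric_gens1 : ∀ i, (gens1 N i).IsSymmetric := by
  intro i; fin_cases i
  exacts [isSymmetric_sigma 1, isSymmetric_sigma 2, isSymmetric_tau N]

/-- Exponents of weight at most `n - c` in which the second variable has exponent at most `r`
and the last variable does not occur. -/
def Adm1 (n r c : ℕ) (d : Fin 3 → ℕ) : Prop := d 1 ≤ r ∧ d 2 = 0 ∧ d 0 + 2 * d 1 + c ≤ n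

theorem degree_bound1 {r c : ℕ} {f : MvPolynomial (Fin 3) ℂ} (hf : SuppIn (Adm1 n r c) f) :
    f = 0 ∨ (aeval (gens1 N) f).totalDegree + c ≤ n := by
  refine eq_zero_or_totalDegree_aeval_le isHomogeneous_gens1 (hf.mono fun d hd => ?_)
  obtain ⟨-, h2, h3⟩ := hd
  simp [Fin.sum_univ_three, h2]
  exact h3

theorem exists_adm1 {r c : ℕ} {f : MvPolynomial (Fin 3) ℂ}
    (hf : SuppIn (fun d => d 1 ≤ r ∧ d 2 = 0) f)
    (hd : (aeval (gens1 N) f).totalDegree + c ≤ n) :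
    ∃ g, aeval (gens1 N) g = aeval (gens1 N) f ∧ SuppIn (Adm1 n r c) g := by
  obtain ⟨g, h1, h2⟩ := aeval_eq_of_totalDegree_le (isHomogeneous_gens1 (N := N)) f
    (n := n - c) (Nat.le_sub_of_add_le hd)
  refine ⟨g, h1, fun d hg => ⟨(hf d (h2 d hg).1).1, (hf d (h2 d hg).1).2, ?_⟩⟩
  have := (h2 d hg).2
  rw [Fin.sum_univ_three] at this
  simp [(hf d (h2 d hg).1).2] at this
  omega

/-- The inclusion of the first and last variables. -/
abbrev incl02 : Fin 2 → Fin 3 := ![0, 2]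

theorem incl02_injective : Function.Injective incl02 := by decide

theorem aeval_rename_incl02 (p : Fin 3 → Poly N) (g : MvPolynomial (Fin 2) ℂ) :
    aeval p (rename incl02 g) = aeval ![p 0, p 2] g := by
  rw [aeval_rename]
  congr 1
  ext j
  fin_cases j <;> simp

variable [NeZero N]

theorem mem_space1_one (v : Spin N k) {f : MvPolynomial (Fin 3) ℂ} (hf : SuppIn (Adm1 n 1 0) f) :
    symState v (fun _ => aeval (gens1 N) f) ∈ space1 N k n := by
  rcases degree_bound1 (N := N) hf with rfl | hd
  · simp only [map_zero]
    exact (symState v).map_zero ▸ Submodule.zero_mem _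
  · refine Submodule.subset_span (Or.inl ⟨f, v, ?_, ?_, hd, ?_⟩)
    · exact pderiv_pderiv_eq_zero_of_suppIn (hf.mono fun d h => h.1)
    · exact pderiv_eq_zero_of_suppIn (hf.mono fun d h => h.2.1)
    · rw [mul_symmetrize_eq]; simp [substPoly]

theorem mem_space1_X (v : Spin N k) {f : MvPolynomial (Fin 3) ℂ} (hf : SuppIn (Adm1 n 0 1) f) :
    symState v (fun π => aeval (gens1 N) f * X (π 0)) ∈ space1 N k n := by
  rcases degree_bound1 (N := N) hf with rfl | hd
  · rw [symState_mul_eq_zero _ (map_zero _)]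
    exact Submodule.zero_mem _
  · obtain ⟨g, rfl, hg⟩ := exists_rename_of_suppIn incl02_injective (c := 1) (by decide)
      (hf.mono fun d hd => Nat.le_zero.1 hd.1) hf
    rw [aeval_rename_incl02] at hd ⊢
    refine Submodule.subset_span (Or.inr ⟨g, v, ?_, hd, ?_⟩)
    · refine pderiv_eq_zero_of_suppIn (hg.mono ?_)
      rintro e ⟨d, hd, h⟩
      exact (h 1).symm.trans hd.2.1
    · rw [mul_symmetrize_eq]; simp [substPoly]

theorem space1_le {S : Submodule ℂ (State N k)}
    (h1 : ∀ (v : Spin N k) (f : MvPolynomial (Fin 3) ℂ), SuppIn (Adm1 n 1 0) f →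
      symState v (fun _ => aeval (gens1 N) f * 1) ∈ S)
    (h2 : ∀ (v : Spin N k) (f : MvPolynomial (Fin 3) ℂ), SuppIn (Adm1 n 0 1) f →
      symState v (fun π => aeval (gens1 N) f * X (π 0)) ∈ S) :
    space1 N k n ≤ S := by
  refine Submodule.span_le.2 ?_
  rintro Φ (⟨f, v, hf, hf', hd, rfl⟩ | ⟨f, v, hf, hd, rfl⟩)
  · obtain ⟨g, e, hg⟩ := exists_adm1 (N := N) (c := 0) (r := 1) (fun d hd =>
      ⟨suppIn_of_pderiv_pderiv_eq_zero hf d hd, suppIn_of_pderiv_eq_zero hf' d hd⟩) hd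
    have := h1 v g hg
    rw [e] at this
    rw [mul_symmetrize_eq]
    simp only [map_one]
    exact this
  · have hr : aeval (gens1 N) (rename incl02 f) = aeval ![sigma N 1, tau N N] f :=
      aeval_rename_incl02 _ _
    obtain ⟨g, e, hg⟩ := exists_adm1 (N := N) (n := n) (c := 1) (r := 0) (f := rename incl02 f)
      (((suppIn_of_pderiv_eq_zero hf).rename incl02_injective (c := 1) (by decide)).mono
        fun d hd => ⟨hd.1.le, hd.2⟩) (by rw [hr]; exact hd)
    have := h2 v g hg
    rw [e, hr] at this
    rw [mul_symmetrize_eq]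
    simp only [rename_X]
    exact this

/-- The action of the gauge Hamiltonian for `ε = 1` on functions of `σ_1, σ_2`, without the
constant term. -/
def act1 (N : ℕ) (a b ω : ℝ) (f : MvPolynomial (Fin 3) ℂ) : MvPolynomial (Fin 3) ℂ :=
  C (constC 1 * 2 * a * N + constMinus 1 b * N : ℂ) * pderiv 0 f
  + C (constZero 1 a ω : ℂ) * (X 0 * pderiv 0 f)
  + C (constC 1 * (2 + 8 * a) + 2 * constMinus 1 b : ℂ) * (X 0 * pderiv 1 f)
  + C (2 * constZero 1 a ω : ℂ) * (X 1 * pderiv 1 f)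
  + C (constC 1 : ℂ) * (X 0 * pderiv 0 (pderiv 0 f))
  + C (2 * constC 1 : ℂ) * (X 1 * pderiv 0 (pderiv 1 f))
  + C (2 * constC 1 : ℂ) * (X 1 * pderiv 1 (pderiv 0 f))

omit [NeZero N] in
-- Here every term preserves the weight or lowers it by one, and `σ_2` is multiplied in only after a
-- derivative in `σ_2`.
theorem suppIn_act1 {r c : ℕ} {f : MvPolynomial (Fin 3) ℂ} (hf : SuppIn (Adm1 n r c) f)
    (a b ω : ℝ) : SuppIn (Adm1 n r c) (act1 N a b ω f) := by
  have hX : ∀ {P} {g : MvPolynomial (Fin 3) ℂ}, SuppIn P g → ∀ i,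
      (∀ e, P e → Adm1 n r c (e + Pi.single i 1)) → SuppIn (Adm1 n r c) (X i * g) :=
    fun h i h' => (h.X_mul i).mono (by rintro _ ⟨e, rfl, he⟩; exact h' e he)
  refine .add (.add (.add (.add (.add (.add (.C_mul (hf.pderiv_mono _ ?_) _)
    (.C_mul (hX (hf.pderiv _) _ ?_) _))
    (.C_mul (hX (hf.pderiv _) _ ?_) _))
    (.C_mul (hX (hf.pderiv _) _ ?_) _))
    (.C_mul (hX ((hf.pderiv _).pderiv _) _ ?_) _))
    (.C_mul (hX ((hf.pderiv _).pderiv _) _ ?_) _))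
    (.C_mul (hX ((hf.pderiv _).pderiv _) _ ?_) _)
  all_goals
    intro e he
    simp only [Adm1, Pi.add_apply, Pi.single_apply] at he ⊢
    simp at he ⊢
    omega

/-- The hypothesis `hf` removes `∑ z_i (∂_i σ_2)² = 4 σ_3`; the other three discard all
contributions of `τ_N`. -/
theorem gaugeHam_one_mul (hN : 2 ≤ N) {φ : Poly N} {R : Fin N → Poly N} (hφ : HasDunkl 1 φ R)
    {f : MvPolynomial (Fin 3) ℂ} (hf : pderiv 1 (pderiv 1 f) = 0) (hf' : pderiv 2 f = 0)
    (hf0 : pderiv 2 (pderiv 0 f) = 0) (hf1 : pderiv 2 (pderiv 1 f) = 0) (a b ω : ℝ) :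
    gaugeHam 1 a b ω (aeval (gens1 N) f * φ) = toRat (
      aeval (gens1 N) f * gaugePoly 1 a b ω φ R + aeval (gens1 N) (act1 N a b ω f) * φ
      + C (2 * constC 1 : ℂ) * (aeval (gens1 N) (pderiv 0 f) * opGamma 1 (sigma N 1) φ
        + aeval (gens1 N) (pderiv 1 f) * opGamma 1 (sigma N 2) φ)) := by
  have hD : ∀ j, HasDunkl 1 (gens1 N j)
      ((![fun _ => 1, fun i => C 2 * (X i + X (i + 1)), fun _ => 0] :
        Fin 3 → Fin N → Poly N) j) := by
    intro j
    fin_cases j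
    · exact hasDunkl_sigma_of fun i => by simp
    · exact hasDunkl_sigma_of fun i => by simp; ring
    · exact hasDunkl_tau_self_one
  rw [gaugeHam_aeval_mul hN isSymmetric_gens1 hD hφ]
  refine congrArg toRat ?_
  simp only [Fin.sum_univ_three, hf, hf', hf0, hf1, map_zero, zero_mul, add_zero]
  simp [gaugePoly, opDelta_sigma, opJzero_sigma, opJminus_sigma, opGamma_sigma_sigma,
    ← Finset.mul_sum, act1, sigma_zero, sum_X_add_X]
  simp only [map_ofNat]
  ring

theorem symState_mem_preimage1_one (hN : 2 ≤ N) (a b ω : ℝ) (v : Spin N k)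
    {f : MvPolynomial (Fin 3) ℂ} (hf : SuppIn (Adm1 n 1 0) f) :
    symState v (fun _ => aeval (gens1 N) f * 1) ∈ preimage 1 a b ω (space1 N k n) := by
  refine symState_mem_preimage
    (mem_space1_one v ((hf.C_mul (constE 1 N a b ω)).add (suppIn_act1 (N := N) hf a b ω)))
    fun π => ?_
  have hz : ∀ i, pderiv 2 (pderiv i f) = 0 := fun i =>
    pderiv_eq_zero_of_suppIn (hf.pderiv_mono i fun e he => by simp [Adm1] at he; omega)
  rw [gaugeHam_one_mul hN (hasDunkl_one 1)
    (pderiv_pderiv_eq_zero_of_suppIn (hf.mono fun d h => h.1))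
    (pderiv_eq_zero_of_suppIn (hf.mono fun d h => h.2.1)) (hz 0) (hz 1)]
  refine congrArg toRat ?_
  simp [gaugePoly, opGamma_one, opDelta_one, opJminus_one, opJzero_one]
  ring

/-- `σ_2` would couple to `z_j` through `2 z_j²`, so it cannot occur here. The constant sent to the
first family consists of `J^- z_j = 1` and the two half-incidences of `j`. -/
theorem symState_mem_preimage1_X (hN : 2 ≤ N) (a b ω : ℝ) (v : Spin N k)
    {f : MvPolynomial (Fin 3) ℂ} (hf : SuppIn (Adm1 n 0 1) f) :
    symState v (fun π => aeval (gens1 N) f * X (π 0)) ∈ preimage 1 a b ω (space1 N k n) := by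
  have m1 := mem_space1_X v
    (((hf.C_mul (constZero 1 a ω + constE 1 N a b ω)).add (suppIn_act1 (N := N) hf a b ω)).add
    ((hf.pderiv_mono (Q := Adm1 n 0 1) 0 (fun e he => by
      simp [Adm1] at he ⊢; omega)).C_mul (2 * constC 1)))
  have m2 := mem_space1_one v ((hf.mono (Q := Adm1 n 1 0) (fun e he => by
      simp [Adm1] at he ⊢; omega)).C_mul (constC 1 * 2 * a + constMinus 1 b))
  have hmem := add_mem m1 m2
  rw [← map_add] at hmem
  refine symState_mem_preimage hmem fun π => ?_
  have hz1 : pderiv 1 f = 0 := pderiv_eq_zero_of_suppIn (hf.mono fun d h => Nat.le_zero.1 h.1)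
  have hz : ∀ i, pderiv 2 (pderiv i f) = 0 := fun i =>
    pderiv_eq_zero_of_suppIn (hf.pderiv_mono i fun e he => by simp [Adm1] at he; omega)
  rw [gaugeHam_one_mul hN (hasDunkl_X_one hN (π 0)) (by rw [hz1, map_zero])
    (pderiv_eq_zero_of_suppIn (hf.mono fun d h => h.2.1)) (hz 0) (hz 1)]
  have hC : (2 : Poly N) * C (2⁻¹ : ℂ) = 1 := by
    rw [show (2 : Poly N) = C 2 from (map_ofNat C 2).symm, ← C_mul]; norm_num
  refine congrArg toRat ?_
  simp [gaugePoly, opGamma_sigma_X, opDelta_X, opJminus_X, opJzero_X, hz1, ← Finset.mul_sum,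
    sum_incidence]
  simp only [map_ofNat]
  linear_combination (2 * bind₁ (gens1 N) f * C (constC 1 : ℂ) * C (a : ℂ)) * hC

theorem space1_le_preimage (hN : 2 ≤ N) (a b ω : ℝ) :
    space1 N k n ≤ preimage 1 a b ω (space1 N k n) :=
  space1_le (fun v _ hf => symState_mem_preimage1_one hN a b ω v hf)
    (fun v _ hf => symState_mem_preimage1_X hN a b ω v hf)

/-! ### The case `ε = 2` -/

/-- The symmetric polynomials generating the coefficients for `ε = 2`. -/
abbrev gens2 (N : ℕ) : Fin 3 → Poly N := ![sigma N 1, tau N (N - 1), tau N N]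

omit [NeZero N] in
theorem isHomogeneous_gens2 :
    ∀ i, (gens2 N i).IsHomogeneous ((![1, N - 1, N] : Fin 3 → ℕ) i) := by
  intro i; fin_cases i
  exacts [isHomogeneous_sigma 1, isHomogeneous_tau (N - 1), isHomogeneous_tau N]

omit [NeZero N] in
theorem isSymmetric_gens2 : ∀ i, (gens2 N i).IsSymmetric := by
  intro i; fin_cases i
  exacts [isSymmetric_sigma 1, isSymmetric_tau (N - 1), isSymmetric_tau N]

/-- Exponents of weight at most `n - c` in which the first and second variables have exponents
at most `r` and `r'`. -/
def Adm2 (N n r r' c : ℕ) (d : Fin 3 → ℕ) : Prop :=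
  d 0 ≤ r ∧ d 1 ≤ r' ∧ d 0 + (N - 1) * d 1 + N * d 2 + c ≤ n

omit [NeZero N] in
theorem degree_bound2 {r r' c : ℕ} {f : MvPolynomial (Fin 3) ℂ}
    (hf : SuppIn (Adm2 N n r r' c) f) :
    f = 0 ∨ (aeval (gens2 N) f).totalDegree + c ≤ n := by
  refine eq_zero_or_totalDegree_aeval_le isHomogeneous_gens2 (hf.mono fun d hd => ?_)
  simpa [Fin.sum_univ_three] using hd.2.2

omit [NeZero N] in
theorem exists_adm2 {r r' c : ℕ} {f : MvPolynomial (Fin 3) ℂ}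
    (hf : SuppIn (fun d => d 0 ≤ r ∧ d 1 ≤ r') f)
    (hd : (aeval (gens2 N) f).totalDegree + c ≤ n) :
    ∃ g, aeval (gens2 N) g = aeval (gens2 N) f ∧ SuppIn (Adm2 N n r r' c) g := by
  obtain ⟨g, h1, h2⟩ := aeval_eq_of_totalDegree_le (isHomogeneous_gens2 (N := N)) f
    (n := n - c) (Nat.le_sub_of_add_le hd)
  refine ⟨g, h1, fun d hg => ⟨(hf d (h2 d hg).1).1, (hf d (h2 d hg).1).2, ?_⟩⟩
  have := (h2 d hg).2
  rw [Fin.sum_univ_three] at this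
  simp at this
  omega

/-- The inclusion of the last two variables. -/
abbrev incl12 : Fin 2 → Fin 3 := ![1, 2]

theorem incl12_injective : Function.Injective incl12 := by decide

omit [NeZero N] in
theorem aeval_rename_incl12 (p : Fin 3 → Poly N) (g : MvPolynomial (Fin 2) ℂ) :
    aeval p (rename incl12 g) = aeval ![p 1, p 2] g := by
  rw [aeval_rename]
  congr 1
  ext j
  fin_cases j <;> simp

theorem rename_tauOverFirst (π : Equiv.Perm (Fin N)) :
    rename π (tauOverFirst N) = cofactor (π 0) := rename_cofactor π 0

theorem mem_space2_one (v : Spin N k) {f : MvPolynomial (Fin 3) ℂ}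
    (hf : SuppIn (Adm2 N n 1 1 0) f) :
    symState v (fun _ => aeval (gens2 N) f) ∈ space2 N k n := by
  rcases degree_bound2 (N := N) hf with rfl | hd
  · simp only [map_zero]
    exact (symState v).map_zero ▸ Submodule.zero_mem _
  · refine Submodule.subset_span (Or.inl (Or.inl ⟨f, v, ?_, ?_, hd, ?_⟩))
    · exact pderiv_pderiv_eq_zero_of_suppIn (hf.mono fun d h => h.1)
    · exact pderiv_pderiv_eq_zero_of_suppIn (hf.mono fun d h => h.2.1)
    · rw [mul_symmetrize_eq]; simp [substPoly]

theorem mem_space2_X (v : Spin N k) {f : MvPolynomial (Fin 3) ℂ}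
    (hf : SuppIn (Adm2 N n 0 1 1) f) :
    symState v (fun π => aeval (gens2 N) f * X (π 0)) ∈ space2 N k n := by
  rcases degree_bound2 (N := N) hf with rfl | hd
  · rw [symState_mul_eq_zero _ (map_zero _)]
    exact Submodule.zero_mem _
  · obtain ⟨g, rfl, hg⟩ := exists_rename_of_suppIn incl12_injective (c := 0) (by decide)
      (hf.mono fun d hd => Nat.le_zero.1 hd.1) hf
    rw [aeval_rename_incl12] at hd ⊢
    refine Submodule.subset_span (Or.inl (Or.inr ⟨g, v, ?_, hd, ?_⟩))
    · refine pderiv_pderiv_eq_zero_of_suppIn (hg.mono ?_)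
      rintro e ⟨d, hd, h⟩
      exact (h 0).symm.trans_le hd.2.1
    · rw [mul_symmetrize_eq]; simp [substPoly]

theorem mem_space2_cofactor (v : Spin N k) {f : MvPolynomial (Fin 3) ℂ}
    (hf : SuppIn (Adm2 N (n + 1) 1 0 N) f) :
    symState v (fun π => aeval (gens2 N) f * cofactor (π 0)) ∈ space2 N k n := by
  rcases degree_bound2 (N := N) hf with rfl | hd
  · rw [symState_mul_eq_zero _ (map_zero _)]
    exact Submodule.zero_mem _
  · obtain ⟨g, rfl, hg⟩ := exists_rename_of_suppIn incl02_injective (c := 1) (by decide)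
      (hf.mono fun d hd => Nat.le_zero.1 hd.2.1) hf
    rw [aeval_rename_incl02] at hd ⊢
    refine Submodule.subset_span (Or.inr ⟨g, v, ?_, hd, ?_⟩)
    · refine pderiv_pderiv_eq_zero_of_suppIn (hg.mono ?_)
      rintro e ⟨d, hd, h⟩
      exact (h 0).symm.trans_le hd.1
    · rw [mul_symmetrize_eq]; simp [substPoly, rename_tauOverFirst]

theorem space2_le {S : Submodule ℂ (State N k)}
    (h1 : ∀ (v : Spin N k) (f : MvPolynomial (Fin 3) ℂ), SuppIn (Adm2 N n 1 1 0) f →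
      symState v (fun _ => aeval (gens2 N) f * 1) ∈ S)
    (h2 : ∀ (v : Spin N k) (f : MvPolynomial (Fin 3) ℂ), SuppIn (Adm2 N n 0 1 1) f →
      symState v (fun π => aeval (gens2 N) f * X (π 0)) ∈ S)
    (h3 : ∀ (v : Spin N k) (f : MvPolynomial (Fin 3) ℂ), SuppIn (Adm2 N (n + 1) 1 0 N) f →
      symState v (fun π => aeval (gens2 N) f * cofactor (π 0)) ∈ S) :
    space2 N k n ≤ S := by
  refine Submodule.span_le.2 ?_
  rintro Φ ((⟨f, v, hf, hf', hd, rfl⟩ | ⟨f, v, hf, hd, rfl⟩) | ⟨f, v, hf, hd, rfl⟩)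
  · obtain ⟨g, e, hg⟩ := exists_adm2 (N := N) (c := 0) (r := 1) (r' := 1) (fun d hd =>
      ⟨suppIn_of_pderiv_pderiv_eq_zero hf d hd, suppIn_of_pderiv_pderiv_eq_zero hf' d hd⟩) hd
    have := h1 v g hg
    rw [e] at this
    rw [mul_symmetrize_eq]
    simp only [map_one]
    exact this
  · have hr : aeval (gens2 N) (rename incl12 f) = aeval ![tau N (N - 1), tau N N] f :=
      aeval_rename_incl12 _ _
    obtain ⟨g, e, hg⟩ := exists_adm2 (N := N) (n := n) (c := 1) (r := 0) (r' := 1)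
      (f := rename incl12 f)
      (((suppIn_of_pderiv_pderiv_eq_zero hf).rename incl12_injective (c := 0) (by decide)).mono
        fun d hd => ⟨hd.1.le, hd.2⟩) (by rw [hr]; exact hd)
    have := h2 v g hg
    rw [e, hr] at this
    rw [mul_symmetrize_eq]
    simp only [rename_X]
    exact this
  · have hr : aeval (gens2 N) (rename incl02 f) = aeval ![sigma N 1, tau N N] f :=
      aeval_rename_incl02 _ _
    obtain ⟨g, e, hg⟩ := exists_adm2 (N := N) (n := n + 1) (c := N) (r := 1) (r' := 0)
      (f := rename incl02 f)
      (((suppIn_of_pderiv_pderiv_eq_zero hf).rename incl02_injective (c := 1) (by decide)).mono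
        fun d hd => ⟨hd.2, hd.1.le⟩) (by rw [hr]; exact hd)
    have := h3 v g hg
    rw [e, hr] at this
    rw [mul_symmetrize_eq]
    simp only [rename_tauOverFirst]
    exact this

/-- The action of the gauge Hamiltonian for `ε = 2` on functions of `σ_1, τ_{N-1}, τ_N`, without
the constant term. -/
def act2 (N : ℕ) (a ω : ℝ) (f : MvPolynomial (Fin 3) ℂ) : MvPolynomial (Fin 3) ℂ :=
  C (constC 2 * 4 * a + constZero 2 a ω : ℂ) * (X 0 * pderiv 0 f)
  + C (constC 2 * 2 * a * N + constZero 2 a ω * (N - 1) : ℂ) * (X 1 * pderiv 1 f)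
  + C (constC 2 * 2 * a * N + constZero 2 a ω * N : ℂ) * (X 2 * pderiv 2 f)
  + C (constC 2 : ℂ) * (X 0 * (X 1 * (pderiv 0 (pderiv 1 f) + pderiv 1 (pderiv 0 f))))
  + C (-(constC 2 * N) : ℂ) * (X 2 * (pderiv 0 (pderiv 1 f) + pderiv 1 (pderiv 0 f)))
  + C (constC 2 : ℂ) * (X 0 * (X 2 * (pderiv 0 (pderiv 2 f) + pderiv 2 (pderiv 0 f))))
  + C (constC 2 * (N - 1) : ℂ) * (X 1 * (X 2 * (pderiv 1 (pderiv 2 f) + pderiv 2 (pderiv 1 f))))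
  + C (constC 2 * N : ℂ) * (X 2 * (X 2 * pderiv 2 (pderiv 2 f)))

/-- `T_2` and `J^0` preserve the degree, and so does each term here, including `τ_N ∂²/∂σ_1
∂τ_{N-1}`. A factor `σ_1` or `τ_{N-1}` always comes with the corresponding derivative. -/
theorem suppIn_act2 {r r' c : ℕ} {f : MvPolynomial (Fin 3) ℂ} (hf : SuppIn (Adm2 N n r r' c) f)
    (a ω : ℝ) : SuppIn (Adm2 N n r r' c) (act2 N a ω f) := by
  -- Removes the truncated `N - 1`; the weight inequalities become linear once the products with `M`
  -- are expanded.
  obtain ⟨M, hM⟩ : ∃ M, N = M + 1 := ⟨N - 1, by have := NeZero.pos N; omega⟩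
  have hX : ∀ {P} {g : MvPolynomial (Fin 3) ℂ}, SuppIn P g → ∀ i,
      (∀ e, P e → Adm2 N n r r' c (e + Pi.single i 1)) → SuppIn (Adm2 N n r r' c) (X i * g) :=
    fun h i h' => (h.X_mul i).mono (by rintro _ ⟨e, rfl, he⟩; exact h' e he)
  have hXX : ∀ {P} {g : MvPolynomial (Fin 3) ℂ}, SuppIn P g → ∀ i j,
      (∀ e, P e → Adm2 N n r r' c (e + Pi.single i 1 + Pi.single j 1)) →
      SuppIn (Adm2 N n r r' c) (X j * (X i * g)) :=
    fun h i j h' => hX (h.X_mul i) j (by rintro _ ⟨e, rfl, he⟩; exact h' e he)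
  have hS : ∀ i j : Fin 3, SuppIn (fun d => Adm2 N n r r' c (d + Pi.single i 1 + Pi.single j 1))
      (pderiv i (pderiv j f) + pderiv j (pderiv i f)) := by
    intro i j
    refine .add ((hf.pderiv j).pderiv i) (((hf.pderiv i).pderiv j).mono fun e he => ?_)
    rwa [add_right_comm]
  refine .add (.add (.add (.add (.add (.add (.add
    (.C_mul (hX (hf.pderiv _) _ ?_) _)
    (.C_mul (hX (hf.pderiv _) _ ?_) _))
    (.C_mul (hX (hf.pderiv _) _ ?_) _))
    (.C_mul (hXX (hS 0 1) _ _ ?_) _))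
    (.C_mul (hX (hS 0 1) _ ?_) _))
    (.C_mul (hXX (hS 0 2) _ _ ?_) _))
    (.C_mul (hXX (hS 1 2) _ _ ?_) _))
    (.C_mul (hXX ((hf.pderiv _).pderiv _) _ _ ?_) _)
  all_goals
    intro e he
    simp only [Adm2, Pi.add_apply, Pi.single_apply] at he ⊢
    subst hM
    simp [mul_add, add_mul] at he ⊢
    omega

/-- The two hypotheses on `f` remove `∑ z_i² (∂_i σ_1)² = σ_2` and `∑ z_i² (∂_i τ_{N-1})²`, which
involves `τ_{N-2}`. -/
theorem gaugeHam_two_mul (hN : 2 ≤ N) {φ : Poly N} {R : Fin N → Poly N} (hφ : HasDunkl 2 φ R)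
    {f : MvPolynomial (Fin 3) ℂ} (hf : pderiv 0 (pderiv 0 f) = 0) (hf' : pderiv 1 (pderiv 1 f) = 0)
    (a b ω : ℝ) :
    gaugeHam 2 a b ω (aeval (gens2 N) f * φ) = toRat (
      aeval (gens2 N) f * gaugePoly 2 a b ω φ R + aeval (gens2 N) (act2 N a ω f) * φ
      + C (2 * constC 2 : ℂ) * (aeval (gens2 N) (pderiv 0 f) * opGamma 2 (sigma N 1) φ
        + aeval (gens2 N) (pderiv 1 f) * (tau N (N - 1) * opJzero φ - tau N N * opJminus φ)
        + aeval (gens2 N) (pderiv 2 f) * (tau N N * opJzero φ))) := by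
  have hD : ∀ j, HasDunkl 2 (gens2 N j)
      ((![fun i => X i + X (i + 1), fun _ => tau N (N - 1), fun _ => tau N N] :
        Fin 3 → Fin N → Poly N) j) := by
    intro j
    fin_cases j
    · exact hasDunkl_sigma_of fun i => by simp; ring
    · exact hasDunkl_tau_pred_two hN
    · exact hasDunkl_tau_self_two
  rw [gaugeHam_aeval_mul hN isSymmetric_gens2 hD hφ]
  refine congrArg toRat ?_
  have hm : constMinus 2 b = 0 := rfl
  have e1 : opGamma 2 (sigma N 1) (tau N (N - 1)) =
      sigma N 1 * tau N (N - 1) - C (N : ℂ) * tau N N := by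
    rw [opGamma_comm, opGamma_two_tau_pred, opJzero_sigma, opJminus_sigma, sigma_zero]
    simp; ring
  have e2 : opGamma 2 (sigma N 1) (tau N N) = sigma N 1 * tau N N := by
    rw [opGamma_comm, opGamma_two_tau_self, opJzero_sigma]
    simp; ring
  have e3 : opGamma 2 (tau N (N - 1)) (tau N N) = opGamma 2 (tau N N) (tau N (N - 1)) :=
    opGamma_comm _ _ _
  have e4 : opGamma 2 (tau N (N - 1)) (sigma N 1) = opGamma 2 (sigma N 1) (tau N (N - 1)) :=
    opGamma_comm _ _ _
  have e5 : opGamma 2 (tau N N) (sigma N 1) = opGamma 2 (sigma N 1) (tau N N) :=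
    opGamma_comm _ _ _
  simp only [Fin.sum_univ_three, hf, hf', map_zero, zero_mul, add_zero, zero_add, Matrix.cons_val,
    e4, e5, e1, e2, e3, gens2]
  simp [gaugePoly, hm, opDelta_sigma, opJzero_sigma, sum_X_add_X, opGamma_two_tau_self,
    opGamma_two_tau_pred, opJzero_tau_self, opJzero_tau_pred, opDelta_two_tau_self,
    opDelta_two_tau_pred, act2]
  simp only [map_ofNat]
  ring

theorem symState_mem_preimage2_one (hN : 2 ≤ N) (a b ω : ℝ) (v : Spin N k)
    {f : MvPolynomial (Fin 3) ℂ} (hf : SuppIn (Adm2 N n 1 1 0) f) :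
    symState v (fun _ => aeval (gens2 N) f * 1) ∈ preimage 2 a b ω (space2 N k n) := by
  refine symState_mem_preimage
    (mem_space2_one v ((hf.C_mul (constE 2 N a b ω)).add (suppIn_act2 hf a ω))) fun π => ?_
  rw [gaugeHam_two_mul hN (hasDunkl_one 2)
    (pderiv_pderiv_eq_zero_of_suppIn (hf.mono fun d h => h.1))
    (pderiv_pderiv_eq_zero_of_suppIn (hf.mono fun d h => h.2.1))]
  refine congrArg toRat ?_
  simp [gaugePoly, opGamma_one, opDelta_one, opJminus_one, opJzero_one]
  ring

/-- `σ_1` would couple to `z_j` through `z_j²`, so it is absent. The coupling of `τ_{N-1}` contains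
`-τ_N J^- z_j = -τ_N`, a state of the first family. -/
theorem symState_mem_preimage2_X (hN : 2 ≤ N) (a b ω : ℝ) (v : Spin N k)
    {f : MvPolynomial (Fin 3) ℂ} (hf : SuppIn (Adm2 N n 0 1 1) f) :
    symState v (fun π => aeval (gens2 N) f * X (π 0)) ∈ preimage 2 a b ω (space2 N k n) := by
  obtain ⟨M, hM⟩ : ∃ M, N = M + 1 := ⟨N - 1, by omega⟩
  have hm : constMinus 2 b = 0 := rfl
  have hz : pderiv 0 f = 0 := pderiv_eq_zero_of_suppIn (hf.mono fun d h => Nat.le_zero.1 h.1)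
  have s1 : SuppIn (Adm2 N n 0 1 1) (X 1 * pderiv 1 f) := ((hf.pderiv 1).X_mul 1).mono (by
    rintro _ ⟨e, rfl, he⟩; exact he)
  have s2 : SuppIn (Adm2 N n 0 1 1) (X 2 * pderiv 2 f) := ((hf.pderiv 2).X_mul 2).mono (by
    rintro _ ⟨e, rfl, he⟩; exact he)
  -- Trading `τ_{N-1}` for `τ_N` raises the weight by one, which makes up for the lost factor `z_j`.
  have s3 : SuppIn (Adm2 N n 1 1 0) (X 2 * pderiv 1 f) := ((hf.pderiv 1).X_mul 2).mono (by
    rintro _ ⟨e, rfl, he⟩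
    subst hM
    simp [Adm2, mul_add, add_mul] at he ⊢
    omega)
  have m1 := mem_space2_X v ((((hf.C_mul (constC 2 * 4 * a + constZero 2 a ω + constE 2 N a b ω)).add
    (suppIn_act2 hf a ω)).add (s1.C_mul (2 * constC 2))).add (s2.C_mul (2 * constC 2)))
  have m2 := mem_space2_one v (s3.C_mul (-(2 * constC 2)))
  have hmem := add_mem m1 m2
  rw [← map_add] at hmem
  refine symState_mem_preimage hmem fun π => ?_
  rw [gaugeHam_two_mul hN (hasDunkl_X_two hN (π 0)) (by rw [hz, map_zero])
    (pderiv_pderiv_eq_zero_of_suppIn (hf.mono fun d h => h.2.1))]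
  refine congrArg toRat ?_
  simp [gaugePoly, opDelta_X, opJminus_X, opJzero_X, hm, hz, ← Finset.mul_sum, sum_incidence]
  simp only [map_ofNat]
  ring

omit [NeZero N] in
theorem opGamma_sigma_one_cofactor (j : Fin N) :
    opGamma 2 (sigma N 1) (cofactor j) = sigma N 1 * cofactor j - tau N N := by
  have h : ∀ i : Fin N, X i ^ 2 * pderiv i (cofactor j) =
      X i * cofactor j - if i = j then X i * cofactor j else 0 := by
    intro i
    have := X_mul_pderiv_cofactor i j
    split_ifs at this ⊢ <;> linear_combination X i * this
  rw [opGamma_sigma, sigma_one, ← X_mul_cofactor j, Finset.sum_mul]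
  have e : ((2 : Fin 3) : ℕ) + (1 - 1) = 2 := rfl
  simp only [e, h, Finset.sum_sub_distrib, Finset.sum_ite_eq', Finset.mem_univ, if_true]
  simp

/-- `τ_{N-1}` would bring in `J^- (τ_N / z_j)`, so it is absent; `σ_1` couples through `σ_1 τ_N /
z_j - τ_N`, whose last term belongs to the first family. The bound `deg q ≤ n - N + 1` is carried as
`deg q + N ≤ n + 1`, free of truncated subtraction. -/
theorem symState_mem_preimage2_cofactor (hN : 2 ≤ N) (a b ω : ℝ) (v : Spin N k)
    {f : MvPolynomial (Fin 3) ℂ} (hf : SuppIn (Adm2 N (n + 1) 1 0 N) f) :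
    symState v (fun π => aeval (gens2 N) f * cofactor (π 0)) ∈
      preimage 2 a b ω (space2 N k n) := by
  obtain ⟨M, hM⟩ : ∃ M, N = M + 1 := ⟨N - 1, by omega⟩
  have hm : constMinus 2 b = 0 := rfl
  have hz : pderiv 1 f = 0 := pderiv_eq_zero_of_suppIn (hf.mono fun d h => Nat.le_zero.1 h.2.1)
  have s1 : SuppIn (Adm2 N (n + 1) 1 0 N) (X 0 * pderiv 0 f) := ((hf.pderiv 0).X_mul 0).mono (by
    rintro _ ⟨e, rfl, he⟩; exact he)
  have s2 : SuppIn (Adm2 N (n + 1) 1 0 N) (X 2 * pderiv 2 f) := ((hf.pderiv 2).X_mul 2).mono (by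
    rintro _ ⟨e, rfl, he⟩; exact he)
  have s3 : SuppIn (Adm2 N n 1 1 0) (X 2 * pderiv 0 f) := ((hf.pderiv 0).X_mul 2).mono (by
    rintro _ ⟨e, rfl, he⟩
    subst hM
    simp [Adm2, mul_add, add_mul] at he ⊢
    omega)
  have m1 := mem_space2_cofactor v
    ((((hf.C_mul (constC 2 * 2 * a * N + constZero 2 a ω * (N - 1) + constE 2 N a b ω)).add
    (suppIn_act2 hf a ω)).add (s1.C_mul (2 * constC 2))).add
    (s2.C_mul (2 * constC 2 * (N - 1))))
  have m2 := mem_space2_one v (s3.C_mul (-(2 * constC 2)))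
  have hmem := add_mem m1 m2
  rw [← map_add] at hmem
  refine symState_mem_preimage hmem fun π => ?_
  rw [gaugeHam_two_mul hN (hasDunkl_cofactor_two hN (π 0))
    (pderiv_pderiv_eq_zero_of_suppIn (hf.mono fun d h => h.1)) (by rw [hz, map_zero])]
  refine congrArg toRat ?_
  simp [gaugePoly, opDelta_two_cofactor, opJzero_cofactor, hm, hz,
    opGamma_sigma_one_cofactor]
  simp only [map_ofNat]
  ring

theorem space2_le_preimage (hN : 2 ≤ N) (a b ω : ℝ) :
    space2 N k n ≤ preimage 2 a b ω (space2 N k n) :=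
  space2_le (fun v _ hf => symState_mem_preimage2_one hN a b ω v hf)
    (fun v _ hf => symState_mem_preimage2_X hN a b ω v hf)
    (fun v _ hf => symState_mem_preimage2_cofactor hN a b ω v hf)

theorem invSpace_le_preimage (hN : 2 ≤ N) (ε : Fin 3) (a b ω : ℝ) :
    invSpace N k n ε ≤ preimage ε a b ω (invSpace N k n ε) := by
  fin_cases ε
  exacts [space0_le_preimage hN a b ω, space1_le_preimage hN a b ω, space2_le_preimage hN a b ω]

end

noncomputable section

variable {N k n : ℕ}

/-! ### Total symmetry of the invariant spaces -/

/-- The totally symmetric states. -/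
def symmetricStates (N k : ℕ) : Submodule ℂ (State N k) where
  carrier := {Φ | ∀ π, totalPerm π Φ = Φ}
  zero_mem' := fun π => by funext s; simp [totalPerm]
  add_mem' := by
    intro Φ Ψ h h' π
    funext s
    have h1 := congrFun (h π) s
    have h2 := congrFun (h' π) s
    simp only [totalPerm] at h1 h2
    simp [totalPerm, h1, h2]
  smul_mem' := by
    intro c Φ h π
    funext s
    have h1 := congrFun (h π) s
    simp only [totalPerm] at h1
    simp [totalPerm, h1]

theorem mul_symmetrize_mem_symmetricStates {m : ℕ} {p : Fin m → Poly N}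
    (hp : ∀ i, (p i).IsSymmetric) (f : MvPolynomial (Fin m) ℂ) (Φ : State N k) :
    (fun s => substPoly p f * symmetrize Φ s) ∈ symmetricStates N k := by
  intro π
  funext s
  have h1 := congrFun (totalPerm_symmetrize π Φ) s
  simp only [totalPerm] at h1 ⊢
  rw [map_mul, h1, substPoly, isSymmetric_aeval hp]

theorem isSymmetric_pair {p q : Poly N} (hp : p.IsSymmetric) (hq : q.IsSymmetric) :
    ∀ i, (![p, q] i).IsSymmetric := Fin.forall_fin_two.2 ⟨hp, hq⟩

theorem invSpace_le_symmetricStates [NeZero N] (ε : Fin 3) :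
    invSpace N k n ε ≤ symmetricStates N k := by
  have hs := fun j => isSymmetric_sigma (N := N) j
  have ht := fun j => isSymmetric_tau (N := N) j
  fin_cases ε
  · refine Submodule.span_le.2 ?_
    rintro Φ (((⟨f, v, -, -, rfl⟩ | ⟨f, v, -, -, rfl⟩) | ⟨f, v, -, rfl⟩) | ⟨f, v, -, -, rfl⟩)
    · exact mul_symmetrize_mem_symmetricStates isSymmetric_gens0 _ _
    · exact mul_symmetrize_mem_symmetricStates isSymmetric_gens0 _ _
    · exact mul_symmetrize_mem_symmetricStates (isSymmetric_pair (hs 1) (hs 2)) _ _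
    · exact mul_symmetrize_mem_symmetricStates (isSymmetric_pair (hs 1) (hs 2)) _ _
  · refine Submodule.span_le.2 ?_
    rintro Φ (⟨f, v, -, -, -, rfl⟩ | ⟨f, v, -, -, rfl⟩)
    · exact mul_symmetrize_mem_symmetricStates isSymmetric_gens1 _ _
    · exact mul_symmetrize_mem_symmetricStates (isSymmetric_pair (hs 1) (ht N)) _ _
  · refine Submodule.span_le.2 ?_
    rintro Φ ((⟨f, v, -, -, -, rfl⟩ | ⟨f, v, -, -, rfl⟩) | ⟨f, v, -, -, rfl⟩)
    · exact mul_symmetrize_mem_symmetricStates isSymmetric_gens2 _ _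
    · exact mul_symmetrize_mem_symmetricStates (isSymmetric_pair (ht (N - 1)) (ht N)) _ _
    · exact mul_symmetrize_mem_symmetricStates (isSymmetric_pair (hs 1) (ht N)) _ _

/-- Permuting coordinates and spins together does nothing, and a swap is its own inverse: exchanging
coordinates equals exchanging spins. This turns the `K_{i,i+1}` of the gauge Hamiltonian into the
`S_{i,i+1}` of the potential. -/
theorem rename_swap_of_mem_symmetricStates {Φ : State N k} (hΦ : Φ ∈ symmetricStates N k)
    (i j : Fin N) (s : Config N k) :
    rename (Equiv.swap i j) (Φ s) = Φ (fun l => s (Equiv.swap i j l)) := by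
  have h := congrFun (hΦ (Equiv.swap i j)) (fun l => s (Equiv.swap i j l))
  simpa only [totalPerm, Equiv.swap_apply_self] using h

/-! ### Evaluation of the gauge Hamiltonian -/

/-- Clearing all denominators leaves a polynomial identity, which can be evaluated and divided back
where the denominators are nonzero. -/
theorem eval_eq_of_sum_div_eq {ι : Type*} [Fintype ι] [DecidableEq ι] {p e : ι → Poly N}
    {h : Poly N} {z : Fin N → ℂ} (he : ∀ i, eval z (e i) ≠ 0)
    (H : ∑ i, toRat (p i) / toRat (e i) = toRat h) :
    ∑ i, eval z (p i) / eval z (e i) = eval z h := by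
  have he' : ∀ i, toRat (e i) ≠ 0 := by
    intro i h0
    have : e i = 0 := toRat_injective (h0.trans toRat_zero.symm)
    exact he i (by rw [this, map_zero])
  have key : ∑ i, p i * ∏ j ∈ Finset.univ.erase i, e j = h * ∏ j, e j := by
    apply toRat_injective
    rw [toRat_mul, ← H, toRat_sum, Finset.sum_mul]
    refine Finset.sum_congr rfl fun i _ => ?_
    rw [toRat_mul, ← Finset.mul_prod_erase _ _ (Finset.mem_univ i), toRat_mul]
    field_simp [he' i]
  have key2 := congrArg (eval z) key
  rw [map_sum, map_mul, map_prod] at key2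
  have hP : ∏ j, eval z (e j) ≠ 0 := Finset.prod_ne_zero_iff.2 fun j _ => he j
  refine mul_right_cancel₀ hP ?_
  rw [← key2, Finset.sum_mul]
  refine Finset.sum_congr rfl fun i _ => ?_
  rw [map_mul, map_prod, ← Finset.mul_prod_erase _ _ (Finset.mem_univ i)]
  field_simp [he i]

variable [NeZero N]

theorem eval_of_gaugeHam_eq (hN : 2 ≤ N) {ε : Fin 3} {a b ω : ℝ} {f g : Poly N}
    (h : gaugeHam ε a b ω f = toRat g) {z : Fin N → ℂ} (hz : ∀ i, z i ≠ z (i + 1)) :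
    eval z g = constC ε * (∑ i, z i ^ (ε : ℕ) * eval z (pderiv i (pderiv i f))
        + 2 * a * ∑ i, (z i ^ (ε : ℕ) * eval z (pderiv i f)
            - z (i + 1) ^ (ε : ℕ) * eval z (pderiv (i + 1) f)) / (z i - z (i + 1))
        - 2 * a * ∑ i, eval z (thetaPoly ε (X i) (X (i + 1))) / (z i - z (i + 1)) ^ 2
            * (eval z f - eval z (rename (Equiv.swap i (i + 1)) f)))
      + constMinus ε b * ∑ i, eval z (pderiv i f)
      + constZero ε a ω * ∑ i, z i * eval z (pderiv i f)
      + constE ε N a b ω * eval z f := by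
  classical
  have hd : ∀ i : Fin N, toRat (X i) - toRat (X (i + 1) : Poly N) ≠ 0 := by
    intro i
    rw [← toRat_sub, ← toRat_zero]
    exact fun h => X_sub_X_ne_zero hN i (toRat_injective h)
  have hz' : ∀ i, z i - z (i + 1) ≠ 0 := fun i => sub_ne_zero.2 (hz i)
  set K : Poly N := C (constC ε * (2 * a) : ℂ) with hK
  -- Single Dunkl-type terms of `f` may have poles; only their sum is known to be a polynomial. They
  -- are kept as fractions over `(z_i - z_{i+1})²` and everything polynomial is moved to the right.
  have H : ∑ i : Fin N, toRat (K * (pairDiff ε i f * (X i - X (i + 1))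
        - thetaPoly ε (X i) (X (i + 1)) * (f - rename (Equiv.swap i (i + 1)) f)))
        / toRat ((X i - X (i + 1)) ^ 2) =
      toRat (g - (C (constC ε : ℂ) * opDelta ε f + C (constMinus ε b : ℂ) * opJminus f
        + C (constZero ε a ω : ℂ) * opJzero f + C (constE ε N a b ω : ℂ) * f)) := by
    rw [toRat_sub, ← h]
    have h1 : ∀ i : Fin N, toRat (K * (pairDiff ε i f * (X i - X (i + 1))
        - thetaPoly ε (X i) (X (i + 1)) * (f - rename (Equiv.swap i (i + 1)) f)))
        / toRat ((X i - X (i + 1)) ^ 2) =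
        toRat K * (toRat (pairDiff ε i f) / (toRat (X i) - toRat (X (i + 1)))
          - theta ε (toRat (X i)) (toRat (X (i + 1))) / (toRat (X i) - toRat (X (i + 1))) ^ 2
        * toRat (f - rename (Equiv.swap i (i + 1)) f)) := by
      intro i
      have := hd i
      rw [toRat_mul, toRat_sub (_ * _) (_ * _), toRat_mul, toRat_mul (thetaPoly _ _ _),
        toRat_thetaPoly, toRat_pow, toRat_sub (X i)]
      field_simp
    rw [Finset.sum_congr rfl fun i _ => h1 i, ← Finset.mul_sum, Finset.sum_sub_distrib]
    unfold gaugeHam opT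
    simp only [toRat_add, toRat_mul (C (constC ε : ℂ)), pairDiff, opDelta, hK, C_mul, toRat_mul]
    ring
  have H2 := eval_eq_of_sum_div_eq (z := z) (fun i => by simpa using hz' i) H
  simp only [map_mul, map_sub, map_add, map_pow, eval_X, eval_C, hK, pairDiff, opDelta, opJminus,
    opJzero, map_sum] at H2
  have h2 : ∀ i : Fin N, (constC ε * (2 * a) : ℂ) * ((z i ^ (ε : ℕ) * eval z (pderiv i f)
            - z (i + 1) ^ (ε : ℕ) * eval z (pderiv (i + 1) f)) * (z i - z (i + 1))
        - eval z (thetaPoly ε (X i) (X (i + 1)))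
            * (eval z f - eval z (rename (Equiv.swap i (i + 1)) f))) / (z i - z (i + 1)) ^ 2
        = constC ε * (2 * a) * ((z i ^ (ε : ℕ) * eval z (pderiv i f)
            - z (i + 1) ^ (ε : ℕ) * eval z (pderiv (i + 1) f)) / (z i - z (i + 1))
          - eval z (thetaPoly ε (X i) (X (i + 1))) / (z i - z (i + 1)) ^ 2
            * (eval z f - eval z (rename (Equiv.swap i (i + 1)) f))) := by
    intro i
    have := hz' i
    field_simp
  rw [Finset.sum_congr rfl fun i _ => h2 i, ← Finset.mul_sum, Finset.sum_sub_distrib] at H2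
  linear_combination -H2

/-! ### Derivatives along a coordinate line -/

open Filter Topology

/-- With `m' = m l`, a common factor `m` comes out of the second derivative of `m q`. First
derivatives are needed on a neighbourhood, the second ones at `x` only. -/
theorem iteratedDeriv_two_mul_ofReal {m l : ℝ → ℝ} {q q₁ : ℝ → ℂ} {x l' : ℝ} {q₂ : ℂ}
    (hm : ∀ᶠ t in 𝓝 x, HasDerivAt m (m t * l t) t) (hl : HasDerivAt l l' x)
    (hq : ∀ᶠ t in 𝓝 x, HasDerivAt q (q₁ t) t) (hq₁ : HasDerivAt q₁ q₂ x) :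
    iteratedDeriv 2 (fun t => (m t : ℂ) * q t) x =
      m x * (((l x ^ 2 + l' : ℝ) : ℂ) * q x + 2 * (l x : ℂ) * q₁ x + q₂) := by
  have h1 : deriv (fun t => (m t : ℂ) * q t) =ᶠ[𝓝 x]
      fun t => ((m t : ℂ) * (l t : ℂ)) * q t + (m t : ℂ) * q₁ t := by
    filter_upwards [hm, hq] with t ht ht'
    have := (ht.ofReal_comp.fun_mul ht').deriv
    rw [Complex.ofReal_mul] at this
    exact this
  rw [iteratedDeriv_succ, iteratedDeriv_one, h1.deriv_eq]
  have hmx := hm.self_of_nhds.ofReal_comp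
  have hqx := hq.self_of_nhds
  have hlx := hl.ofReal_comp
  have := (((hmx.fun_mul hlx).fun_mul hqx).fun_add (hmx.fun_mul hq₁)).deriv
  refine this.trans ?_
  push_cast
  ring

omit [NeZero N] in
theorem hasDerivAt_eval_update (P : Poly N) (z : Fin N → ℂ) (i : Fin N) (w : ℂ) :
    HasDerivAt (fun w => eval (Function.update z i w) P)
      (eval (Function.update z i w) (pderiv i P)) w := by
  induction P using MvPolynomial.induction_on with
  | C c => simpa using hasDerivAt_const w c
  | add p q hp hq =>
    simp only [map_add]
    exact hp.add hq
  | mul_X p j hp =>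
    have hX : HasDerivAt (fun w => Function.update z i w j)
        (eval (Function.update z i w) (pderiv i (X j : Poly N))) w := by
      by_cases h : j = i
      · subst h
        simpa using hasDerivAt_id' w
      · rw [pderiv_X_of_ne h, map_zero]
        simpa [Function.update_of_ne h] using hasDerivAt_const w (z j)
    simp only [map_mul, eval_X, Derivation.leibniz, smul_eq_mul, map_add]
    refine (hp.fun_mul hX).congr_deriv ?_
    ring

end

/-! ### Conjugation by the gauge factor, for an abstract local model. -/

noncomputable section

open Filter Topology

variable {N k n : ℕ}

/-- The value of `ϑ_ε`. -/
def thetaVal (ε : Fin 3) (x y : ℂ) : ℂ :=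
  match ε with
  | 0 => 1
  | 1 => 1 / 2 * (x + y)
  | 2 => x * y

theorem eval_thetaPoly (ε : Fin 3) (p q : Poly N) (z : Fin N → ℂ) :
    eval z (thetaPoly ε p q) = thetaVal ε (eval z p) (eval z q) := by
  fin_cases ε <;> simp [thetaPoly, thetaVal]

/-- The one- and two-particle building blocks `α`, `β` of the gauge factor, with logarithmic
derivatives `A` and `a λ`, and the identities that relate them to the potential and to the
coefficients of the gauge Hamiltonian. -/
structure LocalModel (ε : Fin 3) (η : ℤˣ) (a b ω : ℝ) where
  dom : ℝ → ℝ → Prop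
  α : ℝ → ℝ
  A : ℝ → ℝ
  A' : ℝ → ℝ
  V₁ : ℝ → ℝ
  β : ℝ → ℝ → ℝ
  lam : ℝ → ℝ → ℝ
  lam' : ℝ → ℝ → ℝ
  κ : ℝ → ℝ → ℝ
  ζ₁ : ℝ → ℂ
  ζ₂ : ℝ → ℂ
  c₁ : ℝ
  c₂ : ℝ
  -- The part of the coefficient of `z ∂_z` produced by one pair; each coordinate lies in two cyclic
  -- pairs, hence `2 * e` in `one_body_deriv`.
  e : ℝ
  dom_symm : ∀ {u v}, dom u v → dom v u
  dom_open : ∀ {u v}, dom u v → ∀ᶠ t in 𝓝 u, dom t v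
  hasDerivAt_α : ∀ {u v}, dom u v → HasDerivAt α (α u * A u) u
  hasDerivAt_A : ∀ {u v}, dom u v → HasDerivAt A (A' u) u
  β_symm : ∀ u v, β u v = β v u
  hasDerivAt_β : ∀ {u v}, dom u v → HasDerivAt (fun t => β t v) (β u v * (a * lam u v)) u
  hasDerivAt_lam : ∀ {u v}, dom u v → HasDerivAt (fun t => lam t v) (lam' u v) u
  hasDerivAt_ζ : ∀ t, HasDerivAt (changeVar ε η) (ζ₁ t) t
  hasDerivAt_ζ₁ : ∀ t, HasDerivAt ζ₁ (ζ₂ t) t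
  changeVar_ne : ∀ {u v}, dom u v → changeVar ε η u ≠ changeVar ε η v
  one_body : ∀ {u v}, dom u v → A u ^ 2 + A' u = V₁ u + c₁
  -- The potential contributes `κ (a - S)` and the gauge Hamiltonian `κ (1 - K)`; since `K = S` on
  -- symmetric states, the Laplacian must supply the difference `(a - 1) κ`.
  two_body : ∀ {u v}, dom u v → 2 * a * (A u * lam u v + A v * lam v u)
    + a ^ 2 * (lam u v ^ 2 + lam v u ^ 2) + a * (lam' u v + lam' v u) = (a - 1) * κ u v + c₂
  const : ∀ N : ℕ, constE ε N a b ω = -(N * (c₁ + c₂))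
  one_body_deriv : ∀ {u v}, dom u v → ∀ p q : ℂ,
    -(2 * (A u : ℂ) * (ζ₁ u * p) + (ζ₂ u * p + ζ₁ u ^ 2 * q)) =
      constC ε * (changeVar ε η u ^ (ε : ℕ) * q) + constMinus ε b * p
        + (constZero ε a ω - 2 * e) * (changeVar ε η u * p)
  two_body_deriv : ∀ {u v}, dom u v → ∀ p q : ℂ,
    -(2 * a * ((lam u v : ℂ) * (ζ₁ u * p) + (lam v u : ℂ) * (ζ₁ v * q))) =
      constC ε * (2 * a) * ((changeVar ε η u ^ (ε : ℕ) * p - changeVar ε η v ^ (ε : ℕ) * q)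
        / (changeVar ε η u - changeVar ε η v)) + e * (changeVar ε η u * p + changeVar ε η v * q)
  exchange : ∀ {u v}, dom u v → constC ε * (2 * a) *
    (thetaVal ε (changeVar ε η u) (changeVar ε η v)
      / (changeVar ε η u - changeVar ε η v) ^ 2) = -(κ u v : ℂ)
  gaugeFactor_eq : ∀ {N : ℕ} [NeZero N] (x : Fin N → ℝ),
    gaugeFactor ε a b ω x = ∏ i, (α (x i) * β (x i) (x (i + 1)))
  potential_eq : ∀ {N k : ℕ} [NeZero N] (x : Fin N → ℝ) (v : Spin N k) (s : Config N k),
    potential ε a b ω x v s =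
      ((∑ i, V₁ (x i) + 2 * a ^ 2 * ∑ i, lam (x i) (x (i + 1)) * lam (x i) (x (i - 1)) : ℝ) : ℂ)
        * v s + ∑ i, (κ (x i) (x (i + 1)) : ℂ) * (a * v s - spinExchange i (i + 1) v s)
  dom_of_mem : ∀ {N : ℕ} [NeZero N], 2 ≤ N → ∀ x : Fin N → ℝ, x ∈ configSpace N ε →
    ∀ i, dom (x i) (x (i + 1))
  dom_of_lt_one : ∀ {u v}, 0 < u → u < 1 → 0 < v → v < 1 → u ≠ v → dom u v
  α_ne_zero : ∀ {u v}, dom u v → α u ≠ 0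
  β_ne_zero : ∀ {u v}, dom u v → β u v ≠ 0
  contDiffAt_α : ∀ {u v}, dom u v → ContDiffAt ℝ ((⊤ : ℕ∞) : WithTop ℕ∞) α u
  contDiffAt_β : ∀ {u v}, dom u v →
    ContDiffAt ℝ ((⊤ : ℕ∞) : WithTop ℕ∞) (fun y : ℝ × ℝ => β y.1 y.2) (u, v)
  contDiff_ζ : ContDiff ℝ ((⊤ : ℕ∞) : WithTop ℕ∞) (changeVar ε η)

variable [NeZero N]

theorem sum_sub_one {M : Type*} [AddCommMonoid M] (g : Fin N → Fin N → M) :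
    ∑ i, g i (i - 1) = ∑ i, g (i + 1) i := by
  rw [← sum_add_one]
  simp

theorem sub_one_ne (hN : 2 ≤ N) (i : Fin N) : i - 1 ≠ i := by
  have := fin_ne_add_one hN (i - 1)
  rwa [sub_add_cancel] at this

/-- Only the edges `i` and `i - 1` involve the coordinate `i`. They are distinct factors even for `N
= 2`, where both join the same two points. -/
theorem prod_update_eq (hN : 2 ≤ N) (α : ℝ → ℝ) {β : ℝ → ℝ → ℝ} (hβ : ∀ u v, β u v = β v u)
    (x : Fin N → ℝ) (i : Fin N) :
    ∃ K : ℝ, ∀ t, ∏ j, (α (Function.update x i t j) *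
      β (Function.update x i t j) (Function.update x i t (j + 1))) =
        K * (α t * β t (x (i + 1)) * β t (x (i - 1))) := by
  classical
  have h1 := (fin_ne_add_one hN i).symm
  have h2 := sub_one_ne hN i
  refine ⟨(∏ j ∈ Finset.univ.erase i, α (x j)) *
    ∏ j ∈ (Finset.univ.erase i).erase (i - 1), β (x j) (x (j + 1)), fun t => ?_⟩
  rw [Finset.prod_mul_distrib, ← Finset.mul_prod_erase _ (fun j => α _) (Finset.mem_univ i),
    ← Finset.mul_prod_erase _ (fun j => β _ _) (Finset.mem_univ i),
    ← Finset.mul_prod_erase _ (fun j => β _ _)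
      (Finset.mem_erase.2 ⟨h2, Finset.mem_univ (i - 1)⟩)]
  have e1 : ∏ j ∈ Finset.univ.erase i, α (Function.update x i t j) =
      ∏ j ∈ Finset.univ.erase i, α (x j) :=
    Finset.prod_congr rfl fun j hj => by rw [Function.update_of_ne (Finset.ne_of_mem_erase hj)]
  have e2 : ∏ j ∈ (Finset.univ.erase i).erase (i - 1),
      β (Function.update x i t j) (Function.update x i t (j + 1)) =
      ∏ j ∈ (Finset.univ.erase i).erase (i - 1), β (x j) (x (j + 1)) :=
    Finset.prod_congr rfl fun j hj => by
      have hj1 := Finset.ne_of_mem_erase hj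
      have hj2 := Finset.ne_of_mem_erase (Finset.mem_of_mem_erase hj)
      rw [Function.update_of_ne hj2, Function.update_of_ne]
      intro h
      exact hj1 (by rw [← h, add_sub_cancel_right])
  rw [e1, e2, sub_add_cancel, Function.update_self, Function.update_of_ne h1,
    Function.update_of_ne h2, hβ (x (i - 1)) t]
  ring

variable {ε : Fin 3} {η : ℤˣ} {a b ω : ℝ}

/-- The logarithmic derivative of the gauge factor in the coordinate `i`. -/
def LocalModel.logDeriv (m : LocalModel ε η a b ω) (x : Fin N → ℝ) (i : Fin N) : ℝ :=
  m.A (x i) + a * (m.lam (x i) (x (i + 1)) + m.lam (x i) (x (i - 1)))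

/-- The derivative of `logDeriv` in the coordinate `i`. -/
def LocalModel.logDeriv' (m : LocalModel ε η a b ω) (x : Fin N → ℝ) (i : Fin N) : ℝ :=
  m.A' (x i) + a * (m.lam' (x i) (x (i + 1)) + m.lam' (x i) (x (i - 1)))

theorem LocalModel.dom_pred (m : LocalModel ε η a b ω) {x : Fin N → ℝ}
    (hx : ∀ i, m.dom (x i) (x (i + 1))) (i : Fin N) : m.dom (x i) (x (i - 1)) := by
  have := m.dom_symm (hx (i - 1))
  rwa [sub_add_cancel] at this

theorem LocalModel.secondPartial_physical (m : LocalModel ε η a b ω) (hN : 2 ≤ N)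
    {x : Fin N → ℝ} (hx : ∀ i, m.dom (x i) (x (i + 1))) (Φ : State N k) (i : Fin N)
    (s : Config N k) :
    secondPartial i (physical ε η a b ω Φ) x s = gaugeFactor ε a b ω x *
      (((m.logDeriv x i ^ 2 + m.logDeriv' x i : ℝ) : ℂ)
          * eval (fun j => changeVar ε η (x j)) (Φ s)
        + 2 * (m.logDeriv x i : ℂ)
          * (m.ζ₁ (x i) * eval (fun j => changeVar ε η (x j)) (pderiv i (Φ s)))
        + (m.ζ₂ (x i) * eval (fun j => changeVar ε η (x j)) (pderiv i (Φ s))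
          + m.ζ₁ (x i) ^ 2 * eval (fun j => changeVar ε η (x j)) (pderiv i (pderiv i (Φ s))))) := by
  set z : Fin N → ℂ := fun j => changeVar ε η (x j) with hz
  have hup : ∀ t, (fun j => changeVar ε η (Function.update x i t j)) =
      Function.update z i (changeVar ε η t) := by
    intro t
    funext j
    by_cases h : j = i
    · subst h; simp
    · simp [Function.update_of_ne h, hz]
  have hself : Function.update z i (changeVar ε η (x i)) = z := Function.update_eq_self i z
  obtain ⟨K, hK⟩ := prod_update_eq hN m.α m.β_symm x i
  have hfac : ∀ t, gaugeFactor ε a b ω (Function.update x i t) =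
      K * (m.α t * m.β t (x (i + 1)) * m.β t (x (i - 1))) :=
    fun t => (m.gaugeFactor_eq _).trans (hK t)
  have hq : ∀ (P : Poly N) (t : ℝ), HasDerivAt
      (fun t => eval (Function.update z i (changeVar ε η t)) P)
      (m.ζ₁ t * eval (Function.update z i (changeVar ε η t)) (pderiv i P)) t := fun P t =>
    (hasDerivAt_eval_update P z i (changeVar ε η t)).scomp t (m.hasDerivAt_ζ t)
  have hm : ∀ᶠ t in 𝓝 (x i), HasDerivAt
      (fun t => K * (m.α t * m.β t (x (i + 1)) * m.β t (x (i - 1))))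
      (K * (m.α t * m.β t (x (i + 1)) * m.β t (x (i - 1))) *
        (m.A t + a * (m.lam t (x (i + 1)) + m.lam t (x (i - 1))))) t := by
    filter_upwards [m.dom_open (hx i), m.dom_open (m.dom_pred hx i)] with t h1 h2
    refine ((((m.hasDerivAt_α h1).fun_mul (m.hasDerivAt_β h1)).fun_mul
      (m.hasDerivAt_β h2)).const_mul K).congr_deriv ?_
    ring
  have hl : HasDerivAt (fun t => m.A t + a * (m.lam t (x (i + 1)) + m.lam t (x (i - 1))))
      (m.logDeriv' x i) (x i) :=
    (m.hasDerivAt_A (hx i)).fun_add (((m.hasDerivAt_lam (hx i)).fun_add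
      (m.hasDerivAt_lam (m.dom_pred hx i))).const_mul a)
  have hq₁ := (m.hasDerivAt_ζ₁ (x i)).fun_mul (hq (pderiv i (Φ s)) (x i))
  have := iteratedDeriv_two_mul_ofReal hm hl (Filter.Eventually.of_forall (hq (Φ s))) hq₁
  have hfun : (fun t => physical ε η a b ω Φ (Function.update x i t) s) = fun t =>
      ((K * (m.α t * m.β t (x (i + 1)) * m.β t (x (i - 1))) : ℝ) : ℂ) *
        eval (Function.update z i (changeVar ε η t)) (Φ s) := by
    funext t
    rw [physical, hfac, hup]
  rw [secondPartial, hfun, this, hself, ← hfac, Function.update_eq_self]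
  simp only [LocalModel.logDeriv]
  ring

/-- The cross term of the squared logarithmic derivative is the three-body sum. The terms with
`x_{i-1}` are shifted by one index, so that the two contributions of each edge meet and `two_body`
applies; `N` points and `N` edges give `N (c₁ + c₂) = -E_0`. -/
theorem LocalModel.sum_logDeriv (m : LocalModel ε η a b ω) {x : Fin N → ℝ}
    (hx : ∀ i, m.dom (x i) (x (i + 1))) :
    ∑ i, (m.logDeriv x i ^ 2 + m.logDeriv' x i) = ∑ i, m.V₁ (x i)
      + 2 * a ^ 2 * ∑ i, m.lam (x i) (x (i + 1)) * m.lam (x i) (x (i - 1))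
      + (a - 1) * ∑ i, m.κ (x i) (x (i + 1)) - constE ε N a b ω := by
  have hsplit : ∀ i, m.logDeriv x i ^ 2 + m.logDeriv' x i =
      (m.V₁ (x i) + m.c₁) + 2 * a ^ 2 * (m.lam (x i) (x (i + 1)) * m.lam (x i) (x (i - 1)))
      + (2 * a * (m.A (x i) * m.lam (x i) (x (i + 1))) + a ^ 2 * m.lam (x i) (x (i + 1)) ^ 2
        + a * m.lam' (x i) (x (i + 1)))
      + (2 * a * (m.A (x i) * m.lam (x i) (x (i - 1))) + a ^ 2 * m.lam (x i) (x (i - 1)) ^ 2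
        + a * m.lam' (x i) (x (i - 1))) := by
    intro i
    rw [← m.one_body (hx i), LocalModel.logDeriv, LocalModel.logDeriv']
    ring
  have hpair : ∀ i, (2 * a * (m.A (x i) * m.lam (x i) (x (i + 1)))
        + a ^ 2 * m.lam (x i) (x (i + 1)) ^ 2 + a * m.lam' (x i) (x (i + 1)))
      + (2 * a * (m.A (x (i + 1)) * m.lam (x (i + 1)) (x i))
        + a ^ 2 * m.lam (x (i + 1)) (x i) ^ 2 + a * m.lam' (x (i + 1)) (x i)) =
      (a - 1) * m.κ (x i) (x (i + 1)) + m.c₂ := by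
    intro i
    rw [← m.two_body (hx i)]
    ring
  rw [Finset.sum_congr rfl fun i _ => hsplit i, Finset.sum_add_distrib,
    sum_sub_one fun i j => 2 * a * (m.A (x i) * m.lam (x i) (x j)) + a ^ 2 * m.lam (x i) (x j) ^ 2
        + a * m.lam' (x i) (x j), Finset.sum_add_distrib, add_assoc, ← Finset.sum_add_distrib,
    Finset.sum_congr rfl fun i _ => hpair i, m.const, Finset.sum_add_distrib,
    Finset.sum_add_distrib, Finset.sum_add_distrib, ← Finset.mul_sum, ← Finset.mul_sum]
  simp only [Finset.sum_const, Finset.card_univ, Fintype.card_fin, nsmul_eq_mul]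
  ring

theorem LocalModel.sum_deriv (m : LocalModel ε η a b ω) {x : Fin N → ℝ}
    (hx : ∀ i, m.dom (x i) (x (i + 1))) (p q : Fin N → ℂ) :
    -∑ i, (2 * (m.logDeriv x i : ℂ) * (m.ζ₁ (x i) * p i)
        + (m.ζ₂ (x i) * p i + m.ζ₁ (x i) ^ 2 * q i)) =
      constC ε * (∑ i, changeVar ε η (x i) ^ (ε : ℕ) * q i
        + 2 * a * ∑ i, (changeVar ε η (x i) ^ (ε : ℕ) * p i
          - changeVar ε η (x (i + 1)) ^ (ε : ℕ) * p (i + 1))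
            / (changeVar ε η (x i) - changeVar ε η (x (i + 1))))
      + constMinus ε b * ∑ i, p i + constZero ε a ω * ∑ i, changeVar ε η (x i) * p i := by
  have hsplit : ∀ i, -(2 * (m.logDeriv x i : ℂ) * (m.ζ₁ (x i) * p i)
        + (m.ζ₂ (x i) * p i + m.ζ₁ (x i) ^ 2 * q i)) =
      (constC ε * (changeVar ε η (x i) ^ (ε : ℕ) * q i) + constMinus ε b * p i
        + (constZero ε a ω - 2 * m.e) * (changeVar ε η (x i) * p i))
      + -(2 * a * ((m.lam (x i) (x (i + 1)) : ℂ) * (m.ζ₁ (x i) * p i)))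
      + -(2 * a * ((m.lam (x i) (x (i - 1)) : ℂ) * (m.ζ₁ (x i) * p i))) := by
    intro i
    rw [← m.one_body_deriv (hx i), LocalModel.logDeriv]
    push_cast
    ring
  have hpair : ∀ i, -(2 * a * ((m.lam (x i) (x (i + 1)) : ℂ) * (m.ζ₁ (x i) * p i)))
      + -(2 * a * ((m.lam (x (i + 1)) (x i) : ℂ) * (m.ζ₁ (x (i + 1)) * p (i + 1)))) =
      constC ε * (2 * a) * ((changeVar ε η (x i) ^ (ε : ℕ) * p i
          - changeVar ε η (x (i + 1)) ^ (ε : ℕ) * p (i + 1))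
            / (changeVar ε η (x i) - changeVar ε η (x (i + 1))))
        + (m.e * (changeVar ε η (x i) * p i)
          + m.e * (changeVar ε η (x (i + 1)) * p (i + 1))) := by
    intro i
    have := m.two_body_deriv (hx i) (p i) (p (i + 1))
    linear_combination this
  rw [← Finset.sum_neg_distrib, Finset.sum_congr rfl fun i _ => hsplit i, Finset.sum_add_distrib,
    sum_sub_one fun i j => -(2 * a * ((m.lam (x i) (x j) : ℂ) * (m.ζ₁ (x i) * p i))),
    Finset.sum_add_distrib, add_assoc, ← Finset.sum_add_distrib,
    Finset.sum_congr rfl fun i _ => hpair i]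
  simp only [Finset.sum_add_distrib, ← Finset.mul_sum]
  rw [sum_add_one fun i => changeVar ε η (x i) * p i]
  ring

/-- The terms without derivatives add up to `E_0 - (a - 1) κ + κ (a - S) = E_0 + κ (1 - S)`, summed
over edges, and `κ (1 - S)` is the exchange part of the gauge Hamiltonian because `S = K` on `Φ`. -/
theorem LocalModel.ham_physical (m : LocalModel ε η a b ω) (hN : 2 ≤ N) {Φ Ψ : State N k}
    (hΦ : Φ ∈ symmetricStates N k) (h : GaugeMaps ε a b ω Φ Ψ) {x : Fin N → ℝ}
    (hx : x ∈ configSpace N ε) :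
    ham ε a b ω (physical ε η a b ω Φ) x = physical ε η a b ω Ψ x := by
  have hd := m.dom_of_mem hN x hx
  funext s
  set z : Fin N → ℂ := fun j => changeVar ε η (x j) with hz
  have hev := eval_of_gaugeHam_eq hN (h s) (z := z) fun i => m.changeVar_ne (hd i)
  have hsum := m.sum_logDeriv hd
  have hder := m.sum_deriv hd (fun i => eval z (pderiv i (Φ s)))
    (fun i => eval z (pderiv i (pderiv i (Φ s))))
  have hex : constC ε * (2 * a) * ∑ i, eval z (thetaPoly ε (X i) (X (i + 1)))
      / (z i - z (i + 1)) ^ 2 * (eval z (Φ s) - eval z (rename (Equiv.swap i (i + 1)) (Φ s)))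
      = -∑ i, (m.κ (x i) (x (i + 1)) : ℂ) * (eval z (Φ s)
        - eval z (Φ fun l => s (Equiv.swap i (i + 1) l))) := by
    rw [Finset.mul_sum, ← Finset.sum_neg_distrib]
    refine Finset.sum_congr rfl fun i _ => ?_
    rw [eval_thetaPoly, eval_X, eval_X, rename_swap_of_mem_symmetricStates hΦ, ← mul_assoc,
      m.exchange (hd i), neg_mul]
  have hpot : potential ε a b ω x (physical ε η a b ω Φ x) s = gaugeFactor ε a b ω x *
      (((∑ i, m.V₁ (x i) + 2 * a ^ 2 * ∑ i, m.lam (x i) (x (i + 1)) * m.lam (x i) (x (i - 1)) : ℝ)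
        : ℂ) * eval z (Φ s) + ∑ i, (m.κ (x i) (x (i + 1)) : ℂ) *
          (a * eval z (Φ s) - eval z (Φ fun l => s (Equiv.swap i (i + 1) l)))) := by
    rw [m.potential_eq]
    simp only [physical, spinExchange, spinPerm, mul_add, Finset.mul_sum]
    refine congrArg₂ (· + ·) (by ring) (Finset.sum_congr rfl fun i _ => by ring)
  have hlap : (∑ i, secondPartial i (physical ε η a b ω Φ) x) s = gaugeFactor ε a b ω x *
      (((∑ i, (m.logDeriv x i ^ 2 + m.logDeriv' x i) : ℝ) : ℂ) * eval z (Φ s)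
      + ∑ i, (2 * (m.logDeriv x i : ℂ) * (m.ζ₁ (x i) * eval z (pderiv i (Φ s)))
        + (m.ζ₂ (x i) * eval z (pderiv i (Φ s))
          + m.ζ₁ (x i) ^ 2 * eval z (pderiv i (pderiv i (Φ s)))))) := by
    rw [Finset.sum_apply, Complex.ofReal_sum, Finset.sum_mul, ← Finset.sum_add_distrib,
      Finset.mul_sum]
    refine Finset.sum_congr rfl fun i _ => ?_
    rw [m.secondPartial_physical hN hd]
    ring
  have hk : ∑ i, (m.κ (x i) (x (i + 1)) : ℂ) *
        (a * eval z (Φ s) - eval z (Φ fun l => s (Equiv.swap i (i + 1) l))) =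
      (a - 1) * (∑ i, (m.κ (x i) (x (i + 1)) : ℂ)) * eval z (Φ s)
      + ∑ i, (m.κ (x i) (x (i + 1)) : ℂ) * (eval z (Φ s)
        - eval z (Φ fun l => s (Equiv.swap i (i + 1) l))) := by
    rw [Finset.mul_sum, Finset.sum_mul, ← Finset.sum_add_distrib]
    exact Finset.sum_congr rfl fun i _ => by ring
  rw [ham, Pi.add_apply, Pi.neg_apply, hlap, hpot, hsum, hk, physical, hev]
  push_cast
  linear_combination (gaugeFactor ε a b ω x : ℂ) * (hder + hex)

end

noncomputable section

open Filter Topology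

/-! ### The three local models -/

/-- `Real.log` ignores the sign of its argument, so `|f|^a = exp (a log f)` wherever `f ≠ 0`, and no
case distinction is needed. -/
theorem hasDerivAt_abs_rpow {f : ℝ → ℝ} {f' t : ℝ} (a : ℝ) (hf : HasDerivAt f f' t)
    (h : f t ≠ 0) : HasDerivAt (fun t => |f t| ^ a) (|f t| ^ a * (a * (f' / f t))) t := by
  have e : ∀ y : ℝ, y ≠ 0 → |y| ^ a = Real.exp (a * Real.log y) := by
    intro y hy
    rw [Real.rpow_def_of_pos (abs_pos.2 hy), Real.log_abs, mul_comm]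
  have h1 : (fun t => |f t| ^ a) =ᶠ[𝓝 t] fun t => Real.exp (a * Real.log (f t)) := by
    filter_upwards [hf.continuousAt.eventually_ne h] with t ht using e _ ht
  rw [e _ h]
  exact ((hf.log h).const_mul a).exp.congr_of_eventuallyEq h1

theorem contDiffAt_abs_rpow {E : Type*} [NormedAddCommGroup E] [NormedSpace ℝ E] {f : E → ℝ}
    {x : E} (a : ℝ) (hf : ContDiffAt ℝ ((⊤ : ℕ∞) : WithTop ℕ∞) f x) (h : f x ≠ 0) :
    ContDiffAt ℝ ((⊤ : ℕ∞) : WithTop ℕ∞) (fun y => |f y| ^ a) x :=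
  ((contDiffAt_abs (n := (⊤ : ℕ∞)) h).comp x hf).rpow_const_of_ne (abs_ne_zero.2 h)

theorem hasDerivAt_gaussian (ω t : ℝ) :
    HasDerivAt (fun t : ℝ => Real.exp (-(ω / 2) * t ^ 2))
      (Real.exp (-(ω / 2) * t ^ 2) * (-ω * t)) t := by
  refine (((hasDerivAt_id' t).pow 2).const_mul (-(ω / 2))).exp.congr_deriv ?_
  simp
  ring

theorem hasDerivAt_one_div_sub {u v : ℝ} (h : u ≠ v) :
    HasDerivAt (fun t => 1 / (t - v)) (-1 / (u - v) ^ 2) u := by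
  have h1 : u - v ≠ 0 := sub_ne_zero.2 h
  refine ((hasDerivAt_const u (1 : ℝ)).div ((hasDerivAt_id' u).sub_const v) h1).congr_deriv ?_
  simp

theorem strictMono_ne {N : ℕ} [NeZero N] (hN : 2 ≤ N) {x : Fin N → ℝ} (hx : StrictMono x)
    (i : Fin N) : x i ≠ x (i + 1) := hx.injective.ne (fin_ne_add_one hN i)

/-- The rational model. -/
def rationalModel (η : ℤˣ) (a b ω : ℝ) : LocalModel 0 η a b ω where
  dom u v := u ≠ v
  α u := Real.exp (-(ω / 2) * u ^ 2)
  A u := -ω * u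
  A' _ := -ω
  V₁ u := ω ^ 2 * u ^ 2
  β u v := |u - v| ^ a
  lam u v := 1 / (u - v)
  lam' u v := -1 / (u - v) ^ 2
  κ u v := 2 * a / (u - v) ^ 2
  ζ₁ _ := 1
  ζ₂ _ := 0
  c₁ := -ω
  c₂ := -2 * a * ω
  e := 0
  dom_symm := Ne.symm
  dom_open h := eventually_ne_nhds h
  hasDerivAt_α _ := hasDerivAt_gaussian ω _
  hasDerivAt_A {u v} _ := by simpa using (hasDerivAt_id' u).const_mul (-ω)
  β_symm u v := by rw [abs_sub_comm]
  hasDerivAt_β {u v} h := hasDerivAt_abs_rpow a ((hasDerivAt_id' u).sub_const v) (sub_ne_zero.2 h)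
  hasDerivAt_lam h := hasDerivAt_one_div_sub h
  hasDerivAt_ζ t := Complex.ofRealCLM.hasDerivAt
  hasDerivAt_ζ₁ t := hasDerivAt_const t 1
  changeVar_ne h := by simpa [changeVar] using h
  one_body _ := by ring
  two_body {u v} h := by
    have h1 : u - v ≠ 0 := sub_ne_zero.2 h
    have h2 : v - u ≠ 0 := sub_ne_zero.2 h.symm
    rw [show v - u = -(u - v) by ring]
    field_simp
    ring
  const N := by simp only [constE]; ring
  one_body_deriv _ p q := by
    simp [constC, constMinus, constZero, changeVar]
    ring
  two_body_deriv {u v} h p q := by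
    have h1 : (u : ℂ) - v ≠ 0 := by rw [sub_ne_zero]; exact_mod_cast h
    have h2 : (v : ℂ) - u ≠ 0 := by rw [sub_ne_zero]; exact_mod_cast h.symm
    simp only [constC, changeVar, Fin.val_zero, pow_zero, one_mul]
    push_cast
    rw [show (v : ℂ) - u = -(u - v) by ring]
    field_simp
    ring
  exchange {u v} h := by
    simp [constC, changeVar, thetaVal]
    ring
  gaugeFactor_eq x := by
    rw [gaugeFactor, Finset.prod_mul_distrib, ← Real.exp_sum, Finset.mul_sum]
  potential_eq x v s := by
    simp only [potential, Pi.add_apply, Pi.smul_apply, Finset.sum_apply, Pi.sub_apply, smul_eq_mul,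
      Finset.mul_sum]
    congr 4
    refine Finset.sum_congr rfl fun i _ => ?_
    rw [mul_comm (x i - x (i - 1))]
    simp only [div_eq_mul_inv, mul_inv]
    ring
  dom_of_mem hN x hx i := strictMono_ne hN hx i
  dom_of_lt_one _ _ _ _ h := h
  α_ne_zero _ := (Real.exp_pos _).ne'
  β_ne_zero h := (Real.rpow_pos_of_pos (abs_pos.2 (sub_ne_zero.2 h)) a).ne'
  contDiffAt_α _ := by fun_prop
  contDiffAt_β {u v} h := contDiffAt_abs_rpow a (contDiffAt_fst.sub contDiffAt_snd)
    (sub_ne_zero.2 h)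
  contDiff_ζ := Complex.ofRealCLM.contDiff

theorem sq_ne_sq_of_pos {u v : ℝ} (h : 0 < u ∧ 0 < v ∧ u ≠ v) : u ^ 2 - v ^ 2 ≠ 0 := by
  obtain ⟨hu, hv, hne⟩ := h
  rw [sq_sub_sq]
  exact mul_ne_zero (by positivity) (sub_ne_zero.2 hne)

/-- The model with reflections. -/
def reflectionModel (η : ℤˣ) (a b ω : ℝ) : LocalModel 1 η a b ω where
  dom u v := 0 < u ∧ 0 < v ∧ u ≠ v
  α u := Real.exp (-(ω / 2) * u ^ 2) * u ^ b
  A u := -ω * u + b / u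
  A' u := -ω - b / u ^ 2
  V₁ u := ω ^ 2 * u ^ 2 + b * (b - 1) / u ^ 2
  β u v := |u ^ 2 - v ^ 2| ^ a
  lam u v := 2 * u / (u ^ 2 - v ^ 2)
  lam' u v := 2 / (u ^ 2 - v ^ 2) - 4 * u ^ 2 / (u ^ 2 - v ^ 2) ^ 2
  κ u v := 4 * a * ((u ^ 2 + v ^ 2) / (u ^ 2 - v ^ 2) ^ 2)
  ζ₁ u := 2 * u
  ζ₂ _ := 2
  c₁ := -2 * ω * b - ω
  -- From the Gaussian part of `A`: `2a · (-ω) · 2(u² - v²)/(u² - v²)`. The parts `b/u` and `b/v`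
  -- cancel.
  c₂ := -4 * a * ω
  e := 0
  dom_symm h := ⟨h.2.1, h.1, h.2.2.symm⟩
  dom_open h := by
    filter_upwards [lt_mem_nhds h.1, eventually_ne_nhds h.2.2] with t h1 h2 using ⟨h1, h.2.1, h2⟩
  hasDerivAt_α {u v} h := by
    refine ((hasDerivAt_gaussian ω u).fun_mul
      (Real.hasDerivAt_rpow_const (Or.inl h.1.ne'))).congr_deriv ?_
    rw [Real.rpow_sub_one h.1.ne']
    ring
  hasDerivAt_A {u v} h := by
    refine (((hasDerivAt_id' u).const_mul (-ω)).fun_add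
      ((hasDerivAt_const u b).fun_div (hasDerivAt_id' u) h.1.ne')).congr_deriv ?_
    simp
    ring
  β_symm u v := by rw [abs_sub_comm]
  hasDerivAt_β {u v} h := by
    refine (hasDerivAt_abs_rpow a (((hasDerivAt_id' u).fun_pow 2).sub_const (v ^ 2))
      (sq_ne_sq_of_pos h)).congr_deriv ?_
    simp
  hasDerivAt_lam {u v} h := by
    have h1 := sq_ne_sq_of_pos h
    refine (((hasDerivAt_id' u).const_mul 2).fun_div
      (((hasDerivAt_id' u).fun_pow 2).sub_const (v ^ 2)) h1).congr_deriv ?_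
    field_simp
    simp
    ring
  hasDerivAt_ζ t := by
    have := (Complex.ofRealCLM.hasDerivAt (x := t)).fun_pow 2
    refine this.congr_deriv ?_
    simp
  hasDerivAt_ζ₁ t := by
    refine ((Complex.ofRealCLM.hasDerivAt (x := t)).const_mul 2).congr_deriv ?_
    simp
  changeVar_ne {u v} h := by
    have := sub_ne_zero.1 (sq_ne_sq_of_pos h)
    simp only [changeVar]
    exact_mod_cast this
  one_body {u v} h := by
    have := h.1.ne'
    field_simp
    ring
  two_body {u v} h := by
    have h1 := sq_ne_sq_of_pos h
    have hu := h.1.ne'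
    have hv := h.2.1.ne'
    rw [show v ^ 2 - u ^ 2 = -(u ^ 2 - v ^ 2) by ring]
    field_simp
    ring
  const N := by simp only [constE]; ring
  one_body_deriv {u v} h p q := by
    have hu : (u : ℂ) ≠ 0 := by exact_mod_cast h.1.ne'
    simp [constC, constMinus, constZero, changeVar]
    field_simp
    ring
  two_body_deriv {u v} h p q := by
    have h1 : (u : ℂ) ^ 2 - (v : ℂ) ^ 2 ≠ 0 := by exact_mod_cast sq_ne_sq_of_pos h
    simp [constC, changeVar]
    rw [show (v : ℂ) ^ 2 - (u : ℂ) ^ 2 = -((u : ℂ) ^ 2 - (v : ℂ) ^ 2) by ring]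
    field_simp
    ring
  exchange {u v} h := by
    simp [constC, changeVar, thetaVal]
    ring
  gaugeFactor_eq x := by
    rw [gaugeFactor, Finset.mul_sum, Real.exp_sum, ← Finset.prod_mul_distrib]
    exact Finset.prod_congr rfl fun i _ => by ring
  potential_eq x v s := by
    simp only [potential, Pi.add_apply, Pi.smul_apply, Finset.sum_apply, Pi.sub_apply, smul_eq_mul,
      Finset.mul_sum, Finset.sum_add_distrib]
    congr 4
    refine Finset.sum_congr rfl fun i _ => ?_
    rw [mul_comm (x i ^ 2 - x (i - 1) ^ 2)]
    simp only [div_eq_mul_inv, mul_inv]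
    ring
  dom_of_mem hN x hx i := by
    have hpos : ∀ i, 0 < x i := fun i => hx.2.trans_le (hx.1.monotone (Fin.zero_le i))
    exact ⟨hpos _, hpos _, strictMono_ne hN hx.1 i⟩
  dom_of_lt_one h1 _ h2 _ h := ⟨h1, h2, h⟩
  α_ne_zero h := mul_ne_zero (Real.exp_pos _).ne' (Real.rpow_pos_of_pos h.1 b).ne'
  β_ne_zero h := (Real.rpow_pos_of_pos (abs_pos.2 (sq_ne_sq_of_pos h)) a).ne'
  contDiffAt_α {u v} h := by
    refine ContDiffAt.mul (by fun_prop) (contDiffAt_id.rpow_const_of_ne h.1.ne')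
  contDiffAt_β {u v} h := contDiffAt_abs_rpow a
    ((contDiffAt_fst.pow 2).sub (contDiffAt_snd.pow 2)) (sq_ne_sq_of_pos h)
  contDiff_ζ := Complex.ofRealCLM.contDiff.pow 2

/-! #### Trigonometric identities -/

theorem sin_ne_zero_of_sin_abs_pos {d : ℝ} (h : 0 < Real.sin |d|) : Real.sin d ≠ 0 := by
  rcases abs_choice d with e | e <;> rw [e] at h
  · exact h.ne'
  · rw [Real.sin_neg] at h
    exact (by linarith : Real.sin d < 0).ne

theorem sin_abs_eq_abs_sin {d : ℝ} (h : 0 < Real.sin |d|) : Real.sin |d| = |Real.sin d| := by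
  rcases abs_choice d with e | e <;> rw [e] at h ⊢
  · rw [abs_of_pos h]
  · rw [← abs_neg, ← Real.sin_neg, abs_of_pos h]

/-- The witness is the geometric mean `E = exp(iη(u+v))`: dividing `exp(2iηu) ± exp(2iηv)` by it
leaves `exp(iηd) ± exp(-iηd)` with `d = u - v`. -/
theorem exists_exp_factor (η : ℤˣ) (u v : ℝ) :
    ∃ E : ℂ, E ≠ 0 ∧ E ^ 2 = changeVar 2 η u * changeVar 2 η v ∧
      changeVar 2 η u + changeVar 2 η v = 2 * (Real.cos (u - v) : ℂ) * E ∧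
      changeVar 2 η u - changeVar 2 η v =
        2 * Complex.I * ((η : ℤ) : ℂ) * (Real.sin (u - v) : ℂ) * E := by
  refine ⟨Complex.exp (((η : ℤ) : ℂ) * Complex.I * (u + v)), Complex.exp_ne_zero _, ?_, ?_, ?_⟩
  · simp only [changeVar]
    rw [← Complex.exp_nat_mul, ← Complex.exp_add]
    congr 1
    push_cast
    ring
  · simp only [changeVar, Complex.ofReal_cos, Complex.cos]
    rcases Int.units_eq_one_or η with rfl | rfl
    · rw [show 2 * ((Complex.exp ((u - v : ℝ) * Complex.I) + Complex.exp (-(u - v : ℝ) * Complex.I))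
          / 2) * Complex.exp (((1 : ℤˣ) : ℤ) * Complex.I * (u + v)) =
        Complex.exp ((u - v : ℝ) * Complex.I) * Complex.exp (((1 : ℤˣ) : ℤ) * Complex.I * (u + v))
        + Complex.exp (-(u - v : ℝ) * Complex.I)
          * Complex.exp (((1 : ℤˣ) : ℤ) * Complex.I * (u + v)) by ring,
        ← Complex.exp_add, ← Complex.exp_add]
      congr 2 <;> (push_cast; ring)
    · rw [show 2 * ((Complex.exp ((u - v : ℝ) * Complex.I) + Complex.exp (-(u - v : ℝ) * Complex.I))
          / 2) * Complex.exp (((-1 : ℤˣ) : ℤ) * Complex.I * (u + v)) =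
        Complex.exp (-(u - v : ℝ) * Complex.I) * Complex.exp (((-1 : ℤˣ) : ℤ) * Complex.I * (u + v))
        + Complex.exp ((u - v : ℝ) * Complex.I)
          * Complex.exp (((-1 : ℤˣ) : ℤ) * Complex.I * (u + v)) by ring,
        ← Complex.exp_add, ← Complex.exp_add]
      congr 2 <;> (push_cast; ring)
  · simp only [changeVar, Complex.ofReal_sin, Complex.sin]
    have hI := Complex.I_sq
    rcases Int.units_eq_one_or η with rfl | rfl
    · rw [show 2 * Complex.I * (((1 : ℤˣ) : ℤ) : ℂ) *
          ((Complex.exp (-(u - v : ℝ) * Complex.I) - Complex.exp ((u - v : ℝ) * Complex.I))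
          * Complex.I / 2) * Complex.exp (((1 : ℤˣ) : ℤ) * Complex.I * (u + v)) =
        Complex.exp ((u - v : ℝ) * Complex.I) * Complex.exp (((1 : ℤˣ) : ℤ) * Complex.I * (u + v))
        - Complex.exp (-(u - v : ℝ) * Complex.I)
          * Complex.exp (((1 : ℤˣ) : ℤ) * Complex.I * (u + v)) by
          push_cast
          linear_combination (Complex.exp (-(u - v : ℂ) * Complex.I)
            - Complex.exp ((u - v : ℂ) * Complex.I))
            * Complex.exp (1 * Complex.I * (u + v)) * hI,
        ← Complex.exp_add, ← Complex.exp_add]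
      congr 2 <;> (push_cast; ring)
    · rw [show 2 * Complex.I * (((-1 : ℤˣ) : ℤ) : ℂ) *
          ((Complex.exp (-(u - v : ℝ) * Complex.I) - Complex.exp ((u - v : ℝ) * Complex.I))
          * Complex.I / 2) * Complex.exp (((-1 : ℤˣ) : ℤ) * Complex.I * (u + v)) =
        Complex.exp (-(u - v : ℝ) * Complex.I) * Complex.exp (((-1 : ℤˣ) : ℤ) * Complex.I * (u + v))
        - Complex.exp ((u - v : ℝ) * Complex.I)
          * Complex.exp (((-1 : ℤˣ) : ℤ) * Complex.I * (u + v)) by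
          push_cast
          linear_combination (-(Complex.exp (-(u - v : ℂ) * Complex.I)
            - Complex.exp ((u - v : ℂ) * Complex.I)))
            * Complex.exp (-1 * Complex.I * (u + v)) * hI,
        ← Complex.exp_add, ← Complex.exp_add]
      congr 2 <;> (push_cast; ring)

theorem units_cast_sq (η : ℤˣ) : (((η : ℤ) : ℂ)) ^ 2 = 1 := by
  rcases Int.units_eq_one_or η with rfl | rfl <;> simp

theorem hasDerivAt_changeVar_two (η : ℤˣ) (t : ℝ) :
    HasDerivAt (changeVar 2 η) (2 * Complex.I * ((η : ℤ) : ℂ) * changeVar 2 η t) t := by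
  have := ((Complex.ofRealCLM.hasDerivAt (x := t)).const_mul (((η : ℤ) : ℂ) * 2 * Complex.I)).cexp
  refine this.congr_deriv ?_
  simp [changeVar]
  ring

theorem hasDerivAt_cot {d : ℝ} (h : Real.sin d ≠ 0) :
    HasDerivAt Real.cot (-1 / Real.sin d ^ 2) d := by
  have e : Real.cot = fun t => Real.cos t / Real.sin t := by
    funext t; exact Real.cot_eq_cos_div_sin t
  rw [e]
  refine ((Real.hasDerivAt_cos d).fun_div (Real.hasDerivAt_sin d) h).congr_deriv ?_
  congr 1
  linear_combination -Real.sin_sq_add_cos_sq d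

theorem cot_sub_comm (u v : ℝ) : Real.cot (v - u) = -Real.cot (u - v) := by
  rw [← neg_sub u v, Real.cot_eq_cos_div_sin, Real.cot_eq_cos_div_sin, Real.cos_neg, Real.sin_neg,
    div_neg]

theorem eventually_sin_abs_pos {u v : ℝ} (h : 0 < Real.sin |u - v|) :
    ∀ᶠ t in 𝓝 u, 0 < Real.sin |t - v| :=
  ContinuousAt.eventually_lt continuousAt_const
    (by fun_prop : ContinuousAt (fun t => Real.sin |t - v|) u) h

theorem contDiffAt_sin_abs_rpow {u v : ℝ} (a : ℝ) (h : 0 < Real.sin |u - v|) :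
    ContDiffAt ℝ ((⊤ : ℕ∞) : WithTop ℕ∞) (fun y : ℝ × ℝ => Real.sin |y.1 - y.2| ^ a) (u, v) := by
  have h0 : u - v ≠ 0 := by
    intro h0
    simp [h0] at h
  have h1 : ContDiffAt ℝ ((⊤ : ℕ∞) : WithTop ℕ∞) (fun y : ℝ × ℝ => |y.1 - y.2|) (u, v) :=
    ContDiffAt.comp (g := fun t : ℝ => |t|) (f := fun y : ℝ × ℝ => y.1 - y.2) (u, v)
      (contDiffAt_abs (n := (⊤ : ℕ∞)) h0) (contDiffAt_fst.sub contDiffAt_snd)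
  exact ContDiffAt.rpow_const_of_ne h1.sin h.ne'

/-- The trigonometric model. -/
def trigModel (η : ℤˣ) (a b ω : ℝ) : LocalModel 2 η a b ω where
  dom u v := 0 < Real.sin |u - v|
  α _ := 1
  A _ := 0
  A' _ := 0
  V₁ _ := 0
  β u v := Real.sin |u - v| ^ a
  lam u v := Real.cot (u - v)
  lam' u v := -1 / Real.sin (u - v) ^ 2
  κ u v := 2 * a / Real.sin (u - v) ^ 2
  ζ₁ u := 2 * Complex.I * ((η : ℤ) : ℂ) * changeVar 2 η u
  ζ₂ u := -4 * changeVar 2 η u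
  c₁ := 0
  -- From `2 a² cot² - 2 a csc² = 2 a (a - 1) csc² - 2 a²`.
  c₂ := -2 * a ^ 2
  -- With `cot (u - v) = iη (z + w)/(z - w)`, this comes from `(z + w)(z p - w q) = 2 (z² p - w² q)
  -- - (z - w)(z p + w q)`.
  e := -4 * a
  dom_symm {u v} h := by rwa [abs_sub_comm]
  dom_open h := eventually_sin_abs_pos h
  hasDerivAt_α {u v} _ := by simpa using hasDerivAt_const u (1 : ℝ)
  hasDerivAt_A {u v} _ := hasDerivAt_const u (0 : ℝ)
  β_symm u v := by rw [abs_sub_comm]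
  hasDerivAt_β {u v} h := by
    have h1 : (fun t => Real.sin |t - v| ^ a) =ᶠ[𝓝 u] fun t => |Real.sin (t - v)| ^ a := by
      filter_upwards [eventually_sin_abs_pos h] with t ht
      rw [sin_abs_eq_abs_sin ht]
    have h2 := hasDerivAt_abs_rpow a (((hasDerivAt_id' u).sub_const v).sin)
      (sin_ne_zero_of_sin_abs_pos h)
    refine (h2.congr_of_eventuallyEq h1).congr_deriv ?_
    rw [sin_abs_eq_abs_sin h, Real.cot_eq_cos_div_sin, mul_one]
  hasDerivAt_lam {u v} h :=
    (hasDerivAt_cot (sin_ne_zero_of_sin_abs_pos h)).comp_sub_const u v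
  hasDerivAt_ζ t := hasDerivAt_changeVar_two η t
  hasDerivAt_ζ₁ t := by
    refine ((hasDerivAt_changeVar_two η t).const_mul _).congr_deriv ?_
    linear_combination (4 * changeVar 2 η t * Complex.I ^ 2) * units_cast_sq η
      + 4 * changeVar 2 η t * Complex.I_sq
  changeVar_ne {u v} h := by
    obtain ⟨E, hE, -, -, h4⟩ := exists_exp_factor η u v
    rw [← sub_ne_zero, h4]
    have hs : (Real.sin (u - v) : ℂ) ≠ 0 := by exact_mod_cast sin_ne_zero_of_sin_abs_pos h
    have hη : ((η : ℤ) : ℂ) ≠ 0 := by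
      intro h0; have := units_cast_sq η; rw [h0] at this; norm_num at this
    exact mul_ne_zero (mul_ne_zero (mul_ne_zero (mul_ne_zero two_ne_zero Complex.I_ne_zero) hη) hs) hE
  one_body _ := by ring
  two_body {u v} h := by
    have hs := sin_ne_zero_of_sin_abs_pos h
    have hs2 := Real.sin_sq_add_cos_sq (u - v)
    rw [cot_sub_comm u v, Real.cot_eq_cos_div_sin, show v - u = -(u - v) by ring, Real.sin_neg]
    field_simp
    linear_combination (2 * a ^ 2) * hs2
  const N := by simp only [constE]; ring
  one_body_deriv {u v} h p q := by
    have h1 := units_cast_sq η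
    have h2 := Complex.I_sq
    simp only [constC, constMinus, constZero, Fin.val_two]
    push_cast
    linear_combination (-4 * changeVar 2 η u ^ 2 * q * Complex.I ^ 2) * h1
      - 4 * changeVar 2 η u ^ 2 * q * h2
  two_body_deriv {u v} h p q := by
    obtain ⟨E, hE, -, h3, h4⟩ := exists_exp_factor η u v
    have h1 := units_cast_sq η
    have h2 := Complex.I_sq
    have hs : (Real.sin (u - v) : ℂ) ≠ 0 := by exact_mod_cast sin_ne_zero_of_sin_abs_pos h
    have hη : ((η : ℤ) : ℂ) ≠ 0 := by
      intro h0; rw [h0] at h1; norm_num at h1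
    have hI := Complex.I_ne_zero
    have hd : changeVar 2 η u - changeVar 2 η v ≠ 0 := by
      rw [h4]
      exact mul_ne_zero (mul_ne_zero (mul_ne_zero (mul_ne_zero two_ne_zero Complex.I_ne_zero) hη) hs) hE
    have hcot : (Real.cot (u - v) : ℂ) * (changeVar 2 η u - changeVar 2 η v) =
        Complex.I * ((η : ℤ) : ℂ) * (changeVar 2 η u + changeVar 2 η v) := by
      rw [h3, h4, Real.cot_eq_cos_div_sin]
      push_cast at hs ⊢
      field_simp
    rw [cot_sub_comm u v]
    simp only [constC, Fin.val_two]
    push_cast at hcot ⊢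
    have hR : (changeVar 2 η u ^ 2 * p - changeVar 2 η v ^ 2 * q)
        / (changeVar 2 η u - changeVar 2 η v) * (changeVar 2 η u - changeVar 2 η v) =
        changeVar 2 η u ^ 2 * p - changeVar 2 η v ^ 2 * q := div_mul_cancel₀ _ hd
    refine mul_right_cancel₀ hd ?_
    linear_combination (-4 * a * Complex.I * ((η : ℤ) : ℂ)
      * (changeVar 2 η u * p - changeVar 2 η v * q)) * hcot - 8 * a * hR
      - 4 * a * (changeVar 2 η u * p - changeVar 2 η v * q)
        * (changeVar 2 η u + changeVar 2 η v) * (Complex.I ^ 2 * h1 + h2)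
  exchange {u v} h := by
    obtain ⟨E, hE, h5, -, h4⟩ := exists_exp_factor η u v
    have h1 := units_cast_sq η
    have h2 := Complex.I_sq
    have hs : (Real.sin (u - v) : ℂ) ≠ 0 := by exact_mod_cast sin_ne_zero_of_sin_abs_pos h
    have hη : ((η : ℤ) : ℂ) ≠ 0 := by
      intro h0; rw [h0] at h1; norm_num at h1
    have hI := Complex.I_ne_zero
    simp only [thetaVal, constC]
    rw [← h5, h4, mul_pow, mul_pow, mul_pow, mul_pow, h1, h2]
    push_cast at hs ⊢
    field_simp
    ring
  gaugeFactor_eq x := by simp [gaugeFactor]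
  potential_eq x v s := by
    simp only [potential, Pi.add_apply, Pi.smul_apply, Finset.sum_apply, Pi.sub_apply, smul_eq_mul,
      Finset.sum_const_zero, zero_add]
    congr 4
    exact Finset.sum_congr rfl fun i _ => mul_comm _ _
  dom_of_mem hN x hx i := hx.2 i
  dom_of_lt_one {u v} h1 h2 h3 h4 h := by
    refine Real.sin_pos_of_pos_of_lt_pi (abs_pos.2 (sub_ne_zero.2 h)) ?_
    have : |u - v| < 1 := by rw [abs_lt]; constructor <;> linarith
    linarith [Real.pi_gt_three]
  α_ne_zero _ := one_ne_zero
  β_ne_zero h := (Real.rpow_pos_of_pos h a).ne'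
  contDiffAt_α _ := contDiffAt_const
  contDiffAt_β h := contDiffAt_sin_abs_rpow a h
  contDiff_ζ := (contDiff_const.mul Complex.ofRealCLM.contDiff).cexp

/-- The local model for each `ε`. -/
def localModel (ε : Fin 3) (η : ℤˣ) (a b ω : ℝ) : LocalModel ε η a b ω :=
  match ε with
  | 0 => rationalModel η a b ω
  | 1 => reflectionModel η a b ω
  | 2 => trigModel η a b ω

/-! ### Smoothness and non-vanishing -/

variable {N k n : ℕ} [NeZero N] {ε : Fin 3} {η : ℤˣ} {a b ω : ℝ}

theorem LocalModel.contDiffAt_gaugeFactor (m : LocalModel ε η a b ω) {x : Fin N → ℝ}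
    (hx : ∀ i, m.dom (x i) (x (i + 1))) :
    ContDiffAt ℝ ((⊤ : ℕ∞) : WithTop ℕ∞) (gaugeFactor (N := N) ε a b ω) x := by
  rw [show gaugeFactor (N := N) ε a b ω = fun x => ∏ i, (m.α (x i) * m.β (x i) (x (i + 1))) from
    funext m.gaugeFactor_eq]
  refine contDiffAt_prod fun i _ => ?_
  have hc : ∀ i, ContDiffAt ℝ ((⊤ : ℕ∞) : WithTop ℕ∞) (fun y : Fin N → ℝ => y i) x :=
    fun i => (contDiff_apply ℝ ℝ i).contDiffAt
  exact ((m.contDiffAt_α (hx i)).comp x (hc i)).mul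
    (ContDiffAt.comp (g := fun y : ℝ × ℝ => m.β y.1 y.2) (f := fun y : Fin N → ℝ => (y i, y (i + 1)))
      x (m.contDiffAt_β (hx i)) ((hc i).prodMk (hc (i + 1))))

omit [NeZero N] in
theorem contDiff_eval {ζ : ℝ → ℂ} {r : WithTop ℕ∞} (hζ : ContDiff ℝ r ζ) (P : Poly N) :
    ContDiff ℝ r fun x : Fin N → ℝ => eval (fun i => ζ (x i)) P := by
  induction P using MvPolynomial.induction_on with
  | C c => simpa using contDiff_const
  | add p q hp hq => simpa using hp.add hq
  | mul_X p j hp => simpa using hp.mul (hζ.comp (contDiff_apply ℝ ℝ j))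

theorem LocalModel.contDiffOn_physical (m : LocalModel ε η a b ω) (hN : 2 ≤ N) (Φ : State N k) :
    ContDiffOn ℝ ((⊤ : ℕ∞) : WithTop ℕ∞) (physical ε η a b ω Φ) (configSpace N ε) := by
  refine contDiffOn_pi.2 fun s x hx => ContDiffAt.contDiffWithinAt ?_
  exact (Complex.ofRealCLM.contDiff.contDiffAt.comp x
    (m.contDiffAt_gaugeFactor (m.dom_of_mem hN x hx))).mul
    (contDiff_eval m.contDiff_ζ (Φ s)).contDiffAt

/-- The intervals lie in increasing order inside `(0, 1)`, where all distances are less than `π`. -/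
theorem mem_configSpace_of_mem_Ioo (hN : 2 ≤ N) (ε : Fin 3) {t : Fin N → ℝ}
    (ht : ∀ i : Fin N, t i ∈ Set.Ioo (((i : ℕ) : ℝ) / N) ((((i : ℕ) : ℝ) + 1) / N)) : t ∈ configSpace N ε := by
  have hN0 : (0 : ℝ) < N := by exact_mod_cast NeZero.pos N
  have hmono : StrictMono t := by
    intro i j hij
    refine (ht i).2.trans_le (le_trans ?_ (ht j).1.le)
    rw [div_le_div_iff_of_pos_right hN0]
    exact_mod_cast hij
  have hpos : ∀ i, 0 < t i := fun i => lt_of_le_of_lt (by positivity) (ht i).1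
  have hlt : ∀ i, t i < 1 := by
    intro i
    refine (ht i).2.trans_le ?_
    rw [div_le_one hN0]
    exact_mod_cast i.isLt
  fin_cases ε
  · exact hmono
  · exact ⟨hmono, hpos 0⟩
  -- The domain of the trigonometric model does not depend on the parameters, so any values serve.
  · exact ⟨hmono, fun i => (trigModel 1 0 0 0).dom_of_lt_one (hpos _) (hlt _) (hpos _) (hlt _)
      (strictMono_ne hN hmono i)⟩

/-- If `Ψ` vanished, each component of `Φ` would vanish on the image of the box under `ζ`, a product
of infinite sets, and so be the zero polynomial. -/
theorem LocalModel.exists_physical_ne_zero (m : LocalModel ε η a b ω) (hN : 2 ≤ N)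
    {Φ : State N k} (hΦ : Φ ≠ 0) : ∃ x ∈ configSpace N ε, physical ε η a b ω Φ x ≠ 0 := by
  by_contra! h
  refine hΦ (funext fun s => ?_)
  have hN0 : (0 : ℝ) < N := by exact_mod_cast NeZero.pos N
  refine MvPolynomial.funext_set
    (fun i : Fin N => changeVar ε η '' Set.Ioo (((i : ℕ) : ℝ) / N) ((((i : ℕ) : ℝ) + 1) / N)) (fun i => ?_) ?_
  · have hlt : ((i : ℕ) : ℝ) / N < (((i : ℕ) : ℝ) + 1) / N := by
      rw [div_lt_div_iff_of_pos_right hN0]; linarith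
    refine (Set.Ioo_infinite hlt).image fun u hu v hv huv => ?_
    by_contra hne
    have h0 : (0 : ℝ) ≤ ((i : ℕ) : ℝ) / N := by positivity
    have h1 : (((i : ℕ) : ℝ) + 1) / N ≤ 1 := by
      rw [div_le_one hN0]
      exact_mod_cast i.isLt
    exact m.changeVar_ne (m.dom_of_lt_one (h0.trans_lt hu.1) (hu.2.trans_le h1)
      (h0.trans_lt hv.1) (hv.2.trans_le h1) hne) huv
  · intro z hz
    choose t ht hzt using fun i => hz i (Set.mem_univ i)
    obtain rfl : (fun i => changeVar ε η (t i)) = z := funext hzt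
    have hmem := mem_configSpace_of_mem_Ioo hN ε ht
    have h1 := congrFun (h t hmem) s
    have hd := m.dom_of_mem hN t hmem
    have hg : (gaugeFactor ε a b ω t : ℂ) ≠ 0 := by
      rw [m.gaugeFactor_eq]
      exact_mod_cast Finset.prod_ne_zero_iff.2 fun i _ =>
        mul_ne_zero (m.α_ne_zero (hd i)) (m.β_ne_zero (hd i))
    simpa [hg, physical] using h1

end

end QES

/-! ### Assembly of the three claims. -/

theorem corollary1 (N : ℕ) [NeZero N] (hN : 2 ≤ N) (k n : ℕ) (ε : Fin 3) (η : ℤˣ) (a b ω : ℝ) :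
    -- the gauge Hamiltonian is defined on the space and leaves it invariant
    (∀ Φ ∈ QES.invSpace N k n ε, ∃ Ψ ∈ QES.invSpace N k n ε, QES.GaugeMaps ε a b ω Φ Ψ) ∧
    -- on this space it is carried to the physical Hamiltonian by `Φ ↦ μ · Φ ∘ ζ`
    (∀ Φ ∈ QES.invSpace N k n ε, ∀ Ψ : QES.State N k, QES.GaugeMaps ε a b ω Φ Ψ →
      ∀ x ∈ QES.configSpace N ε,
        QES.ham ε a b ω (QES.physical ε η a b ω Φ) x = QES.physical ε η a b ω Ψ x) ∧
    -- its eigenvectors in this space yield eigenfunctions of the physical Hamiltonian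
    (∀ Φ ∈ QES.invSpace N k n ε, Φ ≠ 0 → ∀ E : ℂ, QES.GaugeMaps ε a b ω Φ (E • Φ) →
      QES.IsEigenfunction ε a b ω E (QES.physical ε η a b ω Φ)) := by
  let m := QES.localModel ε η a b ω
  have hsymm : ∀ Φ ∈ QES.invSpace N k n ε, Φ ∈ QES.symmetricStates N k :=
    fun _ h => QES.invSpace_le_symmetricStates ε h
  refine ⟨fun Φ hΦ => QES.invSpace_le_preimage hN ε a b ω hΦ,
    fun Φ hΦ Ψ h x hx => m.ham_physical hN (hsymm Φ hΦ) h hx,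
    fun Φ hΦ hne E h => ⟨m.contDiffOn_physical hN Φ, m.exists_physical_ne_zero hN hne,
      fun x hx => ?_⟩⟩
  rw [m.ham_physical hN (hsymm Φ hΦ) h hx]
  funext s
  simp only [QES.physical, Pi.smul_apply, smul_eq_mul, MvPolynomial.smul_eval]
  ring
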